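/- **Setting.** For a closed interval $\Delta=[\alpha,\beta]\subset\mathbb R$, $\alpha<\beta$, let $D_\Delta=\overline{\mathbb C}\setminus\Delta$, let $d\omega_\Delta(x)=\frac{dx}{\pi\sqrt{(x-\alpha)(\beta-x)}}$ be the arcsine distribution on $\Delta$, let $w_\Delta(z)=\sqrt{(z-\alpha)(z-\beta)}$ be the branch holomorphic off $\Delta$ with $w_\Delta(z)=z+O(1)$ at $\infty$, and let $\phi_\Delta$ be the conformal map of $D_\Delta$ onto the unit disk $\mathbb D$ with $\phi_\Delta(\infty)=0$, $\phi_\Delta(\beta)=1$. $H^2(D_\Delta)$ is the space of holomorphic functions $f$ in $D_\Delta$ such that $|f|^2$ has a harmonic majorant in $D_\Delta$; $G$ is an outer function in $H^2(D_\Delta)$ if $G\in H^2(D_\Delta)$ and $G\circ\phi_\Delta^{-1}$ is an outer function in $H^2(\mathbb D)$, that is, of the form $e^{i\gamma}\exp\big(\frac1{2\pi}\int_0^{2\pi}\frac{e^{it}+\zeta}{e^{it}-\zeta}\log\psi(t)\,dt\big)$ with $\gamma\in\mathbb R$, $\psi\ge0$, $\log\psi\in L^1$, $\psi\in L^2$.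 $G$ is conjugate-symmetric if $G(\bar z)=\overline{G(z)}$, and $G_\pm$ denote the non-tangential limits of $G$ on $\Delta$ from the upper and lower half-planes. For $f>0$ on $\Delta$ with $\log f\in L^1(\omega_\Delta)$ put $$\Omega_\Delta(f,z)=\exp\Big(w_\Delta(z)\int_\Delta\frac{\log f(x)}{z-x}\,d\omega_\Delta(x)\Big),\qquad \Omega_\Delta(f,\infty)=\exp\Big(\int_\Delta\log f\,d\omega_\Delta\Big),$$ and $(H_\Delta u)(z)=\log|\Omega_\Delta(e^u,z)|$ for $z\in D_\Delta$ and $u\in L^1(\omega_\Delta)$. For a finite compactly supported positive Borel measure $\mu$ on $\mathbb R$, write $\mu\in\mathrm{Sz}(\Delta)$ if $\Delta$ lies in the convex hull of $\mathrm{supp}\,\mu$ and $\log\mu'\in L^1(\omega_\Delta)$, where $\mu'$ is the Lebesgue density of the absolutely continuous part of $\mu$; let $v_\Delta$ be the Radon–Nikodym derivative of $\mu_{|\Delta}$ with respect to $\omega_\Delta$. **Proposition.** Let $\Delta_1,\dots,\Delta_d$ be pairwise disjoint closed intervals as above, and let $\mu_1,\dots,\mu_d$ be finite compactly supported positive Borel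 measures on $\mathbb R$ with $\mu_i\in\mathrm{Sz}(\Delta_i)$ and densities $v_{\Delta_i}$. Then there is a unique collection of functions $S_i:D_{\Delta_i}\to\mathbb C$, $i=1,\dots,d$, such that each $S_i$ is a conjugate-symmetric outer function in $H^2(D_{\Delta_i})$ with $S_i(\infty)>0$, and for every $i$ $$|S_{i\pm}(x)|^2\prod_{j\ne i}S_j(x)=v_{\Delta_i}(x)\qquad\text{for a.e. }x\in\Delta_i .$$ Moreover, $S_i=\Omega_{\Delta_i}(e^{s_i},\cdot)$ on $D_{\Delta_i}$, where $(s_1,\dots,s_d)\in\prod_i L^1(\omega_{\Delta_i})$ is the unique (up to a.e. equality) solution of $$s_i+\frac12\sum_{j\ne i}H_{\Delta_j}s_j=\frac12\log v_{\Delta_i}\quad\text{a.e. on }\Delta_i,\qquad i=1,\dots,d .$$ -/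

import Mathlib

open MeasureTheory Filter Topology

namespace SzegoSystem

noncomputable section

/-- The domain `D_Δ`, the complement of `Δ = [α, β]` in the Riemann sphere `OnePoint ℂ`. -/
def slitSphere (α β : ℝ) : Set (OnePoint ℂ) :=
  {z | ∀ x ∈ Set.Icc α β, z ≠ (((x : ℝ) : ℂ) : OnePoint ℂ)}

/-- The chart `w ↦ 1 / w` of the Riemann sphere around `∞`. -/
def chartAtInfty (w : ℂ) : OnePoint ℂ :=
  if w = 0 then OnePoint.infty else ((w⁻¹ : ℂ) : OnePoint ℂ)

/-- `f` is holomorphic at every point of the open set `U` of the Riemann sphere. -/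
def IsHolomorphicOn (f : OnePoint ℂ → ℂ) (U : Set (OnePoint ℂ)) : Prop :=
  (∀ z : ℂ, (z : OnePoint ℂ) ∈ U → DifferentiableAt ℂ (fun w : ℂ => f (w : OnePoint ℂ)) z) ∧
  (OnePoint.infty ∈ U → DifferentiableAt ℂ (fun w : ℂ => f (chartAtInfty w)) 0)

/-- `u` is harmonic at every point of the open set `U` of the Riemann sphere. -/
def IsHarmonicOn (u : OnePoint ℂ → ℝ) (U : Set (OnePoint ℂ)) : Prop :=
  (∀ z : ℂ, (z : OnePoint ℂ) ∈ U →
    InnerProductSpace.HarmonicAt (fun w : ℂ => u (w : OnePoint ℂ)) z) ∧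
  (OnePoint.infty ∈ U → InnerProductSpace.HarmonicAt (fun w : ℂ => u (chartAtInfty w)) 0)

/-- The Hardy space `H²(D_Δ)`: holomorphic functions in `D_Δ` whose squared modulus has a
harmonic majorant in `D_Δ`. -/
def MemHardyTwo (α β : ℝ) (f : OnePoint ℂ → ℂ) : Prop :=
  IsHolomorphicOn f (slitSphere α β) ∧
  ∃ u : OnePoint ℂ → ℝ, IsHarmonicOn u (slitSphere α β) ∧
    ∀ z ∈ slitSphere α β, ‖f z‖ ^ 2 ≤ u z

/-- `F` is an outer function in `H²(𝔻)`:
`F z = e^{iγ} exp ((1 / 2π) ∫₀^{2π} (e^{it} + z) / (e^{it} - z) * log ψ(t) dt)` on the unit disk,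
where `γ` is real, `log ψ ∈ L¹` and `ψ ∈ L²`. The density `ψ ≥ 0` is a.e. positive because
`log ψ ∈ L¹` (with `log 0 = -∞`), so it is taken to be positive everywhere. -/
def IsOuterOnDisk (F : ℂ → ℂ) : Prop :=
  ∃ (γ : ℝ) (ψ : ℝ → ℝ), (∀ t, 0 < ψ t) ∧
    IntegrableOn (fun t => Real.log (ψ t)) (Set.Ioc 0 (2 * Real.pi)) ∧
    IntegrableOn (fun t => ψ t ^ 2) (Set.Ioc 0 (2 * Real.pi)) ∧
    ∀ z : ℂ, ‖z‖ < 1 →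
      F z = Complex.exp (γ * Complex.I) *
        Complex.exp ((1 / (2 * Real.pi) : ℂ) * ∫ t in Set.Ioc 0 (2 * Real.pi),
          (Complex.exp (t * Complex.I) + z) / (Complex.exp (t * Complex.I) - z)
            * (Real.log (ψ t) : ℂ))

/-- The inverse of the conformal map `φ_Δ` of `D_Δ` onto the unit disk with `φ_Δ(∞) = 0` and
`φ_Δ(β) = 1`. Explicitly, `ζ ↦ (α + β) / 2 + (β - α) / 4 * (ζ + 1 / ζ)` and `0 ↦ ∞`. -/
def diskToSlit (α β : ℝ) (ζ : ℂ) : OnePoint ℂ :=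
  if ζ = 0 then OnePoint.infty
  else (((α + β : ℂ) / 2 + (β - α : ℂ) / 4 * (ζ + ζ⁻¹) : ℂ) : OnePoint ℂ)

/-- `G` is an outer function in `H²(D_Δ)`: it lies in `H²(D_Δ)` and `G ∘ φ_Δ⁻¹` is an outer
function in `H²(𝔻)`. -/
def IsOuter (α β : ℝ) (G : OnePoint ℂ → ℂ) : Prop :=
  MemHardyTwo α β G ∧ IsOuterOnDisk (fun ζ => G (diskToSlit α β ζ))

/-- `f (conj z) = conj (f z)` on `D_Δ`, where `conj ∞ = ∞`. -/
def IsConjSymm (α β : ℝ) (f : OnePoint ℂ → ℂ) : Prop :=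
  ∀ z ∈ slitSphere α β, f (OnePoint.map (starRingEnd ℂ) z) = starRingEnd ℂ (f z)

/-- The non-tangential limit of `f` at the real point `x` from the upper half-plane is `ℓ`. -/
def HasLimitAbove (f : OnePoint ℂ → ℂ) (x : ℝ) (ℓ : ℂ) : Prop :=
  ∀ M : ℝ, 0 < M → Tendsto (fun z : ℂ => f (z : OnePoint ℂ))
    (𝓝[{z : ℂ | |z.re - x| < M * z.im}] (x : ℂ)) (𝓝 ℓ)

/-- The non-tangential limit of `f` at the real point `x` from the lower half-plane is `ℓ`. -/
def HasLimitBelow (f : OnePoint ℂ → ℂ) (x : ℝ) (ℓ : ℂ) : Prop :=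
  ∀ M : ℝ, 0 < M → Tendsto (fun z : ℂ => f (z : OnePoint ℂ))
    (𝓝[{z : ℂ | |z.re - x| < M * (-z.im)}] (x : ℂ)) (𝓝 ℓ)

/-- The arcsine distribution `dω_Δ(x) = dx / (π √((x - α) (β - x)))` on `Δ = [α, β]`. -/
def arcsine (α β : ℝ) : Measure ℝ :=
  (volume.restrict (Set.Icc α β)).withDensity
    (fun x => ENNReal.ofReal (1 / (Real.pi * Real.sqrt ((x - α) * (β - x)))))

/-- `μ ∈ Sz(Δ)`: the measure `μ` is compactly supported, `Δ` lies in the convex hull of the support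
of `μ`, and `log μ' ∈ L¹(ω_Δ)`, where `μ'` is the Lebesgue density of the absolutely continuous part
of `μ`. Since `Real.log 0 = 0`, the a.e. positivity of `μ'` on `Δ` is stated separately. -/
structure IsSzego (μ : Measure ℝ) (α β : ℝ) : Prop where
  isCompact_support : IsCompact μ.support
  subset_hull : Set.Icc α β ⊆ convexHull ℝ μ.support
  pos : ∀ᵐ x ∂(arcsine α β), 0 < (μ.rnDeriv volume x).toReal
  integrable_log : Integrable (fun x => Real.log (μ.rnDeriv volume x).toReal) (arcsine α β)

/-- `v_Δ`, the Radon-Nikodym derivative of `μ` restricted to `Δ` with respect to `ω_Δ`. -/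
def szegoDensity (μ : Measure ℝ) (α β : ℝ) (x : ℝ) : ℝ :=
  ((μ.restrict (Set.Icc α β)).rnDeriv (arcsine α β) x).toReal

/-- `w_Δ(z) = √((z - α) (z - β))`, the branch holomorphic off `Δ` with `w_Δ(z) = z + O(1)`
at `∞`. The quotient `(z - β) / (z - α)` avoids `(-∞, 0]` off `Δ`. -/
def slitSqrt (α β : ℝ) (z : ℂ) : ℂ :=
  (z - α) * ((z - β) / (z - α)) ^ (1 / 2 : ℂ)

/-- `Ω_Δ(f, z) = exp (w_Δ(z) ∫ log f(x) / (z - x) dω_Δ(x))`, and its value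
`exp (∫ log f dω_Δ)` at `∞`. -/
def outerFun (α β : ℝ) (f : ℝ → ℝ) : OnePoint ℂ → ℂ
  | none => Complex.exp (∫ x, (Real.log (f x) : ℂ) ∂(arcsine α β))
  | some z => Complex.exp
      (slitSqrt α β z * ∫ x, (Real.log (f x) : ℂ) / (z - x) ∂(arcsine α β))

/-- `(H_Δ u)(z) = log |Ω_Δ(e^u, z)|`, the solution of the Dirichlet problem in `D_Δ` with boundary
data `u`. -/
def dirichlet (α β : ℝ) (u : ℝ → ℝ) (z : OnePoint ℂ) : ℝ :=
  Real.log ‖outerFun α β (fun x => Real.exp (u x)) z‖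

/-- The `i`-th component of `ℋ u`, where `ℋ = -(1/2) (H_{Δ_j → Δ_i})_{i,j}` with zero diagonal. -/
def operH {d : ℕ} (α β : Fin d → ℝ) (u : Fin d → ℝ → ℝ) (i : Fin d) (x : ℝ) : ℝ :=
  -(1 / 2) * ∑ j ∈ Finset.univ.erase i, dirichlet (α j) (β j) (u j) (((x : ℝ) : ℂ) : OnePoint ℂ)

/-- `s ∈ ∏ L¹(ω_{Δ_i})` solves `(I - ℋ) s = a` with `a_i = (1/2) log v_{Δ_i}`. -/
def SolvesSystem {d : ℕ} (α β : Fin d → ℝ) (μ : Fin d → Measure ℝ) (s : Fin d → ℝ → ℝ) : Prop :=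
  ∀ i, Integrable (s i) (arcsine (α i) (β i)) ∧
    ∀ᵐ x ∂(arcsine (α i) (β i)),
      s i x - operH α β s i x = 1 / 2 * Real.log (szegoDensity (μ i) (α i) (β i) x)

/-- Each `S i` is a conjugate-symmetric outer function in `H²(D_{Δ_i})` with `S i ∞ > 0`, and
`|S_{i±}(x)|² ∏_{j ≠ i} S_j(x) = v_{Δ_i}(x)` for a.e. `x ∈ Δ_i`. -/
def IsSzegoFamily {d : ℕ} (α β : Fin d → ℝ) (μ : Fin d → Measure ℝ)
    (S : Fin d → OnePoint ℂ → ℂ) : Prop :=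
  ∀ i, IsOuter (α i) (β i) (S i) ∧ IsConjSymm (α i) (β i) (S i) ∧
    ((S i OnePoint.infty).im = 0 ∧ 0 < (S i OnePoint.infty).re) ∧
    ∀ᵐ x : ℝ, x ∈ Set.Icc (α i) (β i) →
      ∃ p m : ℂ, HasLimitAbove (S i) x p ∧ HasLimitBelow (S i) x m ∧
        ((‖p‖ ^ 2 : ℝ) : ℂ) * ∏ j ∈ Finset.univ.erase i, S j (((x : ℝ) : ℂ) : OnePoint ℂ)
          = (szegoDensity (μ i) (α i) (β i) x : ℂ) ∧
        ((‖m‖ ^ 2 : ℝ) : ℂ) * ∏ j ∈ Finset.univ.erase i, S j (((x : ℝ) : ℂ) : OnePoint ℂ)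
          = (szegoDensity (μ i) (α i) (β i) x : ℂ)

end

end SzegoSystem

namespace SzegoSystem

/-! Taking logarithms makes the nonlinear boundary problem linear. For real `s` integrable against
the arcsine measure, `exp (schwarz s)` is conjugate-symmetric and positive at infinity, its
nontangential limits on the slit have modulus `exp s` a.e., and on the real axis off the slit it is
the positive number `exp (dirichlet s)`. Conversely, every conjugate-symmetric outer function
positive at infinity has this form (`IsOuter.exists_eq_cexp_schwarz`). The relation on Δ_i becomes
`2 s_i + Σ_{j ≠ i} H_j s_j = log v_i`, so existence, uniqueness and the formula for `S_i` all reduce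
to the unique solvability of `s - ℋ s = a` in the product of the spaces L¹(ω_i).

The intervals being disjoint, ℋ evaluates harmonic functions only at positive distance from the
slits carrying their data. Hence it sends L¹ data to continuous functions and is compact on
continuous functions (`isCompactOperator_operHCLM`). By the Fredholm alternative it suffices that 1
is not an eigenvalue. Passing to L¹ costs nothing: a solution has the form `a + t` with `t`
continuous and `t - ℋ t = ℋ a`, and the difference of two solutions is a.e. equal to its image under
ℋ, hence to a continuous function.

Injectivity (`eq_of_system_const`) is a maximum principle argument. Let U be the sum of all `H_k
s_k`, extended by boundary values. A system with constant right-hand side c says U + s_j = c on Δ_j.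
U attains its maximum over the sphere at some x₀ in some Δ_i, and s_i is minimal there. Leaving x₀
along the Joukowsky image of a radius, `H_i s_i` grows at least linearly (Harnack) unless the mean
of s_i equals its minimum; the other terms are harmonic near x₀ and symmetric in the real axis, so
their derivative in that direction vanishes. Maximality therefore forces `H_i s_i` to be constant;
dropping i leaves a smaller system with another constant, and induction applies.

The analysis is carried to the disk by the Joukowsky map: the slit integral is the Herglotz integral
of the data lifted symmetrically to the circle (`herglotzIntegral_liftCircle`). Boundary limits come
from Fatou's theorem (`ae_tendsto_poissonAngle`) and from writing an outer function as a quotient of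
bounded ones (`ae_exists_tendsto_cexp_herglotzIntegral`). -/

/-- The map `ζ ↦ (α + β) / 2 + (β - α) / 4 * (ζ + 1 / ζ)` of the punctured disk onto `ℂ ∖ [α, β]`. -/
noncomputable def joukowsky (α β : ℝ) (ζ : ℂ) : ℂ :=
  (α + β : ℂ) / 2 + (β - α : ℂ) / 4 * (ζ + ζ⁻¹)

/-- The projection `cos t ↦ x` of the unit circle onto `[α, β]`, in terms of the cosine `y`. -/
noncomputable def affinePoint (α β y : ℝ) : ℝ := (α + β) / 2 + (β - α) / 2 * y

/-- The function `s` on `[α, β]`, transported to the unit circle. -/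
noncomputable def liftCircle {E : Type*} (α β : ℝ) (s : ℝ → E) (z : ℂ) : E :=
  s (affinePoint α β z.re)

theorem diskToSlit_of_ne_zero {α β : ℝ} {ζ : ℂ} (h : ζ ≠ 0) :
    diskToSlit α β ζ = ((joukowsky α β ζ : ℂ) : OnePoint ℂ) := by
  simp [diskToSlit, joukowsky, h]

theorem diskToSlit_zero {α β : ℝ} : diskToSlit α β 0 = OnePoint.infty := by
  simp [diskToSlit]

/-! ### The Joukowsky map and the conformal map of the slit domain onto the disk. -/

section Geometry

variable {α β : ℝ}

theorem joukowsky_sub_left {ζ : ℂ} (h : ζ ≠ 0) :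
    joukowsky α β ζ - α = (β - α) / 4 * ((1 + ζ) ^ 2 / ζ) := by
  unfold joukowsky; field_simp; ring

theorem joukowsky_sub_right {ζ : ℂ} (h : ζ ≠ 0) :
    joukowsky α β ζ - β = (β - α) / 4 * ((1 - ζ) ^ 2 / ζ) := by
  unfold joukowsky; field_simp; ring

theorem norm_ofReal_sub_eq (hαβ : α < β) : ‖((β : ℂ) - α) / 4‖ = (β - α) / 4 := by
  rw [← Complex.ofReal_sub, norm_div, Complex.norm_real, Real.norm_of_nonneg (by linarith)]
  norm_num

/-- The image of the circle `|ζ| = r` is an ellipse with foci `α` and `β`. -/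
theorem norm_sub_add_norm_sub_joukowsky (hαβ : α < β) {ζ : ℂ} (h : ζ ≠ 0) :
    ‖joukowsky α β ζ - α‖ + ‖joukowsky α β ζ - β‖ = (β - α) / 2 * (‖ζ‖ + ‖ζ‖⁻¹) := by
  rw [joukowsky_sub_left h, joukowsky_sub_right h, norm_mul, norm_mul, norm_ofReal_sub_eq hαβ,
    norm_div, norm_div, norm_pow, norm_pow]
  have h1 : ‖1 + ζ‖ ^ 2 + ‖1 - ζ‖ ^ 2 = 2 * (1 + ‖ζ‖ ^ 2) := by
    have := parallelogram_law_with_norm ℝ (1 : ℂ) ζ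
    simp only [norm_one] at this
    nlinarith
  have h0 : ‖ζ‖ ≠ 0 := norm_ne_zero_iff.2 h
  calc _ = (β - α) / 4 * ((‖1 + ζ‖ ^ 2 + ‖1 - ζ‖ ^ 2) / ‖ζ‖) := by ring
    _ = _ := by rw [h1]; field_simp; ring

theorem coe_mem_slitSphere {z : ℂ} :
    (z : OnePoint ℂ) ∈ slitSphere α β ↔ ∀ x ∈ Set.Icc α β, z ≠ (x : ℂ) := by
  simp [slitSphere]

theorem infty_mem_slitSphere : OnePoint.infty ∈ slitSphere α β := by
  intro x _
  exact OnePoint.infty_ne_coe _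

theorem norm_sub_add_norm_sub_of_mem {x : ℝ} (hx : x ∈ Set.Icc α β) :
    ‖(x : ℂ) - α‖ + ‖(x : ℂ) - β‖ = β - α := by
  rw [← Complex.ofReal_sub, ← Complex.ofReal_sub, Complex.norm_real, Complex.norm_real,
    Real.norm_of_nonneg (by linarith [hx.1]), Real.norm_of_nonpos (by linarith [hx.2])]
  ring

theorem two_lt_add_inv {r : ℝ} (h0 : 0 < r) (h1 : r < 1) : 2 < r + r⁻¹ := by
  have : r + r⁻¹ - 2 = (1 - r) ^ 2 / r := by field_simp; ring
  have h2 : 0 < (1 - r) ^ 2 / r := div_pos (pow_pos (by linarith) 2) h0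
  linarith

/-- Points of the slit have focal distance sum β - α, while the ellipse belonging to a radius below
1 has a strictly larger sum. -/
theorem joukowsky_mem (hαβ : α < β) {ζ : ℂ} (h : ζ ≠ 0) (h1 : ‖ζ‖ < 1) :
    ((joukowsky α β ζ : ℂ) : OnePoint ℂ) ∈ slitSphere α β := by
  rw [coe_mem_slitSphere]
  intro x hx he
  have h2 := norm_sub_add_norm_sub_joukowsky hαβ h
  rw [he, norm_sub_add_norm_sub_of_mem hx] at h2
  nlinarith [two_lt_add_inv (norm_pos_iff.2 h) h1]

theorem diskToSlit_mem (hαβ : α < β) {ζ : ℂ} (h1 : ‖ζ‖ < 1) :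
    diskToSlit α β ζ ∈ slitSphere α β := by
  by_cases h : ζ = 0
  · rw [h, diskToSlit_zero]; exact infty_mem_slitSphere
  · rw [diskToSlit_of_ne_zero h]; exact joukowsky_mem hαβ h h1

theorem joukowsky_of_norm_eq_one {ζ : ℂ} (h : ‖ζ‖ = 1) :
    joukowsky α β ζ = (affinePoint α β ζ.re : ℝ) := by
  have : ζ⁻¹ = starRingEnd ℂ ζ := Complex.inv_eq_conj h
  rw [joukowsky, this, Complex.add_conj, affinePoint]
  push_cast; ring

theorem affinePoint_mem (hαβ : α < β) {y : ℝ} (h : y ∈ Set.Icc (-1) 1) :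
    affinePoint α β y ∈ Set.Icc α β := by
  unfold affinePoint
  constructor <;> nlinarith [h.1, h.2]

theorem affinePoint_re_mem (hαβ : α < β) {ζ : ℂ} (h : ‖ζ‖ = 1) :
    affinePoint α β ζ.re ∈ Set.Icc α β := by
  refine affinePoint_mem hαβ (abs_le.1 ?_)
  exact h ▸ Complex.abs_re_le_norm ζ

/-- The preimages of z are the two roots of a quadratic with product 1. Neither lies on the unit
circle, which maps into the slit, so exactly one lies inside. -/
theorem exists_joukowsky_eq (hαβ : α < β) {z : ℂ} (hz : (z : OnePoint ℂ) ∈ slitSphere α β) :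
    ∃ ζ : ℂ, ζ ≠ 0 ∧ ‖ζ‖ < 1 ∧ joukowsky α β ζ = z := by
  have hne : ((β : ℂ) - α) ≠ 0 := by
    rw [← Complex.ofReal_sub]; exact_mod_cast (sub_pos.2 hαβ).ne'
  set Y : ℂ := (z - (α + β) / 2) * (2 / (β - α)) with hY
  obtain ⟨q, hq⟩ := IsAlgClosed.exists_pow_nat_eq (Y ^ 2 - 1) (n := 2) (by norm_num)
  have hmul : (Y - q) * (Y + q) = 1 := by linear_combination -hq
  have key : ∀ ζ : ℂ, ∀ ζ' : ℂ, ζ * ζ' = 1 → ζ + ζ' = 2 * Y → joukowsky α β ζ = z := by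
    intro ζ ζ' h1 h2
    have h3 : ζ⁻¹ = ζ' := inv_eq_of_mul_eq_one_right h1
    rw [joukowsky, h3, h2, hY]
    field_simp; ring
  have hnorm : ∀ ζ : ℂ, joukowsky α β ζ = z → ‖ζ‖ ≠ 1 := by
    intro ζ h1 h2
    rw [joukowsky_of_norm_eq_one h2] at h1
    exact (coe_mem_slitSphere.1 hz) _ (affinePoint_re_mem hαβ h2) h1.symm
  have hn : ‖Y - q‖ * ‖Y + q‖ = 1 := by rw [← norm_mul, hmul, norm_one]
  rcases lt_or_ge ‖Y - q‖ 1 with h | h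
  · exact ⟨Y - q, left_ne_zero_of_mul_eq_one hmul, h, key _ _ hmul (by ring)⟩
  · have h2 : joukowsky α β (Y + q) = z := key (Y + q) (Y - q) (by rw [mul_comm, hmul]) (by ring)
    refine ⟨Y + q, right_ne_zero_of_mul_eq_one hmul, lt_of_le_of_ne ?_ (hnorm _ h2), h2⟩
    nlinarith [norm_nonneg (Y + q)]

theorem re_mobius_pos {ζ : ℂ} (h1 : ‖ζ‖ < 1) : 0 < ((1 - ζ) / (1 + ζ)).re := by
  have h2 : Complex.normSq ζ < 1 := by
    rw [Complex.normSq_eq_norm_sq]; nlinarith [norm_nonneg ζ]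
  have h3 : 0 < Complex.normSq (1 + ζ) := by
    rw [Complex.normSq_pos]
    intro h
    have : ζ = -1 := by linear_combination h
    rw [this] at h1; simp at h1
  rw [Complex.div_re, ← add_div]
  refine div_pos ?_ h3
  rw [Complex.normSq_apply] at h2
  simp
  nlinarith

theorem quotient_joukowsky (hαβ : α < β) {ζ : ℂ} (h : ζ ≠ 0) :
    (joukowsky α β ζ - β) / (joukowsky α β ζ - α) = ((1 - ζ) / (1 + ζ)) ^ 2 := by
  have hne : ((β : ℂ) - α) ≠ 0 := by
    rw [← Complex.ofReal_sub]; exact_mod_cast (sub_pos.2 hαβ).ne'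
  rw [joukowsky_sub_left h, joukowsky_sub_right h, div_pow]
  by_cases h2 : 1 + ζ = 0
  · simp [h2]
  · field_simp

theorem one_add_ne_zero_of_norm_lt {ζ : ℂ} (h1 : ‖ζ‖ < 1) : 1 + ζ ≠ 0 := by
  intro h
  have : ζ = -1 := by linear_combination h
  rw [this] at h1; simp at h1

/-- The quotient under the root is the square of (1 - ζ)/(1 + ζ), which has positive real part, so
the principal branch returns that number itself. -/
theorem slitSqrt_joukowsky (hαβ : α < β) {ζ : ℂ} (h : ζ ≠ 0) (h1 : ‖ζ‖ < 1) :
    slitSqrt α β (joukowsky α β ζ) = (β - α) / 4 * (ζ⁻¹ - ζ) := by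
  rw [slitSqrt, quotient_joukowsky hαβ h, one_div, Complex.sq_cpow_two_inv (re_mobius_pos h1),
    joukowsky_sub_left h]
  have := one_add_ne_zero_of_norm_lt h1
  field_simp
  ring

/-- The conformal map of `ℂ ∖ [α, β]` onto the punctured disk. -/
noncomputable def slitToDisk (α β : ℝ) : OnePoint ℂ → ℂ
  | none => 0
  | some z => (z - (α + β) / 2 - slitSqrt α β z) * (2 / (β - α))

theorem slitToDisk_infty : slitToDisk α β OnePoint.infty = 0 := rfl

theorem slitToDisk_coe (z : ℂ) : slitToDisk α β (z : OnePoint ℂ) =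
    (z - (α + β) / 2 - slitSqrt α β z) * (2 / (β - α)) := rfl

theorem slitToDisk_joukowsky (hαβ : α < β) {ζ : ℂ} (h : ζ ≠ 0) (h1 : ‖ζ‖ < 1) :
    slitToDisk α β ((joukowsky α β ζ : ℂ) : OnePoint ℂ) = ζ := by
  have hne : ((β : ℂ) - α) ≠ 0 := by
    rw [← Complex.ofReal_sub]; exact_mod_cast (sub_pos.2 hαβ).ne'
  rw [slitToDisk_coe, slitSqrt_joukowsky hαβ h h1, joukowsky]
  field_simp
  ring

theorem slitToDisk_diskToSlit (hαβ : α < β) {ζ : ℂ} (h1 : ‖ζ‖ < 1) :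
    slitToDisk α β (diskToSlit α β ζ) = ζ := by
  by_cases h : ζ = 0
  · rw [h, diskToSlit_zero, slitToDisk_infty]
  · rw [diskToSlit_of_ne_zero h, slitToDisk_joukowsky hαβ h h1]

theorem exists_diskToSlit_eq (hαβ : α < β) {z : OnePoint ℂ} (hz : z ∈ slitSphere α β) :
    ∃ ζ : ℂ, ‖ζ‖ < 1 ∧ diskToSlit α β ζ = z := by
  induction z using OnePoint.rec with
  | infty => exact ⟨0, by simp, diskToSlit_zero⟩
  | coe z =>
    obtain ⟨ζ, h0, h1, h2⟩ := exists_joukowsky_eq hαβ hz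
    exact ⟨ζ, h1, by rw [diskToSlit_of_ne_zero h0, h2]⟩

theorem norm_slitToDisk_lt (hαβ : α < β) {z : OnePoint ℂ} (hz : z ∈ slitSphere α β) :
    ‖slitToDisk α β z‖ < 1 := by
  obtain ⟨ζ, h1, rfl⟩ := exists_diskToSlit_eq hαβ hz
  rwa [slitToDisk_diskToSlit hαβ h1]

theorem diskToSlit_slitToDisk (hαβ : α < β) {z : OnePoint ℂ} (hz : z ∈ slitSphere α β) :
    diskToSlit α β (slitToDisk α β z) = z := by
  obtain ⟨ζ, h1, rfl⟩ := exists_diskToSlit_eq hαβ hz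
  rw [slitToDisk_diskToSlit hαβ h1]

theorem joukowsky_conj (ζ : ℂ) :
    joukowsky α β (starRingEnd ℂ ζ) = starRingEnd ℂ (joukowsky α β ζ) := by
  simp [joukowsky, map_ofNat]

theorem slitSqrt_conj (hαβ : α < β) {z : ℂ} (hz : (z : OnePoint ℂ) ∈ slitSphere α β) :
    slitSqrt α β (starRingEnd ℂ z) = starRingEnd ℂ (slitSqrt α β z) := by
  obtain ⟨ζ, h0, h1, rfl⟩ := exists_joukowsky_eq hαβ hz
  rw [← joukowsky_conj, slitSqrt_joukowsky hαβ h0 h1, slitSqrt_joukowsky hαβ (by simpa) (by simpa)]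
  simp [map_ofNat]

theorem isOpen_setOf_coe_mem_slitSphere :
    IsOpen {z : ℂ | (z : OnePoint ℂ) ∈ slitSphere α β} := by
  have : {z : ℂ | (z : OnePoint ℂ) ∈ slitSphere α β} = ((↑) '' Set.Icc α β : Set ℂ)ᶜ := by
    ext z
    simp only [Set.mem_ofPred_eq, coe_mem_slitSphere, Set.mem_compl_iff, Set.mem_image, not_exists,
      not_and]
    exact forall₂_congr fun x _ => ⟨fun h e => h e.symm, fun h e => h e.symm⟩
  rw [this, isOpen_compl_iff]
  exact (isCompact_Icc.image Complex.continuous_ofReal).isClosed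

/-- The quotient is the square of a number with positive real part, hence off the cut of the
principal power. -/
theorem differentiableAt_slitSqrt (hαβ : α < β) {z : ℂ}
    (hz : (z : OnePoint ℂ) ∈ slitSphere α β) : DifferentiableAt ℂ (slitSqrt α β) z := by
  have h1 : z - α ≠ 0 := sub_ne_zero.2 (coe_mem_slitSphere.1 hz α ⟨le_rfl, hαβ.le⟩)
  have h2 : (z - β) / (z - α) ∈ Complex.slitPlane := by
    obtain ⟨ζ, h0, h4, rfl⟩ := exists_joukowsky_eq hαβ hz
    rw [quotient_joukowsky hαβ h0]
    have h3 := re_mobius_pos h4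
    set u := (1 - ζ) / (1 + ζ)
    rw [Complex.mem_slitPlane_iff, sq, Complex.mul_re, Complex.mul_im]
    by_cases h4 : u.im = 0
    · left; rw [h4]; nlinarith
    · right
      have : u.re * u.im ≠ 0 := mul_ne_zero h3.ne' h4
      intro h5; apply this; linarith
  unfold slitSqrt
  refine DifferentiableAt.mul (by fun_prop) ?_
  exact DifferentiableAt.cpow_const (DifferentiableAt.div (by fun_prop) (by fun_prop) h1) h2

end Geometry

/-! ### The arcsine measure as the image of the uniform measure on the circle. -/

section Arcsine

variable {α β : ℝ} {E : Type*} [NormedAddCommGroup E] [NormedSpace ℝ E]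

theorem measurable_arcsine_density : Measurable (fun x : ℝ =>
    ENNReal.ofReal (1 / (Real.pi * Real.sqrt ((x - α) * (β - x))))) := by
  fun_prop

theorem arcsine_absolutelyContinuous : arcsine α β ≪ volume.restrict (Set.Icc α β) :=
  withDensity_absolutelyContinuous _ _

theorem affinePoint_cos_image (hαβ : α < β) :
    (fun t => affinePoint α β (Real.cos t)) '' Set.Ioo 0 Real.pi = Set.Ioo α β := by
  ext x
  constructor
  · rintro ⟨t, ht, rfl⟩
    have h1 : Real.cos t < 1 := by
      rw [← Real.cos_zero]
      exact Real.cos_lt_cos_of_nonneg_of_le_pi le_rfl ht.2.le ht.1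
    have h2 : -1 < Real.cos t := by
      rw [← Real.cos_pi]
      exact Real.cos_lt_cos_of_nonneg_of_le_pi ht.1.le le_rfl ht.2
    simp only [affinePoint]
    constructor <;> nlinarith
  · intro hx
    have hne : β - α ≠ 0 := by linarith
    set y := (x - (α + β) / 2) * (2 / (β - α)) with hy
    have h1 : -1 < y := by
      rw [hy, mul_div_assoc', lt_div_iff₀ (by linarith)]; linarith [hx.1]
    have h2 : y < 1 := by
      rw [hy, mul_div_assoc', div_lt_iff₀ (by linarith)]; linarith [hx.2]
    refine ⟨Real.arccos y, ⟨Real.arccos_pos.2 h2, ?_⟩, ?_⟩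
    · refine lt_of_le_of_ne (Real.arccos_le_pi y) fun h => ?_
      rw [Real.arccos_eq_pi] at h; linarith
    · simp only [affinePoint]
      rw [Real.cos_arccos h1.le h2.le, hy]; field_simp; ring

theorem affinePoint_cos_injOn (hαβ : α < β) :
    Set.InjOn (fun t => affinePoint α β (Real.cos t)) (Set.Ioo 0 Real.pi) := by
  intro s hs t ht h
  refine Real.injOn_cos ⟨hs.1.le, hs.2.le⟩ ⟨ht.1.le, ht.2.le⟩ ?_
  simp only [affinePoint] at h
  have hne : β - α ≠ 0 := by linarith
  have : (β - α) / 2 * Real.cos s = (β - α) / 2 * Real.cos t := by linarith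
  exact mul_left_cancel₀ (by positivity) this

theorem hasDerivAt_affinePoint_cos (t : ℝ) :
    HasDerivAt (fun t => affinePoint α β (Real.cos t)) (-((β - α) / 2 * Real.sin t)) t := by
  unfold affinePoint
  convert! ((Real.hasDerivAt_cos t).const_mul ((β - α) / 2)).const_add ((α + β) / 2) using 1
  ring

/-- The Jacobian of x = affine(cos t) cancels the square root in the density, so the arcsine measure
becomes dt/π on (0, π). -/
theorem abs_deriv_mul_density (hαβ : α < β) {t : ℝ} (ht : t ∈ Set.Ioo 0 Real.pi) :
    |-((β - α) / 2 * Real.sin t)| * (ENNReal.ofReal (1 / (Real.pi *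
      Real.sqrt ((affinePoint α β (Real.cos t) - α) * (β - affinePoint α β (Real.cos t)))))).toReal
      = Real.pi⁻¹ := by
  have hs : 0 < Real.sin t := Real.sin_pos_of_mem_Ioo ht
  have hr : 0 < (β - α) / 2 * Real.sin t := mul_pos (by linarith) hs
  have : (affinePoint α β (Real.cos t) - α) * (β - affinePoint α β (Real.cos t)) =
      ((β - α) / 2 * Real.sin t) ^ 2 := by
    rw [mul_pow, Real.sin_sq]; unfold affinePoint; ring
  rw [this, Real.sqrt_sq hr.le, abs_neg, abs_of_pos hr, ENNReal.toReal_ofReal (by positivity)]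
  have : β - α ≠ 0 := by linarith
  field_simp

theorem integrable_arcsine_iff_integrableOn (hαβ : α < β) (f : ℝ → E) :
    Integrable f (arcsine α β) ↔
      IntegrableOn (fun t => f (affinePoint α β (Real.cos t))) (Set.Ioo 0 Real.pi) := by
  rw [arcsine, integrable_withDensity_iff_integrable_smul' measurable_arcsine_density
    (ae_of_all _ fun _ => ENNReal.ofReal_lt_top), ← IntegrableOn,
    integrableOn_Icc_iff_integrableOn_Ioo, ← affinePoint_cos_image hαβ,
    integrableOn_image_iff_integrableOn_abs_deriv_smul measurableSet_Ioo
      (fun t _ => (hasDerivAt_affinePoint_cos t).hasDerivWithinAt) (affinePoint_cos_injOn hαβ)]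
  rw [integrableOn_congr_fun (g := fun t => Real.pi⁻¹ • f (affinePoint α β (Real.cos t)))
    (fun t ht => ?_) measurableSet_Ioo]
  · exact integrable_smul_iff (by positivity) _
  · simp only [smul_smul]
    rw [abs_deriv_mul_density hαβ ht]

theorem integral_arcsine (hαβ : α < β) (f : ℝ → E) :
    ∫ x, f x ∂(arcsine α β) =
      Real.pi⁻¹ • ∫ t in Set.Ioo 0 Real.pi, f (affinePoint α β (Real.cos t)) := by
  rw [arcsine, integral_withDensity_eq_integral_toReal_smul measurable_arcsine_density
    (ae_of_all _ fun _ => ENNReal.ofReal_lt_top), integral_Icc_eq_integral_Ioo,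
    ← affinePoint_cos_image hαβ,
    integral_image_eq_integral_abs_deriv_smul measurableSet_Ioo
      (fun t _ => (hasDerivAt_affinePoint_cos t).hasDerivWithinAt) (affinePoint_cos_injOn hαβ),
    ← integral_smul]
  refine setIntegral_congr_fun measurableSet_Ioo fun t ht => ?_
  simp only [smul_smul]
  rw [abs_deriv_mul_density hαβ ht]

theorem re_circleMap (t : ℝ) : (circleMap 0 1 t).re = Real.cos t := by
  simp [circleMap, Complex.exp_ofReal_mul_I_re]

theorem im_circleMap (t : ℝ) : (circleMap 0 1 t).im = Real.sin t := by
  simp [circleMap, Complex.exp_ofReal_mul_I_im]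

/-- A lifted function is invariant under t ↦ 2π - t, so the upper half of the circle decides
integrability. -/
theorem circleIntegrable_liftCircle_iff (hαβ : α < β) (f : ℝ → E) :
    CircleIntegrable (liftCircle α β f) 0 1 ↔ Integrable f (arcsine α β) := by
  rw [integrable_arcsine_iff_integrableOn hαβ, CircleIntegrable,
    ← integrableOn_Ioc_iff_integrableOn_Ioo,
    ← intervalIntegrable_iff_integrableOn_Ioc_of_le Real.pi_pos.le]
  simp only [liftCircle, re_circleMap]
  set F : ℝ → E := fun t => f (affinePoint α β (Real.cos t)) with hF
  constructor
  · intro h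
    refine h.mono_set ?_
    rw [Set.uIcc_of_le Real.pi_pos.le, Set.uIcc_of_le Real.two_pi_pos.le]
    exact Set.Icc_subset_Icc le_rfl (by linarith [Real.pi_pos])
  · intro h
    refine h.trans (b := Real.pi) ?_
    have h2 := (h.comp_sub_left (2 * Real.pi)).symm
    have e : (fun x => F (2 * Real.pi - x)) = F := by
      ext x; simp only [hF, Real.cos_two_pi_sub]
    rw [e] at h2
    convert h2 using 1 <;> ring

theorem integral_arcsine_eq_circleAverage (hαβ : α < β) {f : ℝ → E}
    (hf : Integrable f (arcsine α β)) :
    ∫ x, f x ∂(arcsine α β) = Real.circleAverage (liftCircle α β f) 0 1 := by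
  have h := (circleIntegrable_liftCircle_iff hαβ f).2 hf
  rw [integral_arcsine hαβ, Real.circleAverage_def]
  rw [CircleIntegrable] at h
  simp only [liftCircle, re_circleMap] at h ⊢
  set F : ℝ → E := fun t => f (affinePoint α β (Real.cos t)) with hF
  have h1 : IntervalIntegrable F volume 0 Real.pi := h.mono_set (by
    rw [Set.uIcc_of_le Real.pi_pos.le, Set.uIcc_of_le Real.two_pi_pos.le]
    exact Set.Icc_subset_Icc le_rfl (by linarith [Real.pi_pos]))
  have h2 : IntervalIntegrable F volume Real.pi (2 * Real.pi) := h.mono_set (by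
    rw [Set.uIcc_of_le (by linarith [Real.pi_pos]), Set.uIcc_of_le Real.two_pi_pos.le]
    exact Set.Icc_subset_Icc Real.pi_pos.le le_rfl)
  have e : (fun x => F (2 * Real.pi - x)) = F := by
    ext x; simp only [hF, Real.cos_two_pi_sub]
  have h3 : ∫ t in Real.pi..(2 * Real.pi), F t = ∫ t in (0 : ℝ)..Real.pi, F t := by
    have := intervalIntegral.integral_comp_sub_left (a := 0) (b := Real.pi) F (2 * Real.pi)
    rw [e, sub_zero] at this
    rw [this]
    congr 1; ring
  rw [← intervalIntegral.integral_add_adjacent_intervals h1 h2, h3, ← two_smul ℝ, smul_smul,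
    ← integral_Ioc_eq_integral_Ioo, ← intervalIntegral.integral_of_le Real.pi_pos.le]
  congr 1
  field_simp

instance isFiniteMeasure_arcsine : IsFiniteMeasure (arcsine α β) := by
  rcases lt_or_ge α β with h | h
  · have h1 : Integrable (fun _ => (1 : ℝ)) (arcsine α β) := by
      rw [integrable_arcsine_iff_integrableOn h]
      exact integrableOn_const (by simp)
    rw [integrable_const_iff] at h1
    simpa using h1
  · have : arcsine α β = 0 := by
      rw [arcsine, Measure.restrict_eq_zero.2 (by simp [h])]
      simp
    rw [this]; infer_instance

end Arcsine

/-! ### Herglotz and Poisson integrals, and their counterpart on the slit. -/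

/-- The Herglotz integral of `g` over the unit circle. -/
noncomputable def herglotzIntegral (g : ℂ → ℝ) (ζ : ℂ) : ℂ :=
  Real.circleAverage (fun z => herglotzRieszKernel 0 ζ z • (g z : ℂ)) 0 1

/-- The Poisson integral of `g` over the unit circle. -/
noncomputable def poissonIntegral (g : ℂ → ℝ) (ζ : ℂ) : ℝ :=
  Real.circleAverage (fun z => (herglotzRieszKernel 0 ζ z).re * g z) 0 1

/-- `w_Δ(z) ∫ s(x) / (z - x) dω_Δ(x)`, an analytic completion of the solution of the Dirichlet
problem with boundary data `s`. -/
noncomputable def schwarz (α β : ℝ) (s : ℝ → ℝ) : OnePoint ℂ → ℂ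
  | none => ∫ x, (s x : ℂ) ∂(arcsine α β)
  | some z => slitSqrt α β z * ∫ x, (s x : ℂ) / (z - x) ∂(arcsine α β)

theorem schwarz_infty (α β : ℝ) (s : ℝ → ℝ) :
    schwarz α β s OnePoint.infty = ∫ x, (s x : ℂ) ∂(arcsine α β) := rfl

theorem schwarz_coe (α β : ℝ) (s : ℝ → ℝ) (z : ℂ) : schwarz α β s (z : OnePoint ℂ) =
    slitSqrt α β z * ∫ x, (s x : ℂ) / (z - x) ∂(arcsine α β) := rfl

theorem outerFun_exp (α β : ℝ) (s : ℝ → ℝ) (z : OnePoint ℂ) :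
    outerFun α β (fun x => Real.exp (s x)) z = Complex.exp (schwarz α β s z) := by
  induction z using OnePoint.rec with
  | infty => simp only [schwarz_infty]; simp [outerFun]
  | coe z => simp only [schwarz_coe]; simp [outerFun]

theorem dirichlet_eq_re (α β : ℝ) (s : ℝ → ℝ) (z : OnePoint ℂ) :
    dirichlet α β s z = (schwarz α β s z).re := by
  rw [dirichlet, outerFun_exp, Complex.norm_exp, Real.log_exp]

/-! ### Estimates for Poisson integrals in the disk. -/

section Poisson

variable {g g' : ℂ → ℝ} {ζ : ℂ}

theorem circleIntegrable_ofReal (hg : CircleIntegrable g 0 1) :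
    CircleIntegrable (fun z => (g z : ℂ)) 0 1 := by
  rw [CircleIntegrable, intervalIntegrable_iff] at *
  exact hg.ofReal

theorem circleIntegrable_kernel_smul (hg : CircleIntegrable g 0 1) (hζ : ‖ζ‖ < 1) :
    CircleIntegrable (fun z => herglotzRieszKernel 0 ζ z • (g z : ℂ)) 0 1 :=
  (circleIntegrable_ofReal hg).continuousOn_smul
    (continuousOn_herglotzRieszKernel_sphere (by simpa using hζ))

theorem continuousOn_re_kernel (hζ : ‖ζ‖ < 1) :
    ContinuousOn (fun z => (herglotzRieszKernel 0 ζ z).re) (Metric.sphere 0 |1|) :=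
  Complex.continuous_re.comp_continuousOn
    (continuousOn_herglotzRieszKernel_sphere (by simpa using hζ))

theorem circleIntegrable_re_kernel_mul (hg : CircleIntegrable g 0 1) (hζ : ‖ζ‖ < 1) :
    CircleIntegrable (fun z => (herglotzRieszKernel 0 ζ z).re * g z) 0 1 :=
  hg.continuousOn_mul (continuousOn_re_kernel hζ)

theorem re_herglotzIntegral (hg : CircleIntegrable g 0 1) (hζ : ‖ζ‖ < 1) :
    (herglotzIntegral g ζ).re = poissonIntegral g ζ := by
  have := re_circleAverage_herglotzRieszKernel_smul hg (w := ζ) (by simpa using hζ)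
  simpa [herglotzIntegral, poissonIntegral, Pi.mul_def] using this

theorem poissonIntegral_const (c : ℝ) (hζ : ‖ζ‖ < 1) : poissonIntegral (fun _ => c) ζ = c := by
  have := DiffContOnCl.circleAverage_re_herglotzRieszKernel_smul (f := fun _ => (c : ℂ))
    (c := 0) (R := 1) (w := ζ) diffContOnCl_const (by simpa using hζ)
  have h2 := congrArg Complex.reCLM this
  rw [← ContinuousLinearMap.circleAverage_comp_comm] at h2
  · simpa [poissonIntegral, Function.comp_def] using h2
  · refine ContinuousOn.circleIntegrable zero_le_one ?_
    have := continuousOn_re_kernel hζ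
    rw [abs_one] at this
    exact this.smul continuousOn_const

theorem poissonIntegral_add (hg : CircleIntegrable g 0 1) (hg' : CircleIntegrable g' 0 1)
    (hζ : ‖ζ‖ < 1) : poissonIntegral (fun z => g z + g' z) ζ =
      poissonIntegral g ζ + poissonIntegral g' ζ := by
  simp only [poissonIntegral, mul_add]
  exact Real.circleAverage_fun_add (circleIntegrable_re_kernel_mul hg hζ)
    (circleIntegrable_re_kernel_mul hg' hζ)

theorem poissonIntegral_const_mul (c : ℝ) :
    poissonIntegral (fun z => c * g z) ζ = c * poissonIntegral g ζ := by
  simp only [poissonIntegral, ← smul_eq_mul (a := c)]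
  rw [← Real.circleAverage_fun_smul]
  congr 1; ext z; simp only [smul_eq_mul]; ring

theorem re_kernel_lower {z : ℂ} (hz : z ∈ Metric.sphere (0 : ℂ) |1|) (hζ : ‖ζ‖ < 1) :
    (1 - ‖ζ‖) / (1 + ‖ζ‖) ≤ (herglotzRieszKernel 0 ζ z).re := by
  rw [abs_one] at hz
  simpa [herglotzRieszKernel] using le_re_herglotzRieszKernel hz (w := ζ) (by simpa using hζ)

theorem re_kernel_upper {z : ℂ} (hz : z ∈ Metric.sphere (0 : ℂ) |1|) (hζ : ‖ζ‖ < 1) :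
    (herglotzRieszKernel 0 ζ z).re ≤ (1 + ‖ζ‖) / (1 - ‖ζ‖) := by
  rw [abs_one] at hz
  simpa [herglotzRieszKernel] using re_herglotzRieszKernel_le hz (w := ζ) (by simpa using hζ)

theorem re_kernel_nonneg {z : ℂ} (hz : z ∈ Metric.sphere (0 : ℂ) |1|) (hζ : ‖ζ‖ < 1) :
    0 ≤ (herglotzRieszKernel 0 ζ z).re :=
  le_trans (div_nonneg (by linarith) (by linarith [norm_nonneg ζ])) (re_kernel_lower hz hζ)

theorem poissonIntegral_mono (hg : CircleIntegrable g 0 1) (hg' : CircleIntegrable g' 0 1)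
    (h : ∀ z ∈ Metric.sphere (0 : ℂ) |1|, g z ≤ g' z) (hζ : ‖ζ‖ < 1) :
    poissonIntegral g ζ ≤ poissonIntegral g' ζ :=
  Real.circleAverage_mono (circleIntegrable_re_kernel_mul hg hζ)
    (circleIntegrable_re_kernel_mul hg' hζ)
    fun z hz => mul_le_mul_of_nonneg_left (h z hz) (re_kernel_nonneg hz hζ)

theorem circleAverage_mul_const_left (c : ℝ) :
    Real.circleAverage (fun z => c * g z) 0 1 = c * Real.circleAverage g 0 1 := by
  simpa only [smul_eq_mul] using Real.circleAverage_fun_smul (a := c) (f := g) (c := 0) (R := 1)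

theorem harnack_lower (hg : CircleIntegrable g 0 1)
    (h : ∀ z ∈ Metric.sphere (0 : ℂ) |1|, 0 ≤ g z) (hζ : ‖ζ‖ < 1) :
    (1 - ‖ζ‖) / (1 + ‖ζ‖) * Real.circleAverage g 0 1 ≤ poissonIntegral g ζ := by
  rw [← circleAverage_mul_const_left]
  refine Real.circleAverage_mono ?_ (circleIntegrable_re_kernel_mul hg hζ)
    fun z hz => mul_le_mul_of_nonneg_right (re_kernel_lower hz hζ) (h z hz)
  exact hg.continuousOn_mul continuousOn_const

theorem harnack_upper (hg : CircleIntegrable g 0 1)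
    (h : ∀ z ∈ Metric.sphere (0 : ℂ) |1|, 0 ≤ g z) (hζ : ‖ζ‖ < 1) :
    poissonIntegral g ζ ≤ (1 + ‖ζ‖) / (1 - ‖ζ‖) * Real.circleAverage g 0 1 := by
  rw [← circleAverage_mul_const_left]
  refine Real.circleAverage_mono (circleIntegrable_re_kernel_mul hg hζ) ?_
    fun z hz => mul_le_mul_of_nonneg_right (re_kernel_upper hz hζ) (h z hz)
  exact hg.continuousOn_mul continuousOn_const

/-- Jensen's inequality for the Poisson kernel. -/
theorem exp_poissonIntegral_le (hg : CircleIntegrable g 0 1)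
    (hg' : CircleIntegrable (fun z => Real.exp (g z)) 0 1) (hζ : ‖ζ‖ < 1) :
    Real.exp (poissonIntegral g ζ) ≤ poissonIntegral (fun z => Real.exp (g z)) ζ := by
  set m := poissonIntegral g ζ with hm
  -- The integrand is the tangent line of exp at m composed with g; it lies below exp ∘ g, and its
  -- Poisson integral is exp m.
  have h1 : poissonIntegral (fun z => Real.exp m * (1 - m) + Real.exp m * g z) ζ = Real.exp m := by
    have hi : CircleIntegrable (fun z => Real.exp m * g z) 0 1 :=
      hg.continuousOn_mul (continuousOn_const (c := Real.exp m))
    rw [poissonIntegral_add (circleIntegrable_const _ _ _) hi hζ, poissonIntegral_const _ hζ, poissonIntegral_const_mul, ← hm]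
    ring
  calc Real.exp m = _ := h1.symm
    _ ≤ _ := by
      refine poissonIntegral_mono ((circleIntegrable_const _ _ _).add
        (hg.continuousOn_mul continuousOn_const)) hg' (fun z _ => ?_) hζ
      have := Real.add_one_le_exp (g z - m)
      rw [Real.exp_sub, le_div_iff₀ (Real.exp_pos _)] at this
      linarith

/-- On |ζ| ≤ q both denominators are at least 1 - q. The resulting bound is uniform in the boundary
point and is the source of equicontinuity for ℋ. -/
theorem norm_kernel_sub_le {z ζ' : ℂ} (hz : z ∈ Metric.sphere (0 : ℂ) |1|) {q : ℝ} (hq : q < 1)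
    (hζ : ‖ζ‖ ≤ q) (hζ' : ‖ζ'‖ ≤ q) :
    ‖herglotzRieszKernel 0 ζ z - herglotzRieszKernel 0 ζ' z‖ ≤ 2 / (1 - q) ^ 2 * ‖ζ - ζ'‖ := by
  have hz1 : ‖z‖ = 1 := by simpa using hz
  have key : ∀ w : ℂ, ‖w‖ ≤ q → 1 - q ≤ ‖z - w‖ := fun w hw => by
    have := norm_sub_norm_le z w; linarith
  have h1 := key ζ hζ
  have h2 := key ζ' hζ'
  have n1 : z - ζ ≠ 0 := by rw [← norm_pos_iff]; linarith
  have n2 : z - ζ' ≠ 0 := by rw [← norm_pos_iff]; linarith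
  have e : herglotzRieszKernel 0 ζ z - herglotzRieszKernel 0 ζ' z =
      2 * z * (ζ - ζ') / ((z - ζ) * (z - ζ')) := by
    simp only [herglotzRieszKernel, sub_zero]; field_simp; ring
  rw [e, norm_div, norm_mul, norm_mul, norm_mul, hz1, div_mul_eq_mul_div]
  simp only [Complex.norm_ofNat, mul_one]
  have hq0 : 0 < 1 - q := by linarith
  gcongr
  nlinarith

theorem abs_poissonIntegral_sub_le {ζ' : ℂ} (hg : CircleIntegrable g 0 1) {C q : ℝ}
    (h : ∀ z ∈ Metric.sphere (0 : ℂ) |1|, |g z| ≤ C) (hq : q < 1)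
    (hζ : ‖ζ‖ ≤ q) (hζ' : ‖ζ'‖ ≤ q) :
    |poissonIntegral g ζ - poissonIntegral g ζ'| ≤ 2 / (1 - q) ^ 2 * ‖ζ - ζ'‖ * C := by
  have i1 := circleIntegrable_re_kernel_mul hg (hζ.trans_lt hq)
  have i2 := circleIntegrable_re_kernel_mul hg (hζ'.trans_lt hq)
  rw [poissonIntegral, poissonIntegral, ← Real.circleAverage_fun_sub i1 i2]
  refine Real.abs_circleAverage_le_circleAverage_abs.trans ?_
  refine Real.circleAverage_mono_on_of_le_circle (i1.sub i2).abs fun z hz => ?_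
  simp only [Pi.abs_apply, ← sub_mul, abs_mul]
  refine mul_le_mul ?_ (h z hz) (abs_nonneg _) (by positivity)
  refine le_trans ?_ (norm_kernel_sub_le hz hq hζ hζ')
  rw [← Complex.sub_re]
  exact Complex.abs_re_le_norm _

theorem differentiableOn_herglotzIntegral (hg : CircleIntegrable g 0 1) :
    DifferentiableOn ℂ (herglotzIntegral g) (Metric.ball 0 1) :=
  differentiableOn_circleAverage_herglotzRieszKernel_smul (circleIntegrable_ofReal hg)

theorem herglotzIntegral_zero : herglotzIntegral g 0 =
    Real.circleAverage (fun z => (g z : ℂ)) 0 1 := by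
  refine Real.circleAverage_congr_sphere fun z hz => ?_
  have : z ≠ 0 := by rintro rfl; simp at hz
  simp [herglotzRieszKernel, this]

end Poisson

/-! ### Folding the circle onto the slit: the slit integral as a Herglotz integral. -/

section Fold

variable {α β : ℝ} {s t : ℝ → ℝ}

theorem liftCircle_ofReal (α β : ℝ) (s : ℝ → ℝ) :
    (fun z => ((liftCircle α β s z : ℝ) : ℂ)) = liftCircle α β (fun x => (s x : ℂ)) := rfl

/-- The points z and z⁻¹ of the circle lie over the same point of the slit, so symmetric data only
see the average of the two kernel values; that average is the kernel w(z)/(z - x). -/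
theorem kernel_add_kernel_inv (hαβ : α < β) {ζ z : ℂ} (h0 : ζ ≠ 0) (h1 : ‖ζ‖ < 1)
    (hz : ‖z‖ = 1) :
    (herglotzRieszKernel 0 ζ z + herglotzRieszKernel 0 ζ z⁻¹) / 2 =
      slitSqrt α β (joukowsky α β ζ) / (joukowsky α β ζ - affinePoint α β z.re) := by
  have hne : ((β : ℂ) - α) ≠ 0 := by
    rw [← Complex.ofReal_sub]; exact_mod_cast (sub_pos.2 hαβ).ne'
  have hz0 : z ≠ 0 := by rintro rfl; simp at hz
  rw [slitSqrt_joukowsky hαβ h0 h1, ← joukowsky_of_norm_eq_one hz]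
  have n1 : z - ζ ≠ 0 := fun h => by rw [sub_eq_zero.1 h] at hz; linarith
  have n2 : 1 - z * ζ ≠ 0 := fun h => by
    have : ‖z * ζ‖ = 1 := by rw [← sub_eq_zero.1 h, norm_one]
    rw [norm_mul, hz, one_mul] at this; linarith
  have e1 : joukowsky α β ζ - joukowsky α β z =
      (β - α) / 4 * ((z - ζ) * (1 - z * ζ) / (z * ζ)) := by
    unfold joukowsky; field_simp; ring
  have e2 : z⁻¹ - ζ = (1 - z * ζ) / z := by field_simp
  rw [e1]
  simp only [herglotzRieszKernel, sub_zero]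
  rw [e2]
  field_simp
  ring

/-- The Herglotz integral of boundary data which are symmetric about the real axis. -/
theorem herglotzIntegral_liftCircle (hαβ : α < β) (hs : Integrable s (arcsine α β)) {ζ : ℂ}
    (h1 : ‖ζ‖ < 1) :
    herglotzIntegral (liftCircle α β s) ζ = schwarz α β s (diskToSlit α β ζ) := by
  have hg := (circleIntegrable_liftCircle_iff hαβ s).2 hs
  by_cases h0 : ζ = 0
  · rw [h0, herglotzIntegral_zero, diskToSlit_zero, schwarz_infty, liftCircle_ofReal,
      ← integral_arcsine_eq_circleAverage hαβ hs.ofReal]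
  · rw [diskToSlit_of_ne_zero h0, schwarz_coe, ← integral_const_mul]
    have i1 := circleIntegrable_kernel_smul hg h1
    have hre : ∀ z ∈ Metric.sphere (0 : ℂ) |1|, (z⁻¹).re = z.re := fun z hz => by
      have : z⁻¹ = starRingEnd ℂ z := Complex.inv_eq_conj (by simpa using hz)
      rw [this, Complex.conj_re]
    have i2 : CircleIntegrable
        (fun z => herglotzRieszKernel 0 ζ z⁻¹ • ((liftCircle α β s z : ℝ) : ℂ)) 0 1 := by
      refine (circleIntegrable_ofReal hg).continuousOn_smul
        (g := fun z => herglotzRieszKernel 0 ζ z⁻¹) ?_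
      refine (continuousOn_herglotzRieszKernel_sphere (c := 0) (R := 1)
        (by simpa using h1)).comp (f := fun z : ℂ => z⁻¹) ?_ ?_
      · exact continuousOn_inv₀.mono fun z hz => by rintro rfl; simp at hz
      · intro z hz; simpa using hz
    -- Inversion preserves the circle average and the lifted data, so both halves of the symmetrized
    -- kernel integrate to the same value.
    have e : Real.circleAverage
        (fun z => herglotzRieszKernel 0 ζ z⁻¹ • ((liftCircle α β s z : ℝ) : ℂ)) 0 1 =
        herglotzIntegral (liftCircle α β s) ζ := by
      rw [herglotzIntegral, ← Real.circleAverage_zero_one_congr_inv]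
      refine Real.circleAverage_congr_sphere fun z hz => ?_
      simp only [liftCircle, hre z hz, inv_inv]
    have e2 : Set.EqOn (liftCircle α β fun x =>
        slitSqrt α β (joukowsky α β ζ) * ((s x : ℂ) / (joukowsky α β ζ - x)))
        (fun z => (2 : ℂ)⁻¹ • (herglotzRieszKernel 0 ζ z • ((liftCircle α β s z : ℝ) : ℂ) +
          herglotzRieszKernel 0 ζ z⁻¹ • ((liftCircle α β s z : ℝ) : ℂ))) (Metric.sphere 0 |1|) := by
      intro z hz
      have := kernel_add_kernel_inv hαβ h0 h1 (by simpa using hz : ‖z‖ = 1)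
      simp only [liftCircle, smul_eq_mul]
      rw [mul_div_left_comm, ← this]; ring
    have i3 : CircleIntegrable (liftCircle α β fun x =>
        slitSqrt α β (joukowsky α β ζ) * ((s x : ℂ) / (joukowsky α β ζ - x))) 0 1 := by
      rw [circleIntegrable_congr e2]
      exact (i1.add i2).const_smul (a := (2 : ℂ)⁻¹)
    rw [integral_arcsine_eq_circleAverage hαβ ((circleIntegrable_liftCircle_iff hαβ _).1 i3),
      Real.circleAverage_congr_sphere e2, Real.circleAverage_fun_smul,
      Real.circleAverage_fun_add i1 i2, e, ← herglotzIntegral, smul_eq_mul]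
    ring

theorem schwarz_eq_herglotzIntegral (hαβ : α < β) (hs : Integrable s (arcsine α β))
    {z : OnePoint ℂ} (hz : z ∈ slitSphere α β) :
    schwarz α β s z = herglotzIntegral (liftCircle α β s) (slitToDisk α β z) := by
  rw [herglotzIntegral_liftCircle hαβ hs (norm_slitToDisk_lt hαβ hz), diskToSlit_slitToDisk hαβ hz]

theorem re_schwarz_eq_poissonIntegral (hαβ : α < β) (hs : Integrable s (arcsine α β))
    {z : OnePoint ℂ} (hz : z ∈ slitSphere α β) :
    (schwarz α β s z).re = poissonIntegral (liftCircle α β s) (slitToDisk α β z) := by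
  rw [schwarz_eq_herglotzIntegral hαβ hs hz,
    re_herglotzIntegral ((circleIntegrable_liftCircle_iff hαβ s).2 hs) (norm_slitToDisk_lt hαβ hz)]

theorem re_schwarz_infty (hαβ : α < β) (hs : Integrable s (arcsine α β)) :
    (schwarz α β s OnePoint.infty).re = Real.circleAverage (liftCircle α β s) 0 1 := by
  rw [schwarz_infty, integral_complex_ofReal, Complex.ofReal_re,
    integral_arcsine_eq_circleAverage hαβ hs]

theorem re_schwarz_const (hαβ : α < β) (c : ℝ) {z : OnePoint ℂ} (hz : z ∈ slitSphere α β) :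
    (schwarz α β (fun _ => c) z).re = c := by
  rw [re_schwarz_eq_poissonIntegral hαβ (integrable_const c) hz]
  exact poissonIntegral_const c (norm_slitToDisk_lt hαβ hz)

theorem re_schwarz_add (hαβ : α < β) (hs : Integrable s (arcsine α β))
    (ht : Integrable t (arcsine α β)) {z : OnePoint ℂ} (hz : z ∈ slitSphere α β) :
    (schwarz α β (fun x => s x + t x) z).re = (schwarz α β s z).re + (schwarz α β t z).re := by
  rw [re_schwarz_eq_poissonIntegral hαβ hs hz, re_schwarz_eq_poissonIntegral hαβ ht hz,
    re_schwarz_eq_poissonIntegral (s := fun x => s x + t x) hαβ (hs.add ht) hz]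
  exact poissonIntegral_add ((circleIntegrable_liftCircle_iff hαβ s).2 hs)
    ((circleIntegrable_liftCircle_iff hαβ t).2 ht) (norm_slitToDisk_lt hαβ hz)

theorem re_schwarz_const_mul (hαβ : α < β) (c : ℝ) (hs : Integrable s (arcsine α β))
    {z : OnePoint ℂ} (hz : z ∈ slitSphere α β) :
    (schwarz α β (fun x => c * s x) z).re = c * (schwarz α β s z).re := by
  rw [re_schwarz_eq_poissonIntegral hαβ hs hz,
    re_schwarz_eq_poissonIntegral hαβ (hs.const_mul c) hz]
  exact poissonIntegral_const_mul c

theorem schwarz_congr (h : s =ᵐ[arcsine α β] t) (z : OnePoint ℂ) :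
    schwarz α β s z = schwarz α β t z := by
  induction z using OnePoint.rec with
  | infty =>
    rw [schwarz_infty, schwarz_infty]
    exact integral_congr_ae (h.mono fun x hx => by simp only [hx])
  | coe z =>
    rw [schwarz_coe, schwarz_coe]
    congr 1
    exact integral_congr_ae (h.mono fun x hx => by simp only [hx])

theorem ae_arcsine_mem : ∀ᵐ x ∂(arcsine α β), x ∈ Set.Icc α β :=
  arcsine_absolutelyContinuous.ae_le (ae_restrict_mem measurableSet_Icc)

theorem le_re_schwarz (hαβ : α < β) (hs : Integrable s (arcsine α β)) {m : ℝ}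
    (h : ∀ x ∈ Set.Icc α β, m ≤ s x) {z : OnePoint ℂ} (hz : z ∈ slitSphere α β) :
    m ≤ (schwarz α β s z).re := by
  rw [re_schwarz_eq_poissonIntegral hαβ hs hz]
  conv_lhs => rw [← poissonIntegral_const m (norm_slitToDisk_lt hαβ hz)]
  refine poissonIntegral_mono (circleIntegrable_const _ _ _)
    ((circleIntegrable_liftCircle_iff hαβ s).2 hs) (fun w hw => h _ ?_)
    (norm_slitToDisk_lt hαβ hz)
  exact affinePoint_re_mem hαβ (by simpa using hw)

theorem abs_re_schwarz_le (hαβ : α < β) (hs : Integrable s (arcsine α β)) {C : ℝ}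
    (h : ∀ x ∈ Set.Icc α β, |s x| ≤ C) {z : OnePoint ℂ} (hz : z ∈ slitSphere α β) :
    |(schwarz α β s z).re| ≤ C := by
  rw [abs_le]
  refine ⟨le_re_schwarz hαβ hs (fun x hx => (abs_le.1 (h x hx)).1) hz, ?_⟩
  have h1 := le_re_schwarz hαβ (hs.const_mul (-1)) (m := -C)
    (fun x hx => by linarith [(abs_le.1 (h x hx)).2]) hz
  rw [re_schwarz_const_mul hαβ _ hs hz] at h1
  linarith

/-- Harnack's inequality. -/
theorem harnack_re_schwarz_lower (hαβ : α < β) (hs : Integrable s (arcsine α β)) {m : ℝ}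
    (h : ∀ x ∈ Set.Icc α β, m ≤ s x) {z : OnePoint ℂ} (hz : z ∈ slitSphere α β) :
    m + (1 - ‖slitToDisk α β z‖) / (1 + ‖slitToDisk α β z‖) *
      ((schwarz α β s OnePoint.infty).re - m) ≤ (schwarz α β s z).re := by
  have h1 : Integrable (fun x => s x + -m) (arcsine α β) := hs.add (integrable_const _)
  have h2 := harnack_lower ((circleIntegrable_liftCircle_iff hαβ _).2 h1) (fun w hw => ?_)
    (norm_slitToDisk_lt hαβ hz)
  · rw [← re_schwarz_eq_poissonIntegral hαβ h1 hz, ← re_schwarz_infty hαβ h1,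
      re_schwarz_add hαβ hs (integrable_const _) hz,
      re_schwarz_add hαβ hs (integrable_const _) infty_mem_slitSphere,
      re_schwarz_const hαβ _ hz, re_schwarz_const hαβ _ infty_mem_slitSphere] at h2
    simp only [sub_eq_add_neg] at h2 ⊢
    linarith
  · have := h _ (affinePoint_re_mem hαβ (by simpa using hw : ‖w‖ = 1))
    simp only [liftCircle]; linarith

/-- If the value at `∞` is the minimum of the boundary data, then the solution of the Dirichlet
problem is constant. -/
theorem re_schwarz_eq_of_infty_le (hαβ : α < β) (hs : Integrable s (arcsine α β)) {m : ℝ}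
    (h : ∀ x ∈ Set.Icc α β, m ≤ s x) (hm : (schwarz α β s OnePoint.infty).re ≤ m)
    {z : OnePoint ℂ} (hz : z ∈ slitSphere α β) : (schwarz α β s z).re = m := by
  refine le_antisymm ?_ (le_re_schwarz hαβ hs h hz)
  have h1 : Integrable (fun x => s x + -m) (arcsine α β) := hs.add (integrable_const _)
  have hlt := norm_slitToDisk_lt hαβ hz
  have h2 := harnack_upper ((circleIntegrable_liftCircle_iff hαβ _).2 h1) (fun w hw => ?_) hlt
  · rw [← re_schwarz_eq_poissonIntegral hαβ h1 hz, ← re_schwarz_infty hαβ h1,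
      re_schwarz_add hαβ hs (integrable_const _) hz,
      re_schwarz_add hαβ hs (integrable_const _) infty_mem_slitSphere,
      re_schwarz_const hαβ _ hz, re_schwarz_const hαβ _ infty_mem_slitSphere] at h2
    have h3 : 0 ≤ (1 + ‖slitToDisk α β z‖) / (1 - ‖slitToDisk α β z‖) :=
      div_nonneg (by positivity) (by linarith)
    nlinarith
  · have := h _ (affinePoint_re_mem hαβ (by simpa using hw : ‖w‖ = 1))
    simp only [liftCircle]; linarith

/-- Jensen's inequality for the Poisson kernel; it supplies the harmonic majorant needed for
membership in H². -/
theorem exp_two_re_schwarz_le (hαβ : α < β) (hs : Integrable s (arcsine α β))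
    (h2 : Integrable (fun x => Real.exp (2 * s x)) (arcsine α β))
    {z : OnePoint ℂ} (hz : z ∈ slitSphere α β) :
    Real.exp (2 * (schwarz α β s z).re) ≤
      (schwarz α β (fun x => Real.exp (2 * s x)) z).re := by
  rw [← re_schwarz_const_mul hαβ 2 hs hz, re_schwarz_eq_poissonIntegral hαβ (hs.const_mul 2) hz,
    re_schwarz_eq_poissonIntegral hαβ h2 hz]
  exact exp_poissonIntegral_le ((circleIntegrable_liftCircle_iff hαβ _).2 (hs.const_mul 2))
    ((circleIntegrable_liftCircle_iff hαβ _).2 h2) (norm_slitToDisk_lt hαβ hz)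

theorem schwarz_conj (hαβ : α < β) {z : ℂ} (hz : (z : OnePoint ℂ) ∈ slitSphere α β) :
    schwarz α β s ((starRingEnd ℂ z : ℂ) : OnePoint ℂ) =
      starRingEnd ℂ (schwarz α β s (z : OnePoint ℂ)) := by
  rw [schwarz_coe, schwarz_coe, slitSqrt_conj hαβ hz, map_mul, ← integral_conj]
  simp

/-- Used twice: it makes each `S_j` positive on the other intervals, and it makes normal derivatives
vanish in the maximum principle argument. -/
theorem im_schwarz_ofReal (hαβ : α < β) {x : ℝ}
    (hx : ((x : ℂ) : OnePoint ℂ) ∈ slitSphere α β) :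
    (schwarz α β s ((x : ℂ) : OnePoint ℂ)).im = 0 := by
  have := schwarz_conj (s := s) hαβ hx
  rw [Complex.conj_ofReal] at this
  exact Complex.conj_eq_iff_im.1 this.symm

end Fold

/-! ### Holomorphy on the slit domain, including the point at infinity. -/

section Holomorphic

variable {α β : ℝ}

theorem chartAtInfty_of_ne_zero {w : ℂ} (h : w ≠ 0) :
    chartAtInfty w = ((w⁻¹ : ℂ) : OnePoint ℂ) := by simp [chartAtInfty, h]

theorem chartAtInfty_zero : chartAtInfty 0 = OnePoint.infty := by simp [chartAtInfty]

theorem eventually_coe_mem_slitSphere {z : ℂ} (hz : (z : OnePoint ℂ) ∈ slitSphere α β) :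
    ∀ᶠ w : ℂ in 𝓝 z, (w : OnePoint ℂ) ∈ slitSphere α β :=
  isOpen_setOf_coe_mem_slitSphere.mem_nhds hz

theorem eventually_chartAtInfty_mem_slitSphere :
    ∀ᶠ w : ℂ in 𝓝 0, chartAtInfty w ∈ slitSphere α β := by
  have hR : 0 < (|α| + |β| + 1)⁻¹ := by positivity
  filter_upwards [Metric.ball_mem_nhds (0 : ℂ) hR] with w hw
  by_cases h : w = 0
  · rw [h, chartAtInfty_zero]; exact infty_mem_slitSphere
  · rw [chartAtInfty_of_ne_zero h, coe_mem_slitSphere]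
    intro x hx he
    have h1 : ‖w‖⁻¹ = |x| := by rw [← norm_inv, he, Complex.norm_real, Real.norm_eq_abs]
    have h2 : |x| ≤ |α| + |β| := by
      rw [abs_le]
      constructor
      · linarith [hx.1, neg_abs_le α, abs_nonneg β]
      · linarith [hx.2, le_abs_self β, abs_nonneg α]
    rw [mem_ball_zero_iff, lt_inv_comm₀ (norm_pos_iff.2 h) (by positivity)] at hw
    linarith

/-- The distance to one focus is at most the focal sum, which is at most (β - α)/‖ζ‖ on the disk.
This decay gives continuity at infinity. -/
theorem norm_slitToDisk_le (hαβ : α < β) {z : ℂ} (hz : (z : OnePoint ℂ) ∈ slitSphere α β) :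
    ‖slitToDisk α β (z : OnePoint ℂ)‖ ≤ (β - α) / ‖z - α‖ := by
  have h1 : z - α ≠ 0 := sub_ne_zero.2 (coe_mem_slitSphere.1 hz α ⟨le_rfl, hαβ.le⟩)
  obtain ⟨ζ, h0, h2, rfl⟩ := exists_joukowsky_eq hαβ hz
  rw [slitToDisk_joukowsky hαβ h0 h2, le_div_iff₀ (norm_pos_iff.2 h1)]
  have h3 := norm_sub_add_norm_sub_joukowsky hαβ h0
  have h4 : 0 < ‖ζ‖ := norm_pos_iff.2 h0
  have h5 : ‖ζ‖ * ((β - α) / 2 * (‖ζ‖ + ‖ζ‖⁻¹)) = (β - α) / 2 * (‖ζ‖ ^ 2 + 1) := by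
    field_simp
  have h6 : ‖joukowsky α β ζ - α‖ ≤ (β - α) / 2 * (‖ζ‖ + ‖ζ‖⁻¹) := by
    rw [← h3]; linarith [norm_nonneg (joukowsky α β ζ - β)]
  calc _ ≤ ‖ζ‖ * ((β - α) / 2 * (‖ζ‖ + ‖ζ‖⁻¹)) := by gcongr
    _ ≤ _ := by
      rw [h5]
      have : ‖ζ‖ ^ 2 + 1 ≤ 2 := by nlinarith
      nlinarith

theorem differentiableAt_slitToDisk (hαβ : α < β) {z : ℂ}
    (hz : (z : OnePoint ℂ) ∈ slitSphere α β) :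
    DifferentiableAt ℂ (fun w : ℂ => slitToDisk α β (w : OnePoint ℂ)) z := by
  simp only [slitToDisk_coe]
  have := differentiableAt_slitSqrt hαβ hz
  fun_prop

theorem continuousAt_slitToDisk_chartAtInfty (hαβ : α < β) :
    ContinuousAt (fun w : ℂ => slitToDisk α β (chartAtInfty w)) 0 := by
  rw [ContinuousAt, chartAtInfty_zero, slitToDisk_infty, tendsto_zero_iff_norm_tendsto_zero]
  have h1 : Tendsto (fun w : ℂ => (β - α) * ‖w‖ / ‖1 - w * α‖) (𝓝 0) (𝓝 0) := by
    have : ContinuousAt (fun w : ℂ => (β - α) * ‖w‖ / ‖1 - w * α‖) 0 := by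
      refine ContinuousAt.div (by fun_prop) (by fun_prop) (by simp)
    simpa [ContinuousAt] using this
  refine squeeze_zero' (Eventually.of_forall fun _ => norm_nonneg _) ?_ h1
  filter_upwards [eventually_chartAtInfty_mem_slitSphere (α := α) (β := β)] with w hw
  by_cases h : w = 0
  · rw [h, chartAtInfty_zero, slitToDisk_infty]; simp
  · rw [chartAtInfty_of_ne_zero h] at hw ⊢
    refine (norm_slitToDisk_le hαβ hw).trans_eq ?_
    have : w⁻¹ - α = (1 - w * α) / w := by field_simp
    rw [this, norm_div, div_div_eq_mul_div]

/-- A holomorphic function on the disk, transported to the complement of `[α, β]`. -/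
theorem IsHolomorphicOn.of_disk (hαβ : α < β) {H : ℂ → ℂ}
    (hH : DifferentiableOn ℂ H (Metric.ball 0 1)) {f : OnePoint ℂ → ℂ}
    (hf : ∀ z ∈ slitSphere α β, f z = H (slitToDisk α β z)) :
    IsHolomorphicOn f (slitSphere α β) := by
  have hfin : ∀ z : ℂ, (z : OnePoint ℂ) ∈ slitSphere α β →
      DifferentiableAt ℂ (fun w : ℂ => f (w : OnePoint ℂ)) z := by
    intro z hz
    have h1 : DifferentiableAt ℂ (fun w : ℂ => H (slitToDisk α β (w : OnePoint ℂ))) z := by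
      refine DifferentiableAt.comp z ?_ (differentiableAt_slitToDisk hαβ hz)
      exact (hH _ (by simpa using norm_slitToDisk_lt hαβ hz)).differentiableAt
        (Metric.isOpen_ball.mem_nhds (by simpa using norm_slitToDisk_lt hαβ hz))
    refine h1.congr_of_eventuallyEq ?_
    filter_upwards [eventually_coe_mem_slitSphere hz] with w hw
    exact hf _ hw
  refine ⟨hfin, fun _ => ?_⟩
  -- Infinity is a removable singularity in the chart: continuity there plus differentiability in a
  -- punctured neighbourhood.
  refine (Complex.analyticAt_of_differentiable_on_punctured_nhds_of_continuousAt
    ?_ ?_).differentiableAt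
  · filter_upwards [eventually_nhdsWithin_of_eventually_nhds
      (eventually_chartAtInfty_mem_slitSphere (α := α) (β := β)), self_mem_nhdsWithin] with w hw h0
    have h0' : w ≠ 0 := h0
    rw [chartAtInfty_of_ne_zero h0'] at hw
    have h2 : DifferentiableAt ℂ (fun w : ℂ => f ((w⁻¹ : ℂ) : OnePoint ℂ)) w :=
      DifferentiableAt.comp (g := fun w : ℂ => f (w : OnePoint ℂ)) w (hfin _ hw)
        (differentiableAt_inv h0')
    refine h2.congr_of_eventuallyEq ?_
    filter_upwards [isOpen_ne.mem_nhds h0'] with v hv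
    rw [chartAtInfty_of_ne_zero hv]
  · have h3 : ContinuousAt (fun w : ℂ => H (slitToDisk α β (chartAtInfty w))) 0 := by
      refine ContinuousAt.comp (g := H) ?_ (continuousAt_slitToDisk_chartAtInfty hαβ)
      rw [chartAtInfty_zero, slitToDisk_infty]
      exact hH.continuousOn.continuousAt (Metric.ball_mem_nhds 0 one_pos)
    refine h3.congr ?_
    filter_upwards [eventually_chartAtInfty_mem_slitSphere (α := α) (β := β)] with w hw
    exact (hf _ hw).symm

theorem isHolomorphicOn_schwarz (hαβ : α < β) {s : ℝ → ℝ} (hs : Integrable s (arcsine α β)) :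
    IsHolomorphicOn (schwarz α β s) (slitSphere α β) :=
  .of_disk hαβ (differentiableOn_herglotzIntegral ((circleIntegrable_liftCircle_iff hαβ s).2 hs))
    fun _ hz => schwarz_eq_herglotzIntegral hαβ hs hz

theorem IsHolomorphicOn.cexp {f : OnePoint ℂ → ℂ} {U : Set (OnePoint ℂ)}
    (hf : IsHolomorphicOn f U) : IsHolomorphicOn (fun z => Complex.exp (f z)) U :=
  ⟨fun z hz => (hf.1 z hz).cexp, fun h => (hf.2 h).cexp⟩

theorem IsHolomorphicOn.analyticAt_coe {f : OnePoint ℂ → ℂ}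
    (hf : IsHolomorphicOn f (slitSphere α β)) {z : ℂ} (hz : (z : OnePoint ℂ) ∈ slitSphere α β) :
    AnalyticAt ℂ (fun w : ℂ => f (w : OnePoint ℂ)) z := by
  rw [Complex.analyticAt_iff_eventually_differentiableAt]
  exact (eventually_coe_mem_slitSphere hz).mono hf.1

theorem IsHolomorphicOn.analyticAt_infty {f : OnePoint ℂ → ℂ}
    (hf : IsHolomorphicOn f (slitSphere α β)) :
    AnalyticAt ℂ (fun w : ℂ => f (chartAtInfty w)) 0 := by
  refine Complex.analyticAt_of_differentiable_on_punctured_nhds_of_continuousAt ?_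
    (hf.2 infty_mem_slitSphere).continuousAt
  filter_upwards [eventually_nhdsWithin_of_eventually_nhds
    (eventually_chartAtInfty_mem_slitSphere (α := α) (β := β)), self_mem_nhdsWithin] with w hw h0
  have h0' : w ≠ 0 := h0
  rw [chartAtInfty_of_ne_zero h0'] at hw
  have h2 : DifferentiableAt ℂ (fun w : ℂ => f ((w⁻¹ : ℂ) : OnePoint ℂ)) w :=
    DifferentiableAt.comp (g := fun w : ℂ => f (w : OnePoint ℂ)) w (hf.1 _ hw)
      (differentiableAt_inv h0')
  refine h2.congr_of_eventuallyEq ?_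
  filter_upwards [isOpen_ne.mem_nhds h0'] with v hv
  rw [chartAtInfty_of_ne_zero hv]

theorem IsHolomorphicOn.isHarmonicOn_re {f : OnePoint ℂ → ℂ}
    (hf : IsHolomorphicOn f (slitSphere α β)) :
    IsHarmonicOn (fun z => (f z).re) (slitSphere α β) :=
  ⟨fun _ hz => (hf.analyticAt_coe hz).harmonicAt_re, fun _ => hf.analyticAt_infty.harmonicAt_re⟩

end Holomorphic

/-! ### Attainment of continuous boundary data. -/

section BoundaryValues

variable {α β : ℝ} {s : ℝ → ℝ}

theorem integrable_arcsine_of_continuousOn {E : Type*} [NormedAddCommGroup E] [NormedSpace ℝ E]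
    (hαβ : α < β) {f : ℝ → E} (hf : ContinuousOn f (Set.Icc α β)) :
    Integrable f (arcsine α β) := by
  rw [integrable_arcsine_iff_integrableOn hαβ]
  refine IntegrableOn.mono_set (t := Set.Icc 0 Real.pi) ?_ Set.Ioo_subset_Icc_self
  refine ContinuousOn.integrableOn_Icc (hf.comp ?_ fun t _ => affinePoint_mem hαβ ?_)
  · unfold affinePoint; fun_prop
  · exact ⟨Real.neg_one_le_cos t, Real.cos_le_one t⟩

theorem exists_norm_eq_one_affinePoint (hαβ : α < β) {x : ℝ} (hx : x ∈ Set.Icc α β) :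
    ∃ z : ℂ, ‖z‖ = 1 ∧ affinePoint α β z.re = x := by
  have hne : β - α ≠ 0 := by linarith
  set y := (x - (α + β) / 2) * (2 / (β - α)) with hy
  have h1 : -1 ≤ y := by
    rw [hy, mul_div_assoc', le_div_iff₀ (by linarith)]; linarith [hx.1]
  have h2 : y ≤ 1 := by
    rw [hy, mul_div_assoc', div_le_iff₀ (by linarith)]; linarith [hx.2]
  refine ⟨circleMap 0 1 (Real.arccos y), by simp, ?_⟩
  rw [re_circleMap, Real.cos_arccos h1 h2, affinePoint, hy]; field_simp; ring

/-- Half the minor axis of the ellipse through `z` with foci `α` and `β`. -/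
noncomputable def minorAxis (α β : ℝ) (z : ℂ) : ℝ :=
  Real.sqrt ((‖z - α‖ + ‖z - β‖) ^ 2 - (β - α) ^ 2) / 2

theorem minorAxis_joukowsky (hαβ : α < β) {ζ : ℂ} (h0 : ζ ≠ 0) (h1 : ‖ζ‖ < 1) :
    minorAxis α β (joukowsky α β ζ) = (β - α) / 4 * (‖ζ‖⁻¹ - ‖ζ‖) := by
  have hr : 0 < ‖ζ‖ := norm_pos_iff.2 h0
  have h2 : 1 < ‖ζ‖⁻¹ := (one_lt_inv₀ hr).2 h1
  have e : ((β - α) / 2 * (‖ζ‖ + ‖ζ‖⁻¹)) ^ 2 - (β - α) ^ 2 =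
      ((β - α) / 2 * (‖ζ‖⁻¹ - ‖ζ‖)) ^ 2 := by field_simp; ring
  rw [minorAxis, norm_sub_add_norm_sub_joukowsky hαβ h0, e, Real.sqrt_sq
    (mul_nonneg (by linarith) (by linarith))]
  ring

theorem abs_mul_inv_sq_sub_le {a r : ℝ} (h0 : 0 < r) (h1 : r < 1) (ha : |a| ≤ r) :
    |a / r ^ 2 - a| ≤ r⁻¹ - r := by
  have h2 : a / r ^ 2 - a = a * ((r⁻¹) ^ 2 - 1) := by field_simp
  have h3 : 1 < r⁻¹ := (one_lt_inv₀ h0).2 h1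
  rw [h2, abs_mul, abs_of_pos (by nlinarith : 0 < (r⁻¹) ^ 2 - 1)]
  calc _ ≤ r * ((r⁻¹) ^ 2 - 1) := by gcongr; nlinarith
    _ = _ := by field_simp

/-- With ζ = r e^{it}, the real part is (β - α)/4 · (1/r - r) cos t, and the first factors are the
semi-minor axis. -/
theorem abs_re_slitSqrt_le (hαβ : α < β) {z : ℂ} (hz : (z : OnePoint ℂ) ∈ slitSphere α β) :
    |(slitSqrt α β z).re| ≤ minorAxis α β z := by
  obtain ⟨ζ, h0, h1, rfl⟩ := exists_joukowsky_eq hαβ hz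
  rw [minorAxis_joukowsky hαβ h0 h1, slitSqrt_joukowsky hαβ h0 h1]
  have e : ((β - α : ℂ) / 4 * (ζ⁻¹ - ζ)).re = (β - α) / 4 * (ζ.re / ‖ζ‖ ^ 2 - ζ.re) := by
    have : (β - α : ℂ) / 4 = (((β - α) / 4 : ℝ) : ℂ) := by push_cast; ring
    rw [this, Complex.re_ofReal_mul, Complex.sub_re, Complex.inv_re, Complex.normSq_eq_norm_sq]
  rw [e, abs_mul, abs_of_pos (by linarith : 0 < (β - α) / 4)]
  have := abs_mul_inv_sq_sub_le (norm_pos_iff.2 h0) h1 (Complex.abs_re_le_norm ζ)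
  gcongr

theorem abs_im_le_minorAxis (hαβ : α < β) {z : ℂ} (hz : (z : OnePoint ℂ) ∈ slitSphere α β) :
    |z.im| ≤ minorAxis α β z := by
  obtain ⟨ζ, h0, h1, rfl⟩ := exists_joukowsky_eq hαβ hz
  rw [minorAxis_joukowsky hαβ h0 h1]
  have e : (joukowsky α β ζ).im = -((β - α) / 4 * (ζ.im / ‖ζ‖ ^ 2 - ζ.im)) := by
    have h2 : (β - α : ℂ) / 4 = (((β - α) / 4 : ℝ) : ℂ) := by push_cast; ring
    have h3 : (α + β : ℂ) / 2 = (((α + β) / 2 : ℝ) : ℂ) := by push_cast; ring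
    rw [joukowsky, h2, h3, Complex.add_im, Complex.ofReal_im, Complex.im_ofReal_mul,
      Complex.add_im, Complex.inv_im, Complex.normSq_eq_norm_sq]
    ring
  rw [e, abs_neg, abs_mul, abs_of_pos (by linarith : 0 < (β - α) / 4)]
  have := abs_mul_inv_sq_sub_le (norm_pos_iff.2 h0) h1 (Complex.abs_im_le_norm ζ)
  gcongr

theorem norm_slitSqrt_le (hαβ : α < β) {z : ℂ} (hz : (z : OnePoint ℂ) ∈ slitSphere α β) :
    ‖slitSqrt α β z‖ ≤ ‖z - α‖ + ‖z - β‖ := by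
  obtain ⟨ζ, h0, h1, rfl⟩ := exists_joukowsky_eq hαβ hz
  rw [norm_sub_add_norm_sub_joukowsky hαβ h0, slitSqrt_joukowsky hαβ h0 h1, norm_mul,
    norm_ofReal_sub_eq hαβ]
  have h2 : ‖ζ⁻¹ - ζ‖ ≤ ‖ζ‖ + ‖ζ‖⁻¹ := (norm_sub_le _ _).trans (by rw [norm_inv, add_comm])
  have h3 := norm_nonneg (ζ⁻¹ - ζ)
  nlinarith

theorem re_kernel_slit_nonneg (hαβ : α < β) {z : ℂ} (hz : (z : OnePoint ℂ) ∈ slitSphere α β)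
    {x : ℝ} (hx : x ∈ Set.Icc α β) : 0 ≤ (slitSqrt α β z / (z - x)).re := by
  obtain ⟨ζ, h0, h1, rfl⟩ := exists_joukowsky_eq hαβ hz
  obtain ⟨w, hw, rfl⟩ := exists_norm_eq_one_affinePoint hαβ hx
  rw [← kernel_add_kernel_inv hαβ h0 h1 hw]
  have h2 := re_kernel_nonneg (z := w) (by simpa using hw) h1
  have h3 := re_kernel_nonneg (z := w⁻¹) (by simpa using hw) h1
  rw [← Complex.ofReal_ofNat, Complex.div_ofReal_re, Complex.add_re]
  positivity

/-- Each term of the numerator Re w · Re(z - x) + Im w · Im z carries a factor bounded by the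
semi-minor axis, which tends to 0 at the slit. So the kernel dies uniformly away from its pole. -/
theorem abs_re_kernel_slit_le (hαβ : α < β) {z : ℂ} (hz : (z : OnePoint ℂ) ∈ slitSphere α β)
    {x η : ℝ} (hη : 0 < η) (h : η ≤ ‖z - x‖) :
    |(slitSqrt α β z / (z - x)).re| ≤
      minorAxis α β z * (1 / η + (‖z - α‖ + ‖z - β‖) / η ^ 2) := by
  set w := slitSqrt α β z
  have h1 := abs_re_slitSqrt_le hαβ hz
  have h2 := abs_im_le_minorAxis hαβ hz
  have h3 := norm_slitSqrt_le hαβ hz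
  have h4 : 0 < ‖z - x‖ := hη.trans_le h
  have hm : 0 ≤ minorAxis α β z := (abs_nonneg _).trans h2
  have e : (w / (z - x)).re = (w.re * (z - x).re + w.im * z.im) / ‖z - x‖ ^ 2 := by
    rw [Complex.div_re, Complex.normSq_eq_norm_sq, ← add_div]
    simp
  rw [e, abs_div, abs_of_pos (pow_pos h4 2)]
  have h5 : |w.re * (z - x).re + w.im * z.im| ≤
      minorAxis α β z * (‖z - x‖ + (‖z - α‖ + ‖z - β‖)) := by
    refine (abs_add_le _ _).trans ?_
    rw [abs_mul, abs_mul, mul_add]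
    refine add_le_add (mul_le_mul h1 (Complex.abs_re_le_norm _) (abs_nonneg _) hm) ?_
    rw [mul_comm]
    exact mul_le_mul h2 ((Complex.abs_im_le_norm _).trans h3) (abs_nonneg _) hm
  calc _ ≤ minorAxis α β z * (‖z - x‖ + (‖z - α‖ + ‖z - β‖)) / ‖z - x‖ ^ 2 := by gcongr
    _ = minorAxis α β z * (1 / ‖z - x‖ + (‖z - α‖ + ‖z - β‖) / ‖z - x‖ ^ 2) := by
      field_simp
    _ ≤ _ := by gcongr

theorem re_schwarz_eq_integral (hαβ : α < β) (hs : ContinuousOn s (Set.Icc α β)) {z : ℂ}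
    (hz : (z : OnePoint ℂ) ∈ slitSphere α β) :
    (schwarz α β s (z : OnePoint ℂ)).re =
      ∫ x, (slitSqrt α β z / (z - x)).re * s x ∂(arcsine α β) := by
  have h1 : Integrable (fun x : ℝ => slitSqrt α β z * ((s x : ℂ) / (z - x))) (arcsine α β) := by
    refine integrable_arcsine_of_continuousOn hαβ ?_
    refine continuousOn_const.mul (ContinuousOn.div ?_ (by fun_prop) fun x hx => ?_)
    · exact Complex.continuous_ofReal.comp_continuousOn hs
    · exact sub_ne_zero.2 (coe_mem_slitSphere.1 hz x hx)
  rw [schwarz_coe, ← integral_const_mul, ← RCLike.re_eq_complex_re, ← integral_re h1]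
  refine integral_congr_ae (ae_of_all _ fun x => ?_)
  simp only [RCLike.re_eq_complex_re]
  rw [mul_div_left_comm, Complex.re_ofReal_mul, mul_comm]

/-- The solution of the Dirichlet problem attains continuous boundary data. -/
theorem tendsto_re_schwarz (hαβ : α < β) (hs : Continuous s) {x₀ : ℝ} (hx₀ : x₀ ∈ Set.Icc α β) :
    Tendsto (fun z : ℂ => (schwarz α β s (z : OnePoint ℂ)).re)
      (𝓝[{z : ℂ | (z : OnePoint ℂ) ∈ slitSphere α β}] (x₀ : ℂ)) (𝓝 (s x₀)) := by
  set l := 𝓝[{z : ℂ | (z : OnePoint ℂ) ∈ slitSphere α β}] (x₀ : ℂ)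
  have hmem : ∀ᶠ z : ℂ in l, ((z : ℂ) : OnePoint ℂ) ∈ slitSphere α β := self_mem_nhdsWithin
  have hres : (arcsine α β).restrict (Set.Icc α β) = arcsine α β :=
    Measure.restrict_eq_self_of_ae_mem ae_arcsine_mem
  -- The kernel Re(w(z)/(z - x)) is an approximate identity at x₀: nonnegative, of total mass 1, and
  -- uniformly small off any neighbourhood of x₀.
  have key := tendsto_setIntegral_peak_smul_of_integrableOn_of_tendsto (μ := arcsine α β)
    (s := Set.Icc α β) (t := Set.Icc α β) (x₀ := x₀) (l := l) (g := s) (a := s x₀)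
    (φ := fun z x => (slitSqrt α β z / (z - x)).re)
    measurableSet_Icc measurableSet_Icc subset_rfl self_mem_nhdsWithin
    (measure_ne_top _ _) ?_ ?_ ?_ ?_ ?_ ?_
  · refine key.congr' ?_
    filter_upwards [hmem] with z hz
    rw [hres, re_schwarz_eq_integral hαβ hs.continuousOn hz]
    simp only [smul_eq_mul]
  · filter_upwards [hmem] with z hz x hx using re_kernel_slit_nonneg hαβ hz hx
  · intro u hu hxu
    obtain ⟨η, hη, hηu⟩ := Metric.isOpen_iff.1 hu x₀ hxu
    rw [Metric.tendstoUniformlyOn_iff]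
    intro ε hε
    have hlim : Tendsto (fun z : ℂ => minorAxis α β z *
        (1 / (η / 2) + (‖z - α‖ + ‖z - β‖) / (η / 2) ^ 2)) l (𝓝 0) := by
      have hc : Continuous fun z : ℂ => minorAxis α β z *
          (1 / (η / 2) + (‖z - α‖ + ‖z - β‖) / (η / 2) ^ 2) := by
        unfold minorAxis; fun_prop
      have h0 : minorAxis α β x₀ = 0 := by
        rw [minorAxis, norm_sub_add_norm_sub_of_mem hx₀]; simp
      have := hc.tendsto (x₀ : ℂ)
      rw [h0, zero_mul] at this
      exact this.mono_left nhdsWithin_le_nhds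
    filter_upwards [hmem, hlim.eventually (gt_mem_nhds hε),
      nhdsWithin_le_nhds (Metric.ball_mem_nhds (x₀ : ℂ) (half_pos hη))] with z hz hz2 hz3 x hx
    simp only [Pi.zero_apply, dist_zero_left, Real.norm_eq_abs]
    refine (abs_re_kernel_slit_le hαβ hz (half_pos hη) ?_).trans_lt hz2
    -- x is at distance at least η from x₀ and z within η/2 of it, which leaves η/2 between z and x.
    have h4 : η ≤ |x - x₀| := by
      by_contra h
      exact hx.2 (hηu (by rw [Metric.mem_ball, Real.dist_eq]; linarith))
    rw [Metric.mem_ball, dist_eq_norm] at hz3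
    have h5 : |x - x₀| = ‖(x : ℂ) - x₀‖ := by
      rw [← Complex.ofReal_sub, Complex.norm_real, Real.norm_eq_abs]
    have h6 : ‖(x : ℂ) - x₀‖ ≤ ‖z - x‖ + ‖z - x₀‖ := by
      rw [norm_sub_rev z x]
      exact norm_sub_le_norm_sub_add_norm_sub _ _ _
    linarith
  · refine tendsto_const_nhds.congr' ?_
    filter_upwards [hmem] with z hz
    rw [hres]
    have := re_schwarz_eq_integral hαβ (continuousOn_const (c := (1 : ℝ))) hz
    simp only [mul_one] at this
    rw [← this, re_schwarz_const hαβ 1 hz]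
  · refine Eventually.of_forall fun z => Measurable.aestronglyMeasurable ?_
    fun_prop
  · rw [IntegrableOn, hres]
    exact integrable_arcsine_of_continuousOn hαβ hs.continuousOn
  · exact hs.continuousAt.mono_left nhdsWithin_le_nhds

end BoundaryValues

/-! ### The maximum principle on the Riemann sphere. -/

section MaximumPrinciple

/-- Puts the chart at infinity on the same footing as the affine chart, so one local argument serves
both. -/
theorem nhds_infty_eq_map_chartAtInfty :
    𝓝 (OnePoint.infty : OnePoint ℂ) = map chartAtInfty (𝓝 0) := by
  have h1 : 𝓝 (0 : ℂ) = 𝓝[≠] 0 ⊔ pure 0 := by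
    rw [sup_comm]; exact (pure_sup_nhdsNE 0).symm
  rw [OnePoint.nhds_infty_eq, h1, Filter.map_sup, Filter.map_pure, chartAtInfty_zero,
    coclosedCompact_eq_cocompact, ← Metric.cobounded_eq_cocompact]
  congr 1
  have : map (fun w : ℂ => w⁻¹) (𝓝[≠] 0) = Bornology.cobounded ℂ := inv_nhdsNE_zero
  rw [← this, Filter.map_map]
  refine Filter.map_congr ?_
  filter_upwards [self_mem_nhdsWithin] with w hw
  exact (chartAtInfty_of_ne_zero hw).symm

/-- The modulus of exp G is exp U, so the maximum modulus principle makes exp G locally constant.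
The map `c` stands for either chart. -/
theorem eventually_eq_of_isLocalMax_re {U : OnePoint ℂ → ℝ} {G : OnePoint ℂ → ℂ} {c : ℂ → OnePoint ℂ}
    {a : ℂ} (hc : 𝓝 (c a) = map c (𝓝 a)) (hG : AnalyticAt ℂ (fun w => G (c w)) a)
    (hU : ∀ᶠ w in 𝓝 a, U (c w) = (G (c w)).re) (hmax : ∀ z, U z ≤ U (c a)) :
    ∀ᶠ z in 𝓝 (c a), U z = U (c a) := by
  have h1 : ∀ᶠ w in 𝓝 a, Complex.exp (G (c w)) = Complex.exp (G (c a)) := by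
    refine Complex.eventually_eq_of_isLocalMax_norm (f := fun w => Complex.exp (G (c w))) ?_ ?_
    · exact hG.eventually_analyticAt.mono fun w hw => hw.differentiableAt.cexp
    · filter_upwards [hU] with w hw
      simp only [Function.comp_apply, Complex.norm_exp, ← hw, ← hU.self_of_nhds]
      exact Real.exp_le_exp.2 (hmax _)
  rw [hc, eventually_map]
  filter_upwards [h1, hU] with w hw hw2
  have := congrArg norm hw
  rw [Complex.norm_exp, Complex.norm_exp, Real.exp_eq_exp] at this
  rw [hw2, this, hU.self_of_nhds]

/-- The maximum principle on the Riemann sphere. -/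
theorem exists_mem_forall_le {U : OnePoint ℂ → ℝ} (hU : Continuous U) {K : Set (OnePoint ℂ)}
    (hK : K.Nonempty)
    (h : ∀ p ∉ K, (∀ z, U z ≤ U p) → ∀ᶠ z in 𝓝 p, U z = U p) :
    ∃ p ∈ K, ∀ z, U z ≤ U p := by
  obtain ⟨p, -, hp⟩ := isCompact_univ.exists_isMaxOn Set.univ_nonempty hU.continuousOn
  have hp' : ∀ z, U z ≤ U p := fun z => hp (Set.mem_univ z)
  by_contra! hcon
  -- If the maximum is not attained on K, local constancy makes its level set open as well as
  -- closed. The sphere is connected, so the level set is everything and meets K after all.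
  have hA : IsClopen {z | U z = U p} := by
    refine ⟨isClosed_eq hU continuous_const, isOpen_iff_mem_nhds.2 fun q hq => ?_⟩
    have hq' : U q = U p := hq
    have h2 : ∀ z, U z ≤ U q := fun z => hq' ▸ hp' z
    have h3 : q ∉ K := fun hqK => by
      obtain ⟨z, hz⟩ := hcon q hqK
      exact absurd (h2 z) (not_le.2 hz)
    filter_upwards [h q h3 h2] with z hz
    exact hz.trans hq'
  obtain ⟨k, hk⟩ := hK
  have h4 : k ∈ {z | U z = U p} := by
    rw [hA.eq_univ ⟨p, rfl⟩]; trivial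
  obtain ⟨z, hz⟩ := hcon k hk
  have h5 : U k = U p := h4
  exact absurd (hp' z) (not_le.2 (h5 ▸ hz))

/-- The solution of the Dirichlet problem together with its boundary values. -/
noncomputable def dirichletExt (α β : ℝ) (s : ℝ → ℝ) : OnePoint ℂ → ℝ
  | none => (schwarz α β s OnePoint.infty).re
  | some z => open scoped Classical in
      if (z : OnePoint ℂ) ∈ slitSphere α β then (schwarz α β s (z : OnePoint ℂ)).re else s z.re

variable {α β : ℝ} {s : ℝ → ℝ}

open scoped Classical in
theorem dirichletExt_coe (z : ℂ) : dirichletExt α β s (z : OnePoint ℂ) =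
    if (z : OnePoint ℂ) ∈ slitSphere α β then (schwarz α β s (z : OnePoint ℂ)).re else s z.re :=
  rfl

theorem dirichletExt_of_mem {z : OnePoint ℂ} (hz : z ∈ slitSphere α β) :
    dirichletExt α β s z = (schwarz α β s z).re := by
  induction z using OnePoint.rec with
  | infty => rfl
  | coe z => rw [dirichletExt_coe, if_pos hz]

theorem dirichletExt_ofReal {x : ℝ} (hx : x ∈ Set.Icc α β) :
    dirichletExt α β s ((x : ℂ) : OnePoint ℂ) = s x := by
  rw [dirichletExt_coe, if_neg (fun h => coe_mem_slitSphere.1 h x hx rfl), Complex.ofReal_re]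

/-- Only slit points need care: from off the slit the limit is `tendsto_re_schwarz`, and along the
slit it is the continuity of `s`. -/
theorem continuous_dirichletExt (hαβ : α < β) (hs : Continuous s) :
    Continuous (dirichletExt α β s) := by
  have hi := integrable_arcsine_of_continuousOn hαβ hs.continuousOn
  have hh := isHolomorphicOn_schwarz hαβ hi
  rw [continuous_iff_continuousAt]
  intro z
  induction z using OnePoint.rec with
  | infty =>
    rw [ContinuousAt, nhds_infty_eq_map_chartAtInfty, tendsto_map'_iff]
    have h1 : ContinuousAt (fun w => (schwarz α β s (chartAtInfty w)).re) 0 :=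
      Complex.continuous_re.continuousAt.comp hh.analyticAt_infty.continuousAt
    rw [ContinuousAt, chartAtInfty_zero] at h1
    refine Tendsto.congr' ?_ h1
    filter_upwards [eventually_chartAtInfty_mem_slitSphere (α := α) (β := β)] with w hw
    exact (dirichletExt_of_mem hw).symm
  | coe z =>
    rw [OnePoint.continuousAt_coe]
    by_cases hz : (z : OnePoint ℂ) ∈ slitSphere α β
    · have h1 : ContinuousAt (fun w : ℂ => (schwarz α β s (w : OnePoint ℂ)).re) z :=
        Complex.continuous_re.continuousAt.comp (hh.analyticAt_coe hz).continuousAt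
      refine h1.congr ?_
      filter_upwards [eventually_coe_mem_slitSphere hz] with w hw
      exact (dirichletExt_of_mem hw).symm
    · classical
      obtain ⟨x, hx, rfl⟩ : ∃ x ∈ Set.Icc α β, z = (x : ℂ) := by
        by_contra! hcon
        exact hz (coe_mem_slitSphere.2 hcon)
      rw [ContinuousAt, Function.comp_apply, dirichletExt_ofReal hx]
      refine Tendsto.if (p := fun z : ℂ => (z : OnePoint ℂ) ∈ slitSphere α β)
        (tendsto_re_schwarz hαβ hs hx) ?_
      have : ContinuousAt (fun z : ℂ => s z.re) (x : ℂ) := by fun_prop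
      rw [ContinuousAt, Complex.ofReal_re] at this
      exact this.mono_left inf_le_left

end MaximumPrinciple

/-! ### Injectivity: systems with constant right-hand side. -/

section Injectivity

/-- The velocity is purely imaginary: radii meet the slit perpendicularly. At the endpoints it
vanishes, which does no harm below. -/
theorem hasDerivAt_joukowsky_radial {α β : ℝ} {ζ : ℂ} (hζ : ‖ζ‖ = 1) :
    HasDerivAt (fun r : ℝ => joukowsky α β (r * ζ))
      (((β - α) / 2 * ζ.im : ℝ) * Complex.I) 1 := by
  have h0 : ζ ≠ 0 := by rintro rfl; simp at hζ
  have h1 : HasDerivAt (fun r : ℝ => (r : ℂ) * ζ) ζ 1 := by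
    simpa using (Complex.ofRealCLM.hasDerivAt (x := 1)).mul_const ζ
  have h2 : HasDerivAt (fun r : ℝ => ((r : ℂ) * ζ)⁻¹) (-ζ / ((1 : ℝ) * ζ) ^ 2) 1 :=
    h1.inv (by simpa using h0)
  have h3 := ((h1.add h2).const_mul ((β - α : ℂ) / 4)).const_add ((α + β : ℂ) / 2)
  refine h3.congr_deriv ?_
  have e : -ζ / ((1 : ℝ) * ζ) ^ 2 = -ζ⁻¹ := by simp; field_simp
  rw [e, Complex.inv_eq_conj hζ, ← sub_eq_add_neg, Complex.sub_conj]
  push_cast; ring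

/-- A function holomorphic near `x` and real on the real axis has vanishing normal derivative
of its real part, along the images of radii under the Joukowsky map. -/
theorem hasDerivAt_re_radial {α β : ℝ} {g : ℂ → ℂ} {ζ : ℂ} (hζ : ‖ζ‖ = 1)
    (hg : DifferentiableAt ℂ g (affinePoint α β ζ.re : ℝ))
    (hreal : ∀ᶠ x : ℝ in 𝓝 (affinePoint α β ζ.re), (g x).im = 0) :
    HasDerivAt (fun r : ℝ => (g (joukowsky α β (r * ζ))).re) 0 1 := by
  have h1 := hg.hasDerivAt
  set D := deriv g (affinePoint α β ζ.re : ℝ)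
  -- Real values on the axis force a real derivative D; multiplied by an imaginary velocity it
  -- contributes nothing to the real part.
  have h2 : D.im = 0 := by
    have h3 := Complex.imCLM.hasFDerivAt.comp_hasDerivAt _ h1.comp_ofReal
    have h4 : HasDerivAt (fun x : ℝ => (g x).im) 0 (affinePoint α β ζ.re) :=
      (hasDerivAt_const _ (0 : ℝ)).congr_of_eventuallyEq hreal
    exact h3.unique h4
  have e : joukowsky α β ((1 : ℝ) * ζ) = (affinePoint α β ζ.re : ℝ) := by
    rw [Complex.ofReal_one, one_mul, joukowsky_of_norm_eq_one hζ]
  have h5 : HasDerivAt (fun r : ℝ => g (joukowsky α β (r * ζ)))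
      (D * (((β - α) / 2 * ζ.im : ℝ) * Complex.I)) 1 := by
    refine HasDerivAt.comp (𝕜' := ℂ) (1 : ℝ) (h₂ := g) ?_ (hasDerivAt_joukowsky_radial hζ)
    rw [e]; exact h1
  have h6 := Complex.reCLM.hasFDerivAt.comp_hasDerivAt _ h5
  exact h6.congr_deriv (by simp [h2])

variable {d : ℕ} {α β : Fin d → ℝ} {s : Fin d → ℝ → ℝ}

theorem mem_slitSphere_of_ne
    (hdisj : ∀ i j, i ≠ j → Disjoint (Set.Icc (α i) (β i)) (Set.Icc (α j) (β j)))
    {i j : Fin d} (hij : i ≠ j) {x : ℝ}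
    (hx : x ∈ Set.Icc (α i) (β i)) : ((x : ℂ) : OnePoint ℂ) ∈ slitSphere (α j) (β j) := by
  rw [coe_mem_slitSphere]
  intro y hy h
  rw [Complex.ofReal_inj.1 h] at hx
  exact Set.disjoint_left.1 (hdisj i j hij) hx hy

/-- Off the slits of I the sum is locally the real part of a holomorphic function, at infinity too,
so the maximum is attained on some slit. -/
theorem exists_isMax_sum_dirichletExt (hαβ : ∀ i, α i < β i) (hs : ∀ i, Continuous (s i))
    {I : Finset (Fin d)} (hI : I.Nonempty) :
    ∃ i ∈ I, ∃ x ∈ Set.Icc (α i) (β i), ∀ z, ∑ k ∈ I, dirichletExt (α k) (β k) (s k) z ≤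
      ∑ k ∈ I, dirichletExt (α k) (β k) (s k) ((x : ℂ) : OnePoint ℂ) := by
  have hh := fun k => isHolomorphicOn_schwarz (hαβ k)
    (integrable_arcsine_of_continuousOn (hαβ k) (hs k).continuousOn)
  have key := exists_mem_forall_le
    (U := fun z => ∑ k ∈ I, dirichletExt (α k) (β k) (s k) z)
    (K := {p | ∃ i ∈ I, ∃ x ∈ Set.Icc (α i) (β i), p = ((x : ℂ) : OnePoint ℂ)})
    (continuous_finsetSum _ fun k _ => continuous_dirichletExt (hαβ k) (hs k)) ?_ ?_
  · obtain ⟨p, ⟨i, hi, x, hx, rfl⟩, hp⟩ := key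
    exact ⟨i, hi, x, hx, hp⟩
  · obtain ⟨i, hi⟩ := hI
    exact ⟨_, i, hi, α i, ⟨le_rfl, (hαβ i).le⟩, rfl⟩
  · intro p hp hmax
    have hmem : ∀ k ∈ I, p ∈ slitSphere (α k) (β k) := fun k hk x hx hpx => hp ⟨k, hk, x, hx, hpx⟩
    induction p using OnePoint.rec with
    | infty =>
      rw [← chartAtInfty_zero] at hmax ⊢
      refine eventually_eq_of_isLocalMax_re
        (G := fun z => ∑ k ∈ I, schwarz (α k) (β k) (s k) z) ?_ ?_ ?_ hmax
      · rw [chartAtInfty_zero, nhds_infty_eq_map_chartAtInfty]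
      · exact Finset.analyticAt_fun_sum _ fun k _ => (hh k).analyticAt_infty
      · have : ∀ᶠ w : ℂ in 𝓝 0, ∀ k ∈ I, chartAtInfty w ∈ slitSphere (α k) (β k) :=
          (Finset.eventually_all I).2 fun k _ => eventually_chartAtInfty_mem_slitSphere
        filter_upwards [this] with w hw
        rw [Complex.re_sum]
        exact Finset.sum_congr rfl fun k hk => dirichletExt_of_mem (hw k hk)
    | coe z =>
      refine eventually_eq_of_isLocalMax_re (c := ((↑) : ℂ → OnePoint ℂ))
        (G := fun z => ∑ k ∈ I, schwarz (α k) (β k) (s k) z) (OnePoint.nhds_coe_eq z) ?_ ?_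
        hmax
      · exact Finset.analyticAt_fun_sum _ fun k hk => (hh k).analyticAt_coe (hmem k hk)
      · have : ∀ᶠ w : ℂ in 𝓝 z, ∀ k ∈ I, (w : OnePoint ℂ) ∈ slitSphere (α k) (β k) :=
          (Finset.eventually_all I).2 fun k hk => eventually_coe_mem_slitSphere (hmem k hk)
        filter_upwards [this] with w hw
        rw [Complex.re_sum]
        exact Finset.sum_congr rfl fun k hk => dirichletExt_of_mem (hw k hk)

/-- If the sum of the solutions attains its maximum at a point of `Δ_i` where the boundary data on
`Δ_i` is minimal, then the data on `Δ_i` has mean equal to its minimum. -/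
theorem re_schwarz_infty_le_of_isMax (hαβ : ∀ i, α i < β i)
    (hdisj : ∀ i j, i ≠ j → Disjoint (Set.Icc (α i) (β i)) (Set.Icc (α j) (β j)))
    (hs : ∀ i, Continuous (s i)) {I : Finset (Fin d)} {i : Fin d} (hi : i ∈ I) {x₀ : ℝ}
    (hx₀ : x₀ ∈ Set.Icc (α i) (β i))
    (hmax : ∀ z, ∑ k ∈ I, dirichletExt (α k) (β k) (s k) z ≤
      ∑ k ∈ I, dirichletExt (α k) (β k) (s k) ((x₀ : ℂ) : OnePoint ℂ))
    (hmin : ∀ x ∈ Set.Icc (α i) (β i), s i x₀ ≤ s i x) :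
    (schwarz (α i) (β i) (s i) OnePoint.infty).re ≤ s i x₀ := by
  have hint := fun k => integrable_arcsine_of_continuousOn (hαβ k) (hs k).continuousOn
  have hh := fun k => isHolomorphicOn_schwarz (hαβ k) (hint k)
  obtain ⟨ζ, hζ, hζx⟩ := exists_norm_eq_one_affinePoint (hαβ i) hx₀
  have hζ0 : ζ ≠ 0 := by rintro rfl; simp at hζ
  set m := s i x₀ with hm
  set D := (schwarz (α i) (β i) (s i) OnePoint.infty).re - m with hD
  by_contra! hcon
  have hDpos : 0 < D := sub_pos.2 hcon
  -- G collects the other terms; it is holomorphic near x₀ and real on the real axis there, so Re G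
  -- is stationary along the radial path.
  set G : OnePoint ℂ → ℂ := fun z => ∑ k ∈ I.erase i, schwarz (α k) (β k) (s k) z with hG
  have hmem : ∀ k ∈ I.erase i, ∀ x ∈ Set.Icc (α i) (β i),
      ((x : ℂ) : OnePoint ℂ) ∈ slitSphere (α k) (β k) := fun k hk x hx =>
    mem_slitSphere_of_ne hdisj (Finset.ne_of_mem_erase hk).symm hx
  have hev : ∀ᶠ w : ℂ in 𝓝 (x₀ : ℂ), ∀ k ∈ I.erase i, (w : OnePoint ℂ) ∈ slitSphere (α k) (β k) :=
    (Finset.eventually_all _).2 fun k hk => eventually_coe_mem_slitSphere (hmem k hk x₀ hx₀)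
  have hder : HasDerivAt (fun r : ℝ => (G (joukowsky (α i) (β i) (r * ζ) : ℂ)).re) 0 1 := by
    refine hasDerivAt_re_radial (g := fun w : ℂ => G (w : OnePoint ℂ)) hζ ?_ ?_
    · rw [hζx]
      exact (Finset.analyticAt_fun_sum _ fun k hk =>
        (hh k).analyticAt_coe (hmem k hk x₀ hx₀)).differentiableAt
    · rw [hζx]
      filter_upwards [Complex.continuous_ofReal.continuousAt.eventually hev] with x hx
      rw [hG, Complex.im_sum]
      exact Finset.sum_eq_zero fun k hk => im_schwarz_ofReal (hαβ k) (hx k hk)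
  have e1 : joukowsky (α i) (β i) ((1 : ℝ) * ζ) = x₀ := by
    rw [Complex.ofReal_one, one_mul, joukowsky_of_norm_eq_one hζ, hζx]
  have hsum : ∀ w : ℂ, (∀ k ∈ I.erase i, (w : OnePoint ℂ) ∈ slitSphere (α k) (β k)) →
      ∑ k ∈ I, dirichletExt (α k) (β k) (s k) (w : OnePoint ℂ) =
        dirichletExt (α i) (β i) (s i) (w : OnePoint ℂ) + (G w).re := by
    intro w hw
    rw [← Finset.add_sum_erase _ _ hi, hG, Complex.re_sum]
    congr 1
    exact Finset.sum_congr rfl fun k hk => dirichletExt_of_mem (hw k hk)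
  have htend : Tendsto (fun r : ℝ => joukowsky (α i) (β i) (r * ζ)) (𝓝[<] 1) (𝓝 (x₀ : ℂ)) := by
    rw [← e1]
    exact (hasDerivAt_joukowsky_radial hζ).continuousAt.tendsto.mono_left nhdsWithin_le_nhds
  have hslope := (hasDerivAt_iff_tendsto_slope.1 hder).mono_left
    (nhdsWithin_mono (1 : ℝ) (show Set.Iio 1 ⊆ {1}ᶜ from fun _ hr => ne_of_lt hr))
  -- By maximality the growth of the i-th term is at most the decrease of Re G; by Harnack that
  -- growth is at least (1 - r)/(1 + r) · D ≥ (1 - r)/2 · D. Division by r - 1 < 0 bounds the slope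
  -- below by D/2, contradicting derivative 0.
  have hge : ∀ᶠ r : ℝ in 𝓝[<] 1, D / 2 ≤
      slope (fun r : ℝ => (G (joukowsky (α i) (β i) (r * ζ) : ℂ)).re) 1 r := by
    filter_upwards [htend.eventually hev, Ioo_mem_nhdsLT (zero_lt_one' ℝ)] with r hr hr1
    have hn : ‖(r : ℂ) * ζ‖ = r := by
      rw [norm_mul, hζ, mul_one, Complex.norm_real, Real.norm_of_nonneg hr1.1.le]
    have hne : (r : ℂ) * ζ ≠ 0 := by rw [← norm_pos_iff, hn]; exact hr1.1
    have hlt : ‖(r : ℂ) * ζ‖ < 1 := by rw [hn]; exact hr1.2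
    have hz := joukowsky_mem (hαβ i) hne hlt
    have h1 := hmax (joukowsky (α i) (β i) (r * ζ) : ℂ)
    rw [hsum _ hr, hsum _ hev.self_of_nhds, dirichletExt_ofReal hx₀, dirichletExt_of_mem hz] at h1
    have h2 := harnack_re_schwarz_lower (hαβ i) (hint i) hmin hz
    rw [slitToDisk_joukowsky (hαβ i) hne hlt, hn, ← hD] at h2
    rw [slope_def_field, e1, le_div_iff_of_neg (by linarith [hr1.2])]
    have h3 : (1 - r) / 2 * D ≤ (1 - r) / (1 + r) * D := by
      have := hr1.1; have := hr1.2
      gcongr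
      linarith
    linarith
  have := ge_of_tendsto hslope hge
  linarith

/-- Solutions of the system with constant right-hand side are constant. -/
theorem eq_of_system_const (hαβ : ∀ i, α i < β i)
    (hdisj : ∀ i j, i ≠ j → Disjoint (Set.Icc (α i) (β i)) (Set.Icc (α j) (β j)))
    (hs : ∀ i, Continuous (s i)) (n : ℕ) : ∀ (I : Finset (Fin d)), I.card = n → ∀ c : ℝ,
    (∀ i ∈ I, ∀ x ∈ Set.Icc (α i) (β i), 2 * s i x +
      ∑ k ∈ I.erase i, (schwarz (α k) (β k) (s k) ((x : ℂ) : OnePoint ℂ)).re = c) →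
    ∀ i ∈ I, ∀ x ∈ Set.Icc (α i) (β i), s i x = c / (n + 1) := by
  have hint := fun k => integrable_arcsine_of_continuousOn (hαβ k) (hs k).continuousOn
  induction n with
  | zero =>
    intro I hI c _ i hi
    rw [Finset.card_eq_zero] at hI
    simp [hI] at hi
  | succ n ih =>
    intro I hI c hc
    -- One of the two copies of s_j is the boundary value of its own extension, which completes the
    -- sum U; so s_j is smallest where U is largest.
    have hext : ∀ j ∈ I, ∀ x ∈ Set.Icc (α j) (β j),
        ∑ k ∈ I, dirichletExt (α k) (β k) (s k) ((x : ℂ) : OnePoint ℂ) + s j x = c := by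
      intro j hj x hx
      rw [← hc j hj x hx, ← Finset.add_sum_erase _ _ hj, dirichletExt_ofReal hx,
        Finset.sum_congr rfl fun k hk => dirichletExt_of_mem
          (mem_slitSphere_of_ne hdisj (Finset.ne_of_mem_erase hk).symm hx)]
      ring
    obtain ⟨i, hi, x₀, hx₀, hmax⟩ := exists_isMax_sum_dirichletExt hαβ hs
      (Finset.card_pos.1 (by rw [hI]; exact n.succ_pos))
    have hmin : ∀ x ∈ Set.Icc (α i) (β i), s i x₀ ≤ s i x := fun x hx => by
      linarith [hext i hi x hx, hext i hi x₀ hx₀, hmax ((x : ℂ) : OnePoint ℂ)]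
    have hinf := re_schwarz_infty_le_of_isMax hαβ hdisj hs hi hx₀ hmax hmin
    have hcard : (I.erase i).card = n := by rw [Finset.card_erase_of_mem hi, hI]; rfl
    -- The i-th extension is the constant s_i(x₀) and moves to the right-hand side. This is why the
    -- induction allows an arbitrary constant c and not only 0.
    have hIH := ih (I.erase i) hcard (c - s i x₀) (fun j hj x hx => by
      have hji := Finset.ne_of_mem_erase hj
      have h1 := hc j (Finset.mem_of_mem_erase hj) x hx
      rw [← Finset.add_sum_erase (I.erase j) _ (Finset.mem_erase.2 ⟨hji.symm, hi⟩),
        re_schwarz_eq_of_infty_le (hαβ i) (hint i) hmin hinf (mem_slitSphere_of_ne hdisj hji hx),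
        Finset.erase_right_comm] at h1
      linarith)
    have hother : ∀ k ∈ I.erase i, ∀ x ∈ Set.Icc (α i) (β i),
        (schwarz (α k) (β k) (s k) ((x : ℂ) : OnePoint ℂ)).re = (c - s i x₀) / (n + 1) := by
      intro k hk x hx
      rw [schwarz_congr (t := fun _ => (c - s i x₀) / (n + 1))
        (ae_arcsine_mem.mono fun y hy => hIH k hk y hy)]
      exact re_schwarz_const (hαβ k) _
        (mem_slitSphere_of_ne hdisj (Finset.ne_of_mem_erase hk).symm hx)
    have hi' : ∀ x ∈ Set.Icc (α i) (β i), 2 * s i x + n * ((c - s i x₀) / (n + 1)) = c := by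
      intro x hx
      have h1 := hc i hi x hx
      rwa [Finset.sum_congr rfl fun k hk => hother k hk x hx, Finset.sum_const,
        hcard, nsmul_eq_mul] at h1
    have hn : (n : ℝ) + 1 ≠ 0 := by positivity
    have hn2 : (n : ℝ) + 1 + 1 ≠ 0 := by positivity
    have h0 : s i x₀ = c / (n + 1 + 1) := by
      have := hi' x₀ hx₀
      field_simp at this ⊢
      linarith
    have h00 : (c - s i x₀) / (n + 1) = c / (n + 1 + 1) := by
      rw [h0]; field_simp; ring
    intro j hj x hx
    push_cast
    by_cases hji : j = i
    · subst hji
      rw [← h0]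
      linarith [hi' x hx, hi' x₀ hx₀]
    · rw [hIH j (Finset.mem_erase.2 ⟨hji, hj⟩) x hx, h00]

end Injectivity

/-! ### Compactness of ℋ and solvability of the linear system. -/

section CompactOperator

/-- One modulus of continuity at z₀ serves all data bounded by 1; this is the equicontinuity
required by Arzelà–Ascoli. -/
theorem exists_modulus_re_schwarz {α β : ℝ} (hαβ : α < β) {z₀ : ℂ}
    (hz₀ : (z₀ : OnePoint ℂ) ∈ slitSphere α β) : ∃ b : ℂ → ℝ, Tendsto b (𝓝 z₀) (𝓝 0) ∧
      ∀ᶠ z : ℂ in 𝓝 z₀, ∀ s : ℝ → ℝ, Integrable s (arcsine α β) →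
        (∀ x ∈ Set.Icc α β, |s x| ≤ 1) →
        |(schwarz α β s (z₀ : OnePoint ℂ)).re - (schwarz α β s (z : OnePoint ℂ)).re| ≤ b z := by
  have h1 := norm_slitToDisk_lt hαβ hz₀
  have hc := (differentiableAt_slitToDisk hαβ hz₀).continuousAt
  obtain ⟨q, hq, hq1⟩ := exists_between h1
  refine ⟨fun z => 2 / (1 - q) ^ 2 *
    ‖slitToDisk α β (z₀ : OnePoint ℂ) - slitToDisk α β (z : OnePoint ℂ)‖ * 1, ?_, ?_⟩
  · have : ContinuousAt (fun z : ℂ => 2 / (1 - q) ^ 2 *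
        ‖slitToDisk α β (z₀ : OnePoint ℂ) - slitToDisk α β (z : OnePoint ℂ)‖ * 1) z₀ := by
      fun_prop
    simpa [ContinuousAt] using this
  · filter_upwards [eventually_coe_mem_slitSphere hz₀, hc.norm.eventually (gt_mem_nhds hq)]
      with z hz hzq s hs hs1
    rw [re_schwarz_eq_poissonIntegral hαβ hs hz, re_schwarz_eq_poissonIntegral hαβ hs hz₀]
    refine abs_poissonIntegral_sub_le ((circleIntegrable_liftCircle_iff hαβ s).2 hs)
      (fun w hw => hs1 _ ?_) hq1 hq.le hzq.le
    exact affinePoint_re_mem hαβ (by simpa using hw)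

variable {d : ℕ} {α β : Fin d → ℝ}

theorem operH_eq (s : Fin d → ℝ → ℝ) (i : Fin d) (x : ℝ) : operH α β s i x =
    -(1 / 2) * ∑ j ∈ Finset.univ.erase i,
      (schwarz (α j) (β j) (s j) ((x : ℂ) : OnePoint ℂ)).re := by
  simp only [operH, dirichlet_eq_re]

theorem operH_congr {s t : Fin d → ℝ → ℝ} (h : ∀ i, s i =ᵐ[arcsine (α i) (β i)] t i)
    (i : Fin d) (x : ℝ) : operH α β s i x = operH α β t i x := by
  rw [operH_eq, operH_eq]
  simp only [schwarz_congr (h _)]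

variable (hαβ : ∀ i, α i < β i)
  (hdisj : ∀ i j, i ≠ j → Disjoint (Set.Icc (α i) (β i)) (Set.Icc (α j) (β j)))

theorem operH_add (hαβ : ∀ i, α i < β i)
    (hdisj : ∀ i j, i ≠ j → Disjoint (Set.Icc (α i) (β i)) (Set.Icc (α j) (β j)))
    {s t : Fin d → ℝ → ℝ} (hs : ∀ i, Integrable (s i) (arcsine (α i) (β i)))
    (ht : ∀ i, Integrable (t i) (arcsine (α i) (β i))) {i : Fin d} {x : ℝ}
    (hx : x ∈ Set.Icc (α i) (β i)) :
    operH α β (fun j y => s j y + t j y) i x = operH α β s i x + operH α β t i x := by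
  rw [operH_eq, operH_eq, operH_eq, ← mul_add, ← Finset.sum_add_distrib]
  congr 1
  exact Finset.sum_congr rfl fun k hk => re_schwarz_add (hαβ k) (hs k) (ht k)
    (mem_slitSphere_of_ne hdisj (Finset.ne_of_mem_erase hk).symm hx)

theorem operH_const_mul (hαβ : ∀ i, α i < β i)
    (hdisj : ∀ i j, i ≠ j → Disjoint (Set.Icc (α i) (β i)) (Set.Icc (α j) (β j)))
    {s : Fin d → ℝ → ℝ} (hs : ∀ i, Integrable (s i) (arcsine (α i) (β i))) (c : ℝ) {i : Fin d}
    {x : ℝ} (hx : x ∈ Set.Icc (α i) (β i)) :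
    operH α β (fun j y => c * s j y) i x = c * operH α β s i x := by
  rw [operH_eq, operH_eq, mul_left_comm]
  congr 1
  rw [Finset.mul_sum]
  exact Finset.sum_congr rfl fun k hk => re_schwarz_const_mul (hαβ k) c (hs k)
    (mem_slitSphere_of_ne hdisj (Finset.ne_of_mem_erase hk).symm hx)

/-- The smoothing property of ℋ: every evaluation takes place off the slit carrying the data, so
integrability suffices. -/
theorem continuousOn_operH (hαβ : ∀ i, α i < β i)
    (hdisj : ∀ i j, i ≠ j → Disjoint (Set.Icc (α i) (β i)) (Set.Icc (α j) (β j)))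
    {s : Fin d → ℝ → ℝ} (hs : ∀ i, Integrable (s i) (arcsine (α i) (β i))) (i : Fin d) :
    ContinuousOn (operH α β s i) (Set.Icc (α i) (β i)) := by
  intro x hx
  refine ContinuousAt.continuousWithinAt ?_
  have e : operH α β s i = fun x : ℝ => -(1 / 2) * ∑ j ∈ Finset.univ.erase i,
      (schwarz (α j) (β j) (s j) ((x : ℂ) : OnePoint ℂ)).re := funext (operH_eq s i)
  rw [e]
  refine continuousAt_const.mul (tendsto_finsetSum _ fun k hk => ?_)
  have h1 := ((isHolomorphicOn_schwarz (hαβ k) (hs k)).analyticAt_coe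
    (mem_slitSphere_of_ne hdisj (Finset.ne_of_mem_erase hk).symm hx)).continuousAt
  exact Complex.continuous_re.continuousAt.comp
    (h1.comp (f := fun x : ℝ => (x : ℂ)) Complex.continuous_ofReal.continuousAt)

open scoped BoundedContinuousFunction

/-- The disjoint union of the intervals `[α i, β i]`. -/
abbrev Bands (α β : Fin d → ℝ) : Type := Σ i : Fin d, Set.Icc (α i) (β i)

/-- The restrictions of `t` to the intervals, extended by constants. -/
noncomputable def bandExtend (hαβ : ∀ i, α i < β i) (t : Bands α β →ᵇ ℝ) (i : Fin d) (x : ℝ) : ℝ :=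
  t ⟨i, Set.projIcc (α i) (β i) (hαβ i).le x⟩

theorem bandExtend_of_mem (t : Bands α β →ᵇ ℝ) {i : Fin d} {x : ℝ}
    (hx : x ∈ Set.Icc (α i) (β i)) : bandExtend hαβ t i x = t ⟨i, x, hx⟩ := by
  rw [bandExtend, Set.projIcc_of_mem _ hx]

theorem continuous_bandExtend (t : Bands α β →ᵇ ℝ) (i : Fin d) :
    Continuous (bandExtend hαβ t i) :=
  (t.continuous.comp continuous_sigmaMk).comp continuous_projIcc

theorem integrable_bandExtend (t : Bands α β →ᵇ ℝ) (i : Fin d) :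
    Integrable (bandExtend hαβ t i) (arcsine (α i) (β i)) :=
  integrable_arcsine_of_continuousOn (hαβ i) (continuous_bandExtend hαβ t i).continuousOn

theorem abs_bandExtend_le (t : Bands α β →ᵇ ℝ) (i : Fin d) (x : ℝ) :
    |bandExtend hαβ t i x| ≤ ‖t‖ := t.norm_coe_le_norm _

/-- `ℋ s` as a continuous function on the union of the intervals. -/
noncomputable def operHBand (hαβ : ∀ i, α i < β i)
    (hdisj : ∀ i j, i ≠ j → Disjoint (Set.Icc (α i) (β i)) (Set.Icc (α j) (β j)))
    (s : Fin d → ℝ → ℝ) (hs : ∀ i, Integrable (s i) (arcsine (α i) (β i))) : Bands α β →ᵇ ℝ :=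
  BoundedContinuousFunction.mkOfCompact ⟨fun p => operH α β s p.1 p.2,
    continuous_sigma fun i => continuousOn_iff_continuous_domRestrict.1
      (continuousOn_operH hαβ hdisj hs i)⟩

/-- Each extension is bounded by its data. The constant d is crude, but only boundedness of the
operator matters. -/
theorem abs_operH_le (hαβ : ∀ i, α i < β i)
    (hdisj : ∀ i j, i ≠ j → Disjoint (Set.Icc (α i) (β i)) (Set.Icc (α j) (β j)))
    {s : Fin d → ℝ → ℝ} (hs : ∀ i, Integrable (s i) (arcsine (α i) (β i))) {C : ℝ}
    (hC : ∀ i, ∀ x ∈ Set.Icc (α i) (β i), |s i x| ≤ C) {i : Fin d} {x : ℝ}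
    (hx : x ∈ Set.Icc (α i) (β i)) : |operH α β s i x| ≤ d * C := by
  have hC0 : 0 ≤ C := (abs_nonneg _).trans (hC i x hx)
  rw [operH_eq, abs_mul]
  have h1 : |∑ j ∈ Finset.univ.erase i,
      (schwarz (α j) (β j) (s j) ((x : ℂ) : OnePoint ℂ)).re| ≤ ∑ j ∈ Finset.univ.erase i, C :=
    (Finset.abs_sum_le_sum_abs _ _).trans (Finset.sum_le_sum fun k hk =>
      abs_re_schwarz_le (hαβ k) (hs k) (hC k)
        (mem_slitSphere_of_ne hdisj (Finset.ne_of_mem_erase hk).symm hx))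
  have h2 : ∑ j ∈ Finset.univ.erase i, C ≤ d * C :=
    (Finset.sum_le_sum_of_subset_of_nonneg (Finset.erase_subset _ _) fun _ _ _ => hC0).trans_eq
      (by simp)
  have h3 : |(-(1 / 2) : ℝ)| = 1 / 2 := by norm_num
  rw [h3]
  linarith [abs_nonneg (∑ j ∈ Finset.univ.erase i,
      (schwarz (α j) (β j) (s j) ((x : ℂ) : OnePoint ℂ)).re)]

/-- The operator `ℋ` on continuous functions. -/
noncomputable def operHCLM (hαβ : ∀ i, α i < β i)
    (hdisj : ∀ i j, i ≠ j → Disjoint (Set.Icc (α i) (β i)) (Set.Icc (α j) (β j))) :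
    (Bands α β →ᵇ ℝ) →L[ℝ] (Bands α β →ᵇ ℝ) :=
  LinearMap.mkContinuous
    { toFun := fun t => operHBand hαβ hdisj (bandExtend hαβ t) (integrable_bandExtend hαβ t)
      map_add' := fun t u => by
        ext p
        exact operH_add hαβ hdisj (integrable_bandExtend hαβ t) (integrable_bandExtend hαβ u) p.2.2
      map_smul' := fun c t => by
        ext p
        exact operH_const_mul hαβ hdisj (integrable_bandExtend hαβ t) c p.2.2 }
    d fun t => by
      rw [BoundedContinuousFunction.norm_le (by positivity)]
      exact fun p => abs_operH_le hαβ hdisj (integrable_bandExtend hαβ t)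
        (fun i x _ => abs_bandExtend_le hαβ t i x) p.2.2

theorem operHCLM_apply (t : Bands α β →ᵇ ℝ) (p : Bands α β) :
    operHCLM hαβ hdisj t p = operH α β (bandExtend hαβ t) p.1 p.2 := rfl

/-- The image of the unit ball is uniformly bounded, and equicontinuous because interior estimates
for Poisson integrals hold at positive distance from the slits. -/
theorem isCompactOperator_operHCLM : IsCompactOperator (operHCLM hαβ hdisj) := by
  refine (isCompactOperator_iff_isCompact_closure_image_closedBall
    (operHCLM hαβ hdisj : (Bands α β →ᵇ ℝ) →ₗ[ℝ] (Bands α β →ᵇ ℝ)) one_pos).2 ?_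
  refine BoundedContinuousFunction.arzela_ascoli (Set.Icc (-(d * 1 : ℝ)) (d * 1)) isCompact_Icc _
    ?_ ?_
  · rintro _ p ⟨t, ht, rfl⟩
    rw [mem_closedBall_zero_iff] at ht
    exact abs_le.1 (abs_operH_le hαβ hdisj (integrable_bandExtend hαβ t)
      (fun i x _ => (abs_bandExtend_le hαβ t i x).trans ht) p.2.2)
  · rintro ⟨i, x₀, hx₀⟩
    have hmem : ∀ k ∈ Finset.univ.erase i, ((x₀ : ℂ) : OnePoint ℂ) ∈ slitSphere (α k) (β k) :=
      fun k hk => mem_slitSphere_of_ne hdisj (Finset.ne_of_mem_erase hk).symm hx₀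
    -- The index i gets a dummy modulus, so that `choose` yields a family over all indices.
    have hb : ∀ k : Fin d, ∃ b : ℂ → ℝ, k ∈ Finset.univ.erase i → Tendsto b (𝓝 (x₀ : ℂ)) (𝓝 0) ∧
        ∀ᶠ z : ℂ in 𝓝 (x₀ : ℂ), ∀ s : ℝ → ℝ, Integrable s (arcsine (α k) (β k)) →
          (∀ x ∈ Set.Icc (α k) (β k), |s x| ≤ 1) →
          |(schwarz (α k) (β k) s ((x₀ : ℂ) : OnePoint ℂ)).re -
            (schwarz (α k) (β k) s (z : OnePoint ℂ)).re| ≤ b z := by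
      intro k
      by_cases hk : k ∈ Finset.univ.erase i
      · obtain ⟨b, hb⟩ := exists_modulus_re_schwarz (hαβ k) (hmem k hk)
        exact ⟨b, fun _ => hb⟩
      · exact ⟨0, fun h => absurd h hk⟩
    choose b hb using hb
    have hcoe : Tendsto (fun p : Bands α β => ((p.2 : ℝ) : ℂ)) (𝓝 ⟨i, x₀, hx₀⟩) (𝓝 (x₀ : ℂ)) := by
      have hc : Continuous (fun p : Bands α β => ((p.2 : ℝ) : ℂ)) :=
        continuous_sigma fun j => Complex.continuous_ofReal.comp continuous_subtype_val
      exact hc.tendsto _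
    -- Each interval is open in the disjoint union, so nearby points lie on the same interval and
    -- only one index i has to be compared.
    have hfst : ∀ᶠ p : Bands α β in 𝓝 ⟨i, x₀, hx₀⟩, p.1 = i := by
      rw [Sigma.nhds_mk, eventually_map]
      exact Eventually.of_forall fun _ => rfl
    refine Metric.equicontinuousAt_of_continuity_modulus
      (fun p : Bands α β => 1 / 2 * ∑ k ∈ Finset.univ.erase i, b k ((p.2 : ℝ) : ℂ)) ?_ _ ?_
    · have := (tendsto_finsetSum (Finset.univ.erase i) fun k hk =>
        (hb k hk).1.comp hcoe).const_mul (1 / 2 : ℝ)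
      simpa using this
    · have hev : ∀ᶠ p : Bands α β in 𝓝 ⟨i, x₀, hx₀⟩, ∀ k ∈ Finset.univ.erase i, ∀ s : ℝ → ℝ,
          Integrable s (arcsine (α k) (β k)) → (∀ x ∈ Set.Icc (α k) (β k), |s x| ≤ 1) →
          |(schwarz (α k) (β k) s ((x₀ : ℂ) : OnePoint ℂ)).re -
            (schwarz (α k) (β k) s (((p.2 : ℝ) : ℂ) : OnePoint ℂ)).re| ≤ b k ((p.2 : ℝ) : ℂ) :=
        (Finset.eventually_all _).2 fun k hk => hcoe.eventually (hb k hk).2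
      filter_upwards [hev, hfst] with ⟨j, y⟩ hp hpi
      obtain rfl : j = i := hpi
      rintro ⟨_, t, ht, rfl⟩
      rw [mem_closedBall_zero_iff] at ht
      change |operH α β (bandExtend hαβ t) j x₀ - operH α β (bandExtend hαβ t) j y| ≤ _
      rw [operH_eq, operH_eq, ← mul_sub, ← Finset.sum_sub_distrib, abs_mul]
      have h3 : |(-(1 / 2) : ℝ)| = 1 / 2 := by norm_num
      rw [h3]
      refine mul_le_mul_of_nonneg_left ?_ (by norm_num)
      exact (Finset.abs_sum_le_sum_abs _ _).trans (Finset.sum_le_sum fun k hk =>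
        hp k hk _ (integrable_bandExtend hαβ t k)
          fun x _ => (abs_bandExtend_le hαβ t k x).trans ht)

/-- Doubling the fixed-point equation gives the system with c = 0. -/
theorem eq_zero_of_operHCLM_eq {t : Bands α β →ᵇ ℝ} (h : operHCLM hαβ hdisj t = t) : t = 0 := by
  have key := eq_of_system_const hαβ hdisj (continuous_bandExtend hαβ t) _ Finset.univ rfl 0
    (fun i _ x hx => by
      have h1 : operHCLM hαβ hdisj t ⟨i, x, hx⟩ = t ⟨i, x, hx⟩ := by rw [h]
      rw [operHCLM_apply, operH_eq, ← bandExtend_of_mem hαβ t hx] at h1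
      simp only at h1
      linarith)
  ext ⟨i, x, hx⟩
  rw [← bandExtend_of_mem hαβ t hx, key i (Finset.mem_univ i) x hx]
  simp

/-- The Fredholm alternative: 1 is an eigenvalue, which injectivity excludes, or 1 - ℋ is
invertible. -/
theorem exists_sub_operHCLM_eq (b : Bands α β →ᵇ ℝ) : ∃ t, t - operHCLM hαβ hdisj t = b := by
  have h := (isCompactOperator_operHCLM hαβ hdisj).hasEigenvalue_or_mem_resolventSet
    (one_ne_zero (α := ℝ))
  rcases h with h | h
  · obtain ⟨t, ht⟩ := h.exists_hasEigenvector
    refine absurd (eq_zero_of_operHCLM_eq hαβ hdisj ?_) ht.2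
    have := ht.apply_eq_smul
    simpa using this
  · rw [spectrum.mem_resolventSet_iff, map_one] at h
    obtain ⟨u, hu⟩ := h
    refine ⟨(↑u⁻¹ : (Bands α β →ᵇ ℝ) →L[ℝ] (Bands α β →ᵇ ℝ)) b, ?_⟩
    have h2 : (↑u * ↑u⁻¹ : (Bands α β →ᵇ ℝ) →L[ℝ] (Bands α β →ᵇ ℝ)) b = b := by simp
    rw [hu] at h2
    simpa using h2

/-- Solvability of the system `s - ℋ s = a` in `∏ L¹(ω_i)`. -/
theorem exists_system_solution (hαβ : ∀ i, α i < β i)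
    (hdisj : ∀ i j, i ≠ j → Disjoint (Set.Icc (α i) (β i)) (Set.Icc (α j) (β j)))
    {a : Fin d → ℝ → ℝ} (ha : ∀ i, Integrable (a i) (arcsine (α i) (β i))) :
    ∃ s : Fin d → ℝ → ℝ, (∀ i, Integrable (s i) (arcsine (α i) (β i))) ∧
      ∀ i, ∀ x ∈ Set.Icc (α i) (β i), s i x - operH α β s i x = a i x := by
  -- Although a is only integrable, ℋ a is continuous. Solving t - ℋ t = ℋ a among continuous
  -- functions makes a + t a solution.
  obtain ⟨t, ht⟩ := exists_sub_operHCLM_eq hαβ hdisj (operHBand hαβ hdisj a ha)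
  have hti := integrable_bandExtend hαβ t
  refine ⟨fun j y => a j y + bandExtend hαβ t j y, fun i => (ha i).add (hti i), fun i x hx => ?_⟩
  have h1 : t ⟨i, x, hx⟩ - operHCLM hαβ hdisj t ⟨i, x, hx⟩ =
      operHBand hαβ hdisj a ha ⟨i, x, hx⟩ := by rw [← ht]; rfl
  rw [operHCLM_apply, ← bandExtend_of_mem hαβ t hx] at h1
  have h2 : operHBand hαβ hdisj a ha ⟨i, x, hx⟩ = operH α β a i x := rfl
  simp only [h2] at h1
  rw [operH_add hαβ hdisj ha hti hx]
  linarith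

/-- Uniqueness for the system `s - ℋ s = a` in `∏ L¹(ω_i)`. -/
theorem system_solution_unique (hαβ : ∀ i, α i < β i)
    (hdisj : ∀ i j, i ≠ j → Disjoint (Set.Icc (α i) (β i)) (Set.Icc (α j) (β j)))
    {a s t : Fin d → ℝ → ℝ} (hs : ∀ i, Integrable (s i) (arcsine (α i) (β i)))
    (ht : ∀ i, Integrable (t i) (arcsine (α i) (β i)))
    (hs' : ∀ i, ∀ᵐ x ∂(arcsine (α i) (β i)), s i x - operH α β s i x = a i x)
    (ht' : ∀ i, ∀ᵐ x ∂(arcsine (α i) (β i)), t i x - operH α β t i x = a i x) (i : Fin d) :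
    t i =ᵐ[arcsine (α i) (β i)] s i := by
  set δ : Fin d → ℝ → ℝ := fun j y => t j y + (-1) * s j y with hδ
  have hs1 : ∀ j, Integrable (fun y => (-1) * s j y) (arcsine (α j) (β j)) :=
    fun j => (hs j).const_mul (-1)
  have hδi : ∀ j, Integrable (δ j) (arcsine (α j) (β j)) := fun j => (ht j).add (hs1 j)
  have hop : ∀ j, ∀ x ∈ Set.Icc (α j) (β j),
      operH α β δ j x = operH α β t j x - operH α β s j x := fun j x hx => by
    rw [hδ, operH_add hαβ hdisj ht hs1 hx, operH_const_mul hαβ hdisj hs _ hx]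
    ring
  set u := operHBand hαβ hdisj δ hδi with hu
  -- The difference satisfies δ = ℋ δ a.e., so it agrees a.e. with the continuous function u = ℋ δ;
  -- as ℋ ignores null sets, u is a continuous fixed point.
  have hu1 : ∀ j, δ j =ᵐ[arcsine (α j) (β j)] bandExtend hαβ u j := fun j => by
    filter_upwards [hs' j, ht' j, ae_arcsine_mem] with x h1 h2 hx
    rw [bandExtend_of_mem hαβ u hx]
    change _ = operH α β δ j x
    rw [hop j x hx]
    simp only [hδ]
    linarith
  have hu0 : u = 0 := by
    refine eq_zero_of_operHCLM_eq hαβ hdisj ?_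
    ext p
    rw [operHCLM_apply, ← operH_congr hu1]
    rfl
  filter_upwards [hu1 i] with x hx
  rw [hu0] at hx
  simp only [hδ, bandExtend, BoundedContinuousFunction.coe_zero, Pi.zero_apply] at hx
  linarith

end CompactOperator

/-! ### Fatou's theorem on nontangential limits. -/

/-- Layer-cake formula: the superlevel set of the kernel at height l lies in a ball of radius √(δ/l)
and is empty for l > 1/δ. Integrating ε√(δ/l) over (0, 1/δ) gives exactly 2ε. -/
theorem lintegral_cauchy_closedBall_le {ρ : Measure ℝ} {θ δ ε η : ℝ} (hδ : 0 < δ) (hε : 0 ≤ ε)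
    (h : ∀ r, 0 < r → r ≤ η → ρ (Metric.closedBall θ r) ≤ ENNReal.ofReal (ε * r)) (hη : 0 < η) :
    ∫⁻ t in Metric.closedBall θ η, ENNReal.ofReal (δ / (δ ^ 2 + (t - θ) ^ 2)) ∂ρ ≤
      ENNReal.ofReal (2 * ε) := by
  have hint : IntervalIntegrable (fun l : ℝ => ε * Real.sqrt δ * l ^ (-(1 / 2) : ℝ)) volume
      0 (1 / δ) :=
    (intervalIntegral.intervalIntegrable_rpow' (by norm_num)).const_mul _
  have hval : ∫ l in (0 : ℝ)..(1 / δ), ε * Real.sqrt δ * l ^ (-(1 / 2) : ℝ) = 2 * ε := by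
    rw [intervalIntegral.integral_const_mul, integral_rpow (Or.inl (by norm_num))]
    have e : (-(1 / 2) + 1 : ℝ) = 1 / 2 := by norm_num
    rw [e, ← Real.sqrt_eq_rpow, ← Real.sqrt_eq_rpow, Real.sqrt_zero, Real.sqrt_div zero_le_one,
      Real.sqrt_one]
    have : Real.sqrt δ ≠ 0 := (Real.sqrt_pos.2 hδ).ne'
    field_simp
    ring
  rw [lintegral_eq_lintegral_meas_le _ (ae_of_all _ fun t => by positivity)
    (by fun_prop), ← hval,
    intervalIntegral.integral_of_le (by positivity), ofReal_integral_eq_lintegral_ofReal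
      ((intervalIntegrable_iff_integrableOn_Ioc_of_le (by positivity)).1 hint)
      ((ae_restrict_iff' measurableSet_Ioc).2 (ae_of_all _ fun l hl => by
        have := hl.1; simp only [Pi.zero_apply]; positivity)),
    ← lintegral_indicator measurableSet_Ioi, ← lintegral_indicator measurableSet_Ioc]
  refine lintegral_mono fun l => ?_
  by_cases hl : 0 < l
  swap
  · simp [hl]
  rw [Set.indicator_of_mem (by exact hl)]
  by_cases hl' : l ≤ 1 / δ
  swap
  · rw [Set.indicator_of_notMem (fun h => hl' h.2)]
    refine le_of_eq (measure_mono_null (fun t ht => ?_) measure_empty)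
    rw [Set.mem_ofPred_eq] at ht
    exact absurd (ht.trans (by
      rw [div_le_div_iff₀ (by positivity) hδ]; nlinarith [sq_nonneg (t - θ)])) hl'
  rw [Set.indicator_of_mem (show l ∈ Set.Ioc 0 (1 / δ) from ⟨hl, hl'⟩)]
  rw [Measure.restrict_apply (measurableSet_le measurable_const (by fun_prop))]
  have hsq : 0 < Real.sqrt (δ / l) := Real.sqrt_pos.2 (by positivity)
  refine (measure_mono (t := Metric.closedBall θ (min (Real.sqrt (δ / l)) η)) ?_).trans
    ((h _ (lt_min hsq hη) (min_le_right _ _)).trans (ENNReal.ofReal_le_ofReal ?_))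
  · rintro t ⟨ht, ht'⟩
    rw [Metric.mem_closedBall] at *
    refine le_min ?_ ht'
    rw [Real.dist_eq]
    refine Real.abs_le_sqrt ?_
    rw [Set.mem_ofPred_eq, le_div_iff₀ (by positivity)] at ht
    rw [le_div_iff₀ hl]
    nlinarith [sq_nonneg δ]
  · rw [mul_assoc]
    gcongr
    refine (min_le_left _ _).trans (le_of_eq ?_)
    rw [Real.sqrt_div hδ.le, Real.rpow_neg hl.le, ← Real.sqrt_eq_rpow, div_eq_mul_inv]

/-- Splits at distance η: the near part is small by the density of ρ at θ, and the far part vanishes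
with δ because the kernel is at most δ/η² there. -/
theorem lintegral_cauchy_le {ρ : Measure ℝ} {θ δ ε η : ℝ} (hδ : 0 < δ) (hε : 0 ≤ ε)
    (h : ∀ r, 0 < r → r ≤ η → ρ (Metric.closedBall θ r) ≤ ENNReal.ofReal (ε * r)) (hη : 0 < η) :
    ∫⁻ t, ENNReal.ofReal (δ / (δ ^ 2 + (t - θ) ^ 2)) ∂ρ ≤
      ENNReal.ofReal (2 * ε) + ENNReal.ofReal (δ / η ^ 2) * ρ Set.univ := by
  rw [← lintegral_add_compl _ (Metric.isClosed_closedBall (x := θ) (ε := η)).measurableSet]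
  refine add_le_add (lintegral_cauchy_closedBall_le hδ hε h hη) ?_
  refine (setLIntegral_mono (g := fun _ => ENNReal.ofReal (δ / η ^ 2)) measurable_const
    fun t ht => ENNReal.ofReal_le_ofReal ?_).trans ?_
  · rw [Set.mem_compl_iff, Metric.mem_closedBall, not_le, Real.dist_eq] at ht
    have : η ^ 2 ≤ (t - θ) ^ 2 := by
      rw [← sq_abs (t - θ)]; gcongr
    gcongr
    nlinarith [sq_nonneg δ]
  · rw [lintegral_const]
    gcongr
    exact Measure.restrict_le_self

/-- The nontangential approach region at the boundary point `w` of the unit disk. -/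
def stolz (K : ℝ) (w : ℂ) : Set ℂ := {ζ | ‖ζ‖ < 1 ∧ ‖ζ - w‖ ≤ K * (1 - ‖ζ‖)}

theorem norm_circleMap_sub (t θ : ℝ) :
    ‖circleMap 0 1 t - circleMap 0 1 θ‖ = 2 * |Real.sin ((t - θ) / 2)| := by
  have : circleMap 0 1 t - circleMap 0 1 θ =
      circleMap 0 1 θ * (Complex.exp (Complex.I * ((t - θ : ℝ) : ℂ)) - 1) := by
    rw [mul_sub, mul_one]
    simp only [circleMap, zero_add, Complex.ofReal_one, one_mul]
    rw [← Complex.exp_add]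
    congr 2
    push_cast
    ring
  rw [this, norm_mul, norm_circleMap_zero, abs_one, one_mul, Complex.norm_exp_I_mul_ofReal_sub_one,
    norm_mul, Real.norm_eq_abs, Real.norm_eq_abs, abs_two]

/-- As θ is interior, |t - θ| stays at most A < 2π, which keeps the half angle below π, where the
sine would vanish; q measures this gap. -/
theorem exists_chord_le {θ : ℝ} (hθ : θ ∈ Set.Ioo 0 (2 * Real.pi)) :
    ∃ c > 0, ∀ t ∈ Set.Ioc 0 (2 * Real.pi),
      c * |t - θ| ≤ ‖circleMap 0 1 t - circleMap 0 1 θ‖ := by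
  have hpi := Real.pi_pos
  set A := max θ (2 * Real.pi - θ) with hA
  have hA2 : A < 2 * Real.pi := max_lt hθ.2 (by linarith [hθ.1])
  have hA0 : 0 < A := lt_max_of_lt_left hθ.1
  set q := 1 - A / (2 * Real.pi) with hq
  have hq0 : 0 < q := by
    rw [hq, sub_pos, div_lt_one (by positivity)]; exact hA2
  have hq1 : q ≤ 1 := by
    rw [hq]; linarith [div_pos hA0 (by positivity : 0 < 2 * Real.pi)]
  refine ⟨2 / Real.pi * q, by positivity, fun t ht => ?_⟩
  rw [norm_circleMap_sub]
  have habs : |t - θ| ≤ A := by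
    rw [abs_le]
    constructor
    · linarith [le_max_left θ (2 * Real.pi - θ), ht.1]
    · linarith [le_max_right θ (2 * Real.pi - θ), ht.2]
  set x := |t - θ| / 2 with hx
  have hsin : |Real.sin ((t - θ) / 2)| = Real.sin x := by
    have hx' : x = |(t - θ) / 2| := by rw [abs_div, abs_two]
    rw [hx']
    refine (Real.abs_sin_eq_sin_abs_of_abs_le_pi ?_)
    rw [← hx']; linarith
  rw [hsin]
  have hx0 : 0 ≤ x := by positivity
  have hkey : 2 / Real.pi * q * x ≤ Real.sin x := by
    rcases le_total x (Real.pi / 2) with h | h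
    · refine le_trans ?_ (Real.mul_le_sin hx0 h)
      have : 0 ≤ 2 / Real.pi * x := by positivity
      nlinarith
    · rw [← Real.sin_pi_sub]
      refine le_trans ?_ (Real.mul_le_sin (by linarith) (by linarith))
      rw [mul_assoc]
      gcongr
      have h1 : q * x ≤ q * Real.pi := by gcongr; linarith
      have h2 : q * Real.pi = Real.pi - A / 2 := by
        rw [hq]; field_simp
      linarith
  have : |t - θ| = 2 * x := by rw [hx]; ring
  rw [this]
  linarith

/-- In a Stolz region the distance from ζ to a boundary point dominates both 1 - ‖ζ‖ and a multiple
of |t - θ|, so the Poisson kernel is dominated by a Cauchy kernel on the line. -/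
theorem re_kernel_le_cauchy {θ K c t : ℝ} (hK : 0 ≤ K) (hc : 0 < c) {ζ : ℂ}
    (hζ : ζ ∈ stolz K (circleMap 0 1 θ))
    (h : c * |t - θ| ≤ ‖circleMap 0 1 t - circleMap 0 1 θ‖) :
    (herglotzRieszKernel 0 ζ (circleMap 0 1 t)).re ≤
      2 * (1 + (1 + K) ^ 2 / c ^ 2) * ((1 - ‖ζ‖) / ((1 - ‖ζ‖) ^ 2 + (t - θ) ^ 2)) := by
  have hk := congrFun (poissonKernel_eq_re_herglotzRieszKernel (c := 0) (w := ζ))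
    (circleMap 0 1 t)
  rw [Function.comp_apply] at hk
  rw [← hk, poissonKernel_def]
  simp only [sub_zero, norm_circleMap_zero, abs_one, one_pow]
  obtain ⟨h1, h2⟩ := hζ
  set δ := 1 - ‖ζ‖ with hδ
  have hδ0 : 0 < δ := by linarith
  set N := ‖circleMap 0 1 t - ζ‖ with hN
  have hNδ : δ ≤ N := by
    have := norm_sub_norm_le (circleMap 0 1 t) ζ
    rw [norm_circleMap_zero, abs_one] at this
    linarith
  have hN2 : c * |t - θ| ≤ (1 + K) * N := by
    have := norm_sub_le_norm_sub_add_norm_sub (circleMap 0 1 t) ζ (circleMap 0 1 θ)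
    nlinarith
  have hN0 : 0 < N := by linarith
  have hden : δ ^ 2 + (t - θ) ^ 2 ≤ (1 + (1 + K) ^ 2 / c ^ 2) * N ^ 2 := by
    have e1 : δ ^ 2 ≤ N ^ 2 := by gcongr
    have e2 : (t - θ) ^ 2 ≤ (1 + K) ^ 2 / c ^ 2 * N ^ 2 := by
      rw [div_mul_eq_mul_div, le_div_iff₀ (by positivity), ← sq_abs (t - θ), ← mul_pow, ← mul_pow,
        mul_comm _ c]
      gcongr
    linarith
  have hnum : 1 - ‖ζ‖ ^ 2 ≤ 2 * δ := by nlinarith [norm_nonneg ζ]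
  rw [← mul_div_assoc, div_le_div_iff₀ (by positivity) (by positivity)]
  have hA : 0 < 1 + (1 + K) ^ 2 / c ^ 2 := by positivity
  calc (1 - ‖ζ‖ ^ 2) * (δ ^ 2 + (t - θ) ^ 2) ≤ 2 * δ * (δ ^ 2 + (t - θ) ^ 2) := by gcongr
    _ ≤ 2 * δ * ((1 + (1 + K) ^ 2 / c ^ 2) * N ^ 2) := by gcongr
    _ = _ := by ring

section Fatou

variable {E : Type*} [NormedAddCommGroup E] [NormedSpace ℝ E]

/-- The Poisson integral of a vector-valued function of the angle. -/
noncomputable def poissonAngle (h : ℝ → E) (ζ : ℂ) : E :=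
  (2 * Real.pi)⁻¹ • ∫ t in Set.Ioc 0 (2 * Real.pi),
    (herglotzRieszKernel 0 ζ (circleMap 0 1 t)).re • h t

theorem poissonIntegral_eq_poissonAngle (g : ℂ → ℝ) (ζ : ℂ) :
    poissonIntegral g ζ = poissonAngle (fun t => g (circleMap 0 1 t)) ζ := by
  rw [poissonIntegral, poissonAngle, Real.circleAverage,
    intervalIntegral.integral_of_le (by positivity)]
  rfl

theorem continuous_re_kernel_circleMap {ζ : ℂ} (hζ : ‖ζ‖ < 1) :
    Continuous fun t : ℝ => (herglotzRieszKernel 0 ζ (circleMap 0 1 t)).re :=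
  (continuousOn_re_kernel hζ).comp_continuous (continuous_circleMap 0 1) fun t => by simp

theorem integrableOn_re_kernel_smul {h : ℝ → E} (hh : IntegrableOn h (Set.Ioc 0 (2 * Real.pi)))
    {ζ : ℂ} (hζ : ‖ζ‖ < 1) :
    IntegrableOn (fun t => (herglotzRieszKernel 0 ζ (circleMap 0 1 t)).re • h t)
      (Set.Ioc 0 (2 * Real.pi)) := by
  rw [← intervalIntegrable_iff_integrableOn_Ioc_of_le (by positivity)] at *
  exact hh.continuousOn_smul (continuous_re_kernel_circleMap hζ).continuousOn

theorem poissonAngle_const [CompleteSpace E] (c : E) {ζ : ℂ} (hζ : ‖ζ‖ < 1) :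
    poissonAngle (fun _ => c) ζ = c := by
  rw [poissonAngle, integral_smul_const, smul_smul]
  have := poissonIntegral_const 1 hζ
  rw [poissonIntegral_eq_poissonAngle, poissonAngle] at this
  simp only [smul_eq_mul, mul_one] at this
  rw [this, one_smul]

theorem poissonAngle_sub_const [CompleteSpace E] {h : ℝ → E}
    (hh : IntegrableOn h (Set.Ioc 0 (2 * Real.pi))) (c : E)
    {ζ : ℂ} (hζ : ‖ζ‖ < 1) :
    poissonAngle h ζ - c = poissonAngle (fun t => h t - c) ζ := by
  conv_lhs => rw [← poissonAngle_const c hζ]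
  simp only [poissonAngle, smul_sub]
  rw [integral_sub (integrableOn_re_kernel_smul hh hζ)
    (integrableOn_re_kernel_smul (integrableOn_const measure_Ioc_lt_top.ne) hζ), smul_sub]

theorem norm_poissonAngle_le {h : ℝ → E} {θ K c ε η : ℝ}
    (hh : AEMeasurable (fun t => ‖h t‖ₑ) (volume.restrict (Set.Ioc 0 (2 * Real.pi))))
    {M : ℝ} (hM0 : 0 ≤ M)
    (hM : ∫⁻ t in Set.Ioc 0 (2 * Real.pi), ‖h t‖ₑ ≤ ENNReal.ofReal M)
    (hK : 0 ≤ K) (hc : 0 < c)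
    (hchord : ∀ t ∈ Set.Ioc 0 (2 * Real.pi),
      c * |t - θ| ≤ ‖circleMap 0 1 t - circleMap 0 1 θ‖) (hε : 0 ≤ ε) (hη : 0 < η)
    (hleb : ∀ r, 0 < r → r ≤ η →
      ∫⁻ t in Metric.closedBall θ r ∩ Set.Ioc 0 (2 * Real.pi), ‖h t‖ₑ ≤ ENNReal.ofReal (ε * r))
    {ζ : ℂ} (hζ : ζ ∈ stolz K (circleMap 0 1 θ)) :
    ‖poissonAngle h ζ‖ ≤ (2 * Real.pi)⁻¹ * (2 * (1 + (1 + K) ^ 2 / c ^ 2) *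
      (2 * ε + (1 - ‖ζ‖) / η ^ 2 * M)) := by
  have hδ : 0 < 1 - ‖ζ‖ := by linarith [hζ.1]
  set A := 2 * (1 + (1 + K) ^ 2 / c ^ 2) with hA
  have hA0 : 0 < A := by positivity
  rw [poissonAngle, norm_smul, Real.norm_of_nonneg (by positivity)]
  gcongr
  set I := volume.restrict (Set.Ioc 0 (2 * Real.pi)) with hI
  set ρ := I.withDensity (fun t => ‖h t‖ₑ) with hρ
  have hρb : ∀ r, 0 < r → r ≤ η → ρ (Metric.closedBall θ r) ≤ ENNReal.ofReal (ε * r) := by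
    intro r h0 h1
    rw [hρ, withDensity_apply _ Metric.isClosed_closedBall.measurableSet, hI,
      Measure.restrict_restrict Metric.isClosed_closedBall.measurableSet]
    exact hleb r h0 h1
  have hρu : ρ Set.univ ≤ ENNReal.ofReal M := by
    rw [hρ, withDensity_apply _ MeasurableSet.univ, Measure.restrict_univ]
    exact hM
  have hmain := lintegral_cauchy_le hδ hε hρb hη
  rw [hρ, lintegral_withDensity_eq_lintegral_mul₀ hh (by fun_prop)] at hmain
  have h1 : ‖∫ t, (herglotzRieszKernel 0 ζ (circleMap 0 1 t)).re • h t ∂I‖ₑ ≤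
      ENNReal.ofReal (A * (2 * ε + (1 - ‖ζ‖) / η ^ 2 * M)) := by
    refine (enorm_integral_le_lintegral_enorm _).trans ?_
    rw [ENNReal.ofReal_mul (p := A) hA0.le, ENNReal.ofReal_add (by positivity) (by positivity),
      ENNReal.ofReal_mul (p := (1 - ‖ζ‖) / η ^ 2) (by positivity)]
    refine le_trans ?_ (mul_le_mul_right (hmain.trans (add_le_add_right
      (mul_le_mul_right hρu _) _)) _)
    rw [← lintegral_const_mul' _ _ ENNReal.ofReal_ne_top]
    refine lintegral_mono_ae ((ae_restrict_iff' measurableSet_Ioc).2 (ae_of_all _ fun t ht => ?_))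
    have hk0 : 0 ≤ (herglotzRieszKernel 0 ζ (circleMap 0 1 t)).re :=
      re_kernel_nonneg (by simp) hζ.1
    rw [enorm_smul, Real.enorm_of_nonneg hk0, Pi.mul_apply, mul_comm ‖h t‖ₑ, ← mul_assoc,
      ← ENNReal.ofReal_mul hA0.le]
    gcongr
    exact re_kernel_le_cauchy hK hc hζ (hchord t ht)
  rw [← ofReal_norm] at h1
  exact (ENNReal.ofReal_le_ofReal_iff (by positivity)).1 h1

theorem tendsto_norm_stolz (K : ℝ) (θ : ℝ) :
    Tendsto (fun ζ : ℂ => 1 - ‖ζ‖) (𝓝[stolz K (circleMap 0 1 θ)] (circleMap 0 1 θ)) (𝓝 0) := by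
  have : ContinuousAt (fun ζ : ℂ => 1 - ‖ζ‖) (circleMap 0 1 θ) := by fun_prop
  have h2 := this.tendsto
  simp only [norm_circleMap_zero, abs_one, sub_self] at h2
  exact h2.mono_left nhdsWithin_le_nhds

/-- Fatou's theorem on nontangential limits of Poisson integrals. -/
theorem ae_tendsto_poissonAngle [CompleteSpace E] {h : ℝ → E}
    (hh : IntegrableOn h (Set.Ioc 0 (2 * Real.pi))) :
    ∀ᵐ θ : ℝ, θ ∈ Set.Ioo 0 (2 * Real.pi) → ∀ K : ℝ, 0 ≤ K →
      Tendsto (poissonAngle h) (𝓝[stolz K (circleMap 0 1 θ)] (circleMap 0 1 θ)) (𝓝 (h θ)) := by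
  -- Extension by zero, so that Lebesgue's differentiation theorem applies on the whole line.
  set h₀ : ℝ → E := (Set.Ioc 0 (2 * Real.pi)).indicator h with hh₀
  have hint : Integrable h₀ := (integrable_indicator_iff measurableSet_Ioc).2 hh
  filter_upwards [IsUnifLocDoublingMeasure.ae_tendsto_average_norm_sub volume
    hint.locallyIntegrable 1] with θ hleb hθ K hK
  have hθ' : θ ∈ Set.Ioc 0 (2 * Real.pi) := ⟨hθ.1, hθ.2.le⟩
  have hθv : h₀ θ = h θ := Set.indicator_of_mem hθ' _
  have hleb := hleb (l := 𝓝[>] (0 : ℝ)) (fun _ => θ) id tendsto_id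
    (eventually_mem_nhdsWithin.mono fun r hr => by
      simpa using (show (0 : ℝ) < r from hr).le)
  obtain ⟨c, hc, hchord⟩ := exists_chord_le hθ
  set A := 2 * (1 + (1 + K) ^ 2 / c ^ 2) with hA
  have hA0 : 0 < A := by positivity
  have hsub : IntegrableOn (fun t => h t - h θ) (Set.Ioc 0 (2 * Real.pi)) :=
    hh.sub (integrableOn_const measure_Ioc_lt_top.ne)
  set M := (∫⁻ t in Set.Ioc 0 (2 * Real.pi), ‖h t - h θ‖ₑ).toReal with hM
  have hMle : ∫⁻ t in Set.Ioc 0 (2 * Real.pi), ‖h t - h θ‖ₑ ≤ ENNReal.ofReal M := by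
    rw [hM, ENNReal.ofReal_toReal hsub.2.ne]
  rw [Metric.tendsto_nhds]
  intro e he
  -- The near part contributes A · 2ε/(2π), which this choice makes e/4; the far part tends to 0
  -- with 1 - ‖ζ‖.
  obtain ⟨ε, hε0, hε⟩ : ∃ ε > 0, (2 * Real.pi)⁻¹ * (A * (2 * ε)) < e / 2 := by
    refine ⟨e * Real.pi / (4 * A), by positivity, ?_⟩
    have := Real.pi_pos
    field_simp
    norm_num
  have hev := (hleb.eventually (gt_mem_nhds (show (0 : ℝ) < ε / 2 by positivity)))
  rw [eventually_nhdsWithin_iff, Metric.eventually_nhds_iff] at hev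
  obtain ⟨η', hη', hev⟩ := hev
  set η := η' / 2 with hη
  have hη0 : 0 < η := by positivity
  have hball : ∀ r, 0 < r → r ≤ η →
      ∫⁻ t in Metric.closedBall θ r ∩ Set.Ioc 0 (2 * Real.pi), ‖h t - h θ‖ₑ ≤
        ENNReal.ofReal (ε * r) := by
    intro r h0 h1
    have h2 := hev (y := r) (by rw [Real.dist_eq, sub_zero, abs_of_pos h0]; linarith) h0
    have hvol : volume.real (Metric.closedBall θ r) = 2 * r := by
      rw [Measure.real, Real.volume_closedBall, ENNReal.toReal_ofReal (by positivity)]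
    simp only [id] at h2
    rw [setAverage_eq, hvol, smul_eq_mul, inv_mul_lt_iff₀ (by positivity)] at h2
    have hI : IntegrableOn (fun t => h₀ t - h₀ θ) (Metric.closedBall θ r) :=
      hint.integrableOn.sub (integrableOn_const measure_closedBall_lt_top.ne)
    calc ∫⁻ t in Metric.closedBall θ r ∩ Set.Ioc 0 (2 * Real.pi), ‖h t - h θ‖ₑ
        = ∫⁻ t in Metric.closedBall θ r ∩ Set.Ioc 0 (2 * Real.pi), ‖h₀ t - h₀ θ‖ₑ := by
          refine setLIntegral_congr_fun (Metric.isClosed_closedBall.measurableSet.inter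
            measurableSet_Ioc) fun t ht => ?_
          simp only [hθv]
          rw [hh₀, Set.indicator_of_mem ht.2]
      _ ≤ ∫⁻ t in Metric.closedBall θ r, ‖h₀ t - h₀ θ‖ₑ :=
          lintegral_mono_set Set.inter_subset_left
      _ = ENNReal.ofReal (∫ t in Metric.closedBall θ r, ‖h₀ t - h₀ θ‖) :=
          (ofReal_integral_norm_eq_lintegral_enorm hI).symm
      _ ≤ _ := ENNReal.ofReal_le_ofReal (by linarith)
  have hlim : Tendsto (fun ζ : ℂ => (2 * Real.pi)⁻¹ * (A * (2 * ε + (1 - ‖ζ‖) / η ^ 2 * M)))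
      (𝓝[stolz K (circleMap 0 1 θ)] (circleMap 0 1 θ))
      (𝓝 ((2 * Real.pi)⁻¹ * (A * (2 * ε + 0 / η ^ 2 * M)))) :=
    ((((tendsto_norm_stolz K θ).div_const _).mul_const _).const_add _).const_mul _ |>.const_mul _
  have hlt : (2 * Real.pi)⁻¹ * (A * (2 * ε + 0 / η ^ 2 * M)) < e := by
    rw [zero_div, zero_mul, add_zero]; linarith
  filter_upwards [hlim.eventually (gt_mem_nhds hlt), eventually_mem_nhdsWithin] with ζ h1 h2
  rw [dist_eq_norm, poissonAngle_sub_const hh _ h2.1]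
  exact (norm_poissonAngle_le hsub.aestronglyMeasurable.enorm ENNReal.toReal_nonneg hMle hK hc
    hchord hε0.le hη0 hball h2).trans_lt h1

end Fatou

/-! ### Boundary limits of bounded holomorphic functions and of outer functions. -/

/-- Banach–Alaoglu combined with the Riesz representation. An ultrafilter replaces a subsequence, so
no separability is needed. -/
theorem exists_weak_limit {H : Type*} [NormedAddCommGroup H] [InnerProductSpace ℂ H]
    [CompleteSpace H] (F : ℕ → H) {C : ℝ} (hF : ∀ n, ‖F n‖ ≤ C) :
    ∃ (b : H) (U : Filter ℕ), U.NeBot ∧ U ≤ atTop ∧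
      ∀ y, Tendsto (fun n => inner ℂ (F n) y) U (𝓝 (inner ℂ b y)) := by
  let Φ : ℕ → WeakDual ℂ H := fun n => StrongDual.toWeakDual (InnerProductSpace.toDual ℂ H (F n))
  let U : Ultrafilter ℕ := Ultrafilter.of atTop
  obtain ⟨x, -, hx⟩ := (WeakDual.isCompact_closedBall (𝕜 := ℂ) (E := H) 0 C).ultrafilter_le_nhds
    (U.map Φ) (by
      rw [le_principal_iff, Ultrafilter.coe_map, mem_map]
      refine Filter.univ_mem' fun n => ?_
      have h1 := (InnerProductSpace.toDual ℂ H).norm_map (F n)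
      have h2 := hF n
      rw [← h1] at h2
      exact mem_closedBall_zero_iff.2 h2)
  refine ⟨(InnerProductSpace.toDual ℂ H).symm (WeakDual.toStrongDual x), U, inferInstance,
    Ultrafilter.of_le _, fun y => ?_⟩
  have h1 : Tendsto (fun n => (Φ n) y) U (𝓝 (x y)) :=
    ((WeakDual.eval_continuous y).tendsto x).comp hx
  rw [← InnerProductSpace.toDual_apply_apply, LinearIsometryEquiv.apply_symm_apply]
  exact h1

/-- A bounded holomorphic function in the unit disk is the Poisson integral of an integrable
function. -/
theorem exists_eq_poissonAngle {B : ℂ → ℂ} (hB : DifferentiableOn ℂ B (Metric.ball 0 1)) {C : ℝ}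
    (hC : ∀ ζ, ‖ζ‖ < 1 → ‖B ζ‖ ≤ C) :
    ∃ b : ℝ → ℂ, IntegrableOn b (Set.Ioc 0 (2 * Real.pi)) ∧
      ∀ ζ, ‖ζ‖ < 1 → B ζ = poissonAngle b ζ := by
  let ν : Measure ℝ := volume.restrict (Set.Ioc 0 (2 * Real.pi))
  let r : ℕ → ℝ := fun n => 1 - 1 / ((n : ℝ) + 1)
  have hr0 : ∀ n, 0 ≤ r n := fun n => by
    have : 1 / ((n : ℝ) + 1) ≤ 1 := by rw [div_le_one (by positivity)]; simp
    simp only [r]; linarith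
  have hr1 : ∀ n, r n < 1 := fun n => by
    have : 0 < 1 / ((n : ℝ) + 1) := by positivity
    simp only [r]; linarith
  have hrlim : Tendsto r atTop (𝓝 1) := by
    have := (tendsto_one_div_add_atTop_nhds_zero_nat (𝕜 := ℝ)).const_sub 1
    simpa [r] using this
  have hC0 : 0 ≤ C := (norm_nonneg _).trans (hC 0 (by simp))
  have hlt : ∀ n {ζ : ℂ}, ‖ζ‖ ≤ 1 → ‖(r n : ℂ) * ζ‖ < 1 := fun n ζ hζ => by
    rw [norm_mul, Complex.norm_real, Real.norm_of_nonneg (hr0 n)]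
    exact (mul_le_of_le_one_right (hr0 n) hζ).trans_lt (hr1 n)
  have hdiff : ∀ n, ∀ ζ : ℂ, ‖ζ‖ ≤ 1 → DifferentiableAt ℂ (fun ζ => B (r n * ζ)) ζ :=
    fun n ζ hζ => DifferentiableAt.comp ζ (hB.differentiableAt
      (Metric.isOpen_ball.mem_nhds (by simpa using hlt n hζ))) (by fun_prop)
  have hcont : ∀ n, Continuous fun t : ℝ => B (r n * circleMap 0 1 t) := fun n =>
    continuous_iff_continuousAt.2 fun t => ContinuousAt.comp (f := circleMap 0 1)
      (hdiff n _ (by simp)).continuousAt (continuous_circleMap 0 1).continuousAt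
  have hmem : ∀ n, MemLp (fun t : ℝ => B (r n * circleMap 0 1 t)) 2 ν := fun n =>
    MemLp.of_bound (hcont n).aestronglyMeasurable C
      (ae_of_all _ fun t => hC _ (hlt n (by simp)))
  -- The boundary function b is a weak L² limit of the dilates B(r_n ·), which are uniformly
  -- bounded.
  obtain ⟨b, U, hU, hUle, hb⟩ := exists_weak_limit (fun n => (hmem n).toLp _)
    (C := (measureUnivNNReal ν : ℝ) ^ (2 : ENNReal).toReal⁻¹ * C) (fun n =>
      Lp.norm_le_of_ae_bound hC0 ((hmem n).coeFn_toLp.mono fun t ht => by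
        rw [ht]; exact hC _ (hlt n (by simp))))
  have hbint : Integrable (b : ℝ → ℂ) ν := (Lp.memLp b).integrable (by norm_num)
  refine ⟨b, hbint, fun ζ hζ => ?_⟩
  have hP : MemLp (fun t : ℝ => ((herglotzRieszKernel 0 ζ (circleMap 0 1 t)).re : ℂ)) 2 ν :=
    MemLp.of_bound (Complex.continuous_ofReal.comp
      (continuous_re_kernel_circleMap hζ)).aestronglyMeasurable
      ((1 + ‖ζ‖) / (1 - ‖ζ‖)) (ae_of_all _ fun t => by
        rw [Complex.norm_real, Real.norm_of_nonneg (re_kernel_nonneg (by simp) hζ)]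
        exact re_kernel_upper (by simp) hζ)
  -- Pairing with the Poisson kernel turns weak convergence into pointwise convergence of Poisson
  -- integrals; for the dilates these are B(r_n ζ), which tend to B(ζ).
  have hinner : ∀ f : Lp ℂ 2 ν, ∀ f' : ℝ → ℂ, f =ᵐ[ν] f' →
      inner ℂ f (hP.toLp _) = starRingEnd ℂ (2 * Real.pi * poissonAngle f' ζ) := by
    intro f f' hff
    have hpi := Real.pi_ne_zero
    rw [L2.inner_def, poissonAngle, Complex.real_smul, ← mul_assoc]
    have : (2 * (Real.pi : ℂ)) * (((2 * Real.pi)⁻¹ : ℝ) : ℂ) = 1 := by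
      push_cast; field_simp
    rw [this, one_mul, ← integral_conj]
    refine integral_congr_ae ?_
    filter_upwards [hff, hP.coeFn_toLp] with t h1 h2
    rw [h1, h2, RCLike.inner_apply, Complex.real_smul, map_mul, Complex.conj_ofReal]
  have h1 := hb (hP.toLp _)
  rw [hinner b b (ae_eq_refl _)] at h1
  have h2 : ∀ n, inner ℂ ((hmem n).toLp _) (hP.toLp _) =
      starRingEnd ℂ (2 * Real.pi * B (r n * ζ)) := by
    intro n
    rw [hinner _ _ (hmem n).coeFn_toLp]
    congr 2
    have := DiffContOnCl.circleAverage_re_herglotzRieszKernel_smul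
      (f := fun ζ => B (r n * ζ)) (c := 0) (R := 1) (w := ζ)
      (DifferentiableOn.diffContOnCl (fun z hz => (hdiff n z (by
        rw [closure_ball _ one_ne_zero] at hz; simpa using hz)).differentiableWithinAt))
      (by simpa using hζ)
    rw [← this, poissonAngle, Real.circleAverage,
      intervalIntegral.integral_of_le (by positivity)]
    rfl
  simp only [h2] at h1
  have h3 : Tendsto (fun n => starRingEnd ℂ (2 * Real.pi * B (r n * ζ))) U
      (𝓝 (starRingEnd ℂ (2 * Real.pi * B ζ))) := by
    have hc : ContinuousAt (fun x : ℝ => starRingEnd ℂ (2 * Real.pi * B (x * ζ))) 1 := by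
      have hBc : ContinuousAt B ζ := (hB.differentiableAt
        (Metric.isOpen_ball.mem_nhds (by simpa using hζ))).continuousAt
      have : ContinuousAt (fun x : ℝ => B (x * ζ)) 1 :=
        ContinuousAt.comp (g := B) (f := fun x : ℝ => (x : ℂ) * ζ) (by simpa using hBc)
          (by fun_prop)
      exact Complex.continuous_conj.continuousAt.comp (this.const_mul _)
    have := hc.tendsto.comp (hrlim.mono_left hUle)
    simpa [Function.comp_def] using this
  have h4 := tendsto_nhds_unique h3 h1
  have h5 := (starRingEnd ℂ).injective h4
  exact mul_left_cancel₀ (by simp [Real.pi_ne_zero]) h5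

/-- Radii stay in a Stolz region, which lets nontangential limits be compared along a nontrivial
filter. -/
theorem tendsto_radial_stolz (θ : ℝ) :
    Tendsto (fun r : ℝ => (r : ℂ) * circleMap 0 1 θ) (𝓝[<] 1)
      (𝓝[stolz 1 (circleMap 0 1 θ)] (circleMap 0 1 θ)) := by
  refine tendsto_nhdsWithin_iff.2 ⟨?_, ?_⟩
  · have : ContinuousAt (fun r : ℝ => (r : ℂ) * circleMap 0 1 θ) 1 := by fun_prop
    have := this.tendsto
    simp only [Complex.ofReal_one, one_mul] at this
    exact this.mono_left nhdsWithin_le_nhds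
  · filter_upwards [Ioo_mem_nhdsLT (zero_lt_one (α := ℝ))] with r hr
    have h1 : ‖(r : ℂ) * circleMap 0 1 θ‖ = r := by
      simp [abs_of_pos hr.1]
    refine ⟨by rw [h1]; exact hr.2, ?_⟩
    rw [h1, one_mul]
    have : (r : ℂ) * circleMap 0 1 θ - circleMap 0 1 θ = ((r - 1 : ℝ) : ℂ) * circleMap 0 1 θ := by
      push_cast; ring
    rw [this, norm_mul, norm_circleMap_zero, Complex.norm_real, Real.norm_eq_abs, abs_one, mul_one,
      abs_sub_comm, abs_of_pos (by linarith [hr.2])]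

theorem circleIntegrable_iff_integrableOn {E : Type*} [NormedAddCommGroup E] {g : ℂ → E} :
    CircleIntegrable g 0 1 ↔
      IntegrableOn (fun t => g (circleMap 0 1 t)) (Set.Ioc 0 (2 * Real.pi)) := by
  rw [CircleIntegrable, intervalIntegrable_iff_integrableOn_Ioc_of_le (by positivity)]

theorem ae_tendsto_poissonIntegral {g : ℂ → ℝ} (hg : CircleIntegrable g 0 1) :
    ∀ᵐ θ : ℝ, θ ∈ Set.Ioo 0 (2 * Real.pi) → ∀ K : ℝ, 0 ≤ K →
      Tendsto (poissonIntegral g) (𝓝[stolz K (circleMap 0 1 θ)] (circleMap 0 1 θ))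
        (𝓝 (g (circleMap 0 1 θ))) := by
  have := ae_tendsto_poissonAngle (circleIntegrable_iff_integrableOn.1 hg)
  simpa only [funext (poissonIntegral_eq_poissonAngle g)] using this

theorem norm_cexp_herglotzIntegral {g : ℂ → ℝ} (hg : CircleIntegrable g 0 1) {ζ : ℂ}
    (hζ : ‖ζ‖ < 1) : ‖Complex.exp (herglotzIntegral g ζ)‖ = Real.exp (poissonIntegral g ζ) := by
  rw [Complex.norm_exp, re_herglotzIntegral hg hζ]

theorem ae_tendsto_norm_cexp_herglotzIntegral {g : ℂ → ℝ} (hg : CircleIntegrable g 0 1) :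
    ∀ᵐ θ : ℝ, θ ∈ Set.Ioo 0 (2 * Real.pi) → ∀ K : ℝ, 0 ≤ K →
      Tendsto (fun ζ => ‖Complex.exp (herglotzIntegral g ζ)‖)
        (𝓝[stolz K (circleMap 0 1 θ)] (circleMap 0 1 θ))
        (𝓝 (Real.exp (g (circleMap 0 1 θ)))) := by
  filter_upwards [ae_tendsto_poissonIntegral hg] with θ h hθ K hK
  refine (Real.continuous_exp.continuousAt.tendsto.comp (h hθ K hK)).congr' ?_
  filter_upwards [eventually_mem_nhdsWithin] with ζ hζ
  exact (norm_cexp_herglotzIntegral hg hζ.1).symm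

/-- The function is bounded by 1, hence a Poisson integral with Fatou limits. The modulus of the
limit is identified separately, through the Poisson integral of g. -/
theorem ae_exists_tendsto_of_nonpos {g : ℂ → ℝ} (hg : CircleIntegrable g 0 1)
    (h0 : ∀ z, g z ≤ 0) :
    ∀ᵐ θ : ℝ, θ ∈ Set.Ioo 0 (2 * Real.pi) → ∃ l : ℂ, ‖l‖ = Real.exp (g (circleMap 0 1 θ)) ∧
      ∀ K : ℝ, 0 ≤ K → Tendsto (fun ζ => Complex.exp (herglotzIntegral g ζ))
        (𝓝[stolz K (circleMap 0 1 θ)] (circleMap 0 1 θ)) (𝓝 l) := by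
  obtain ⟨b, hb, hB⟩ := exists_eq_poissonAngle
    (B := fun ζ => Complex.exp (herglotzIntegral g ζ)) (C := 1)
    (differentiableOn_herglotzIntegral hg).cexp (fun ζ hζ => by
      rw [norm_cexp_herglotzIntegral hg hζ, Real.exp_le_one_iff, ← poissonIntegral_const 0 hζ]
      refine poissonIntegral_mono hg ?_ (fun z _ => h0 z) hζ
      exact circleIntegrable_const _ _ _)
  filter_upwards [ae_tendsto_poissonAngle hb, ae_tendsto_norm_cexp_herglotzIntegral hg]
    with θ h1 h2 hθ
  have key : ∀ K : ℝ, 0 ≤ K → Tendsto (fun ζ => Complex.exp (herglotzIntegral g ζ))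
      (𝓝[stolz K (circleMap 0 1 θ)] (circleMap 0 1 θ)) (𝓝 (b θ)) := fun K hK =>
    (h1 hθ K hK).congr' (by
      filter_upwards [eventually_mem_nhdsWithin] with ζ hζ
      exact (hB ζ hζ.1).symm)
  exact ⟨b θ, tendsto_nhds_unique ((key 1 zero_le_one).norm.comp (tendsto_radial_stolz θ))
    ((h2 hθ 1 zero_le_one).comp (tendsto_radial_stolz θ)), key⟩

theorem herglotzIntegral_sub {g g' : ℂ → ℝ} {ζ : ℂ} (hg : CircleIntegrable g 0 1)
    (hg' : CircleIntegrable g' 0 1) (hζ : ‖ζ‖ < 1) : herglotzIntegral (fun z => g z - g' z) ζ =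
      herglotzIntegral g ζ - herglotzIntegral g' ζ := by
  simp only [herglotzIntegral, Complex.ofReal_sub, smul_sub]
  exact Real.circleAverage_fun_sub (circleIntegrable_kernel_smul hg hζ)
    (circleIntegrable_kernel_smul hg' hζ)

/-- An outer function in the unit disk has nontangential limits almost everywhere. -/
theorem ae_exists_tendsto_cexp_herglotzIntegral {g : ℂ → ℝ} (hg : CircleIntegrable g 0 1) :
    ∀ᵐ θ : ℝ, θ ∈ Set.Ioo 0 (2 * Real.pi) → ∃ l : ℂ, ‖l‖ = Real.exp (g (circleMap 0 1 θ)) ∧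
      ∀ K : ℝ, 0 ≤ K → Tendsto (fun ζ => Complex.exp (herglotzIntegral g ζ))
        (𝓝[stolz K (circleMap 0 1 θ)] (circleMap 0 1 θ)) (𝓝 l) := by
  have hmin : ∀ {g : ℂ → ℝ}, CircleIntegrable g 0 1 →
      CircleIntegrable (fun z => min (g z) 0) 0 1 := fun {g} hg => by
    rw [circleIntegrable_iff_integrableOn] at *
    exact hg.inf (integrable_zero _ _ _)
  have h1 := hmin hg
  have h2 := hmin hg.neg
  -- Both minima are nonpositive, so the outer function is a quotient of two functions bounded by 1.
  have heq : g = fun z => min (g z) 0 - min ((-g) z) 0 := by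
    funext z
    rw [Pi.neg_apply]
    rcases le_total (g z) 0 with h | h
    · rw [min_eq_left h, min_eq_right (by linarith), sub_zero]
    · rw [min_eq_right h, min_eq_left (by linarith)]; ring
  filter_upwards [ae_exists_tendsto_of_nonpos h1 fun z => min_le_right _ _,
    ae_exists_tendsto_of_nonpos h2 fun z => min_le_right _ _] with θ hl hm hθ
  obtain ⟨l, hl, hl'⟩ := hl hθ
  obtain ⟨m, hm, hm'⟩ := hm hθ
  -- The denominator cannot vanish in the limit: its modulus there is an exponential.
  have hm0 : m ≠ 0 := by
    rw [← norm_pos_iff, hm]; positivity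
  refine ⟨l / m, ?_, fun K hK => ?_⟩
  · rw [norm_div, hl, hm, ← Real.exp_sub]
    exact congrArg Real.exp (congrFun heq _).symm
  · refine ((hl' K hK).div (hm' K hK) hm0).congr' ?_
    filter_upwards [eventually_mem_nhdsWithin] with ζ hζ
    rw [Pi.div_apply, ← Complex.exp_sub, ← herglotzIntegral_sub h1 h2 hζ.1, ← heq]

/-! ### Nontangential approach to the slit and to the circle. -/

section Transfer

variable {α β : ℝ}

theorem joukowsky_sub_of_norm_eq_one {ζ ζ₀ : ℂ} (h : ζ ≠ 0) (h₀ : ‖ζ₀‖ = 1) :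
    joukowsky α β ζ - (affinePoint α β ζ₀.re : ℂ) =
      (β - α) / 4 * ((ζ - ζ₀) * (ζ - starRingEnd ℂ ζ₀) / ζ) := by
  rw [← joukowsky_of_norm_eq_one h₀]
  have hne : ζ₀ ≠ 0 := fun h => by simp [h] at h₀
  have : ζ₀⁻¹ = starRingEnd ℂ ζ₀ := Complex.inv_eq_conj h₀
  have h1 : ζ₀ * starRingEnd ℂ ζ₀ = 1 := by rw [← this, mul_inv_cancel₀ hne]
  unfold joukowsky
  rw [this]
  field_simp
  linear_combination -2 * ((β : ℂ) - α) * h1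

theorem im_joukowsky {ζ : ℂ} (h : ζ ≠ 0) :
    (joukowsky α β ζ).im = -((β - α) / 4 * (ζ.im * ((1 - ‖ζ‖ ^ 2) / ‖ζ‖ ^ 2))) := by
  have h1 : joukowsky α β ζ = (((α + β) / 2 : ℝ) : ℂ) + (((β - α) / 4 : ℝ) : ℂ) * (ζ + ζ⁻¹) := by
    unfold joukowsky; push_cast; rfl
  have h2 : ‖ζ‖ ≠ 0 := norm_ne_zero_iff.2 h
  rw [h1, Complex.add_im, Complex.ofReal_im, Complex.im_ofReal_mul, Complex.add_im, Complex.inv_im,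
    Complex.normSq_eq_norm_sq]
  field_simp
  ring

/-- The difference of Joukowsky values factors through (ζ - ζ₀)(ζ - conj ζ₀)/ζ. When ζ and ζ₀ are on
the same side of the real axis, the second factor is at least |Im ζ₀|. -/
theorem norm_sub_le_of_same_side (hαβ : α < β) {ζ ζ₀ : ℂ} (h : ζ ≠ 0)
    (h₀ : ‖ζ₀‖ = 1) (hside : 0 < ζ.im * ζ₀.im) :
    ‖ζ - ζ₀‖ ≤ 4 / ((β - α) * |ζ₀.im|) * ‖ζ‖ *
      ‖joukowsky α β ζ - (affinePoint α β ζ₀.re : ℂ)‖ := by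
  have hs : 0 < |ζ₀.im| := abs_pos.2 fun h => by simp [h] at hside
  have hconj : |ζ₀.im| ≤ ‖ζ - starRingEnd ℂ ζ₀‖ := by
    refine le_trans ?_ (Complex.abs_im_le_norm _)
    rw [Complex.sub_im, Complex.conj_im, sub_neg_eq_add]
    refine sq_le_sq.1 ?_
    nlinarith [sq_nonneg ζ.im]
  have hz : 0 < ‖ζ‖ := norm_pos_iff.2 h
  have hba : 0 < β - α := sub_pos.2 hαβ
  rw [joukowsky_sub_of_norm_eq_one h h₀, norm_mul, norm_ofReal_sub_eq hαβ, norm_div, norm_mul]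
  have : 4 / ((β - α) * |ζ₀.im|) * ‖ζ‖ * ((β - α) / 4 * (‖ζ - ζ₀‖ * ‖ζ - starRingEnd ℂ ζ₀‖ / ‖ζ‖))
      = ‖ζ - ζ₀‖ * (‖ζ - starRingEnd ℂ ζ₀‖ / |ζ₀.im|) := by
    field_simp
  rw [this]
  refine le_mul_of_one_le_right (norm_nonneg _) ?_
  rwa [one_le_div hs]

/-- In the cone the distance to the boundary point is controlled by |Im z|, and |Im z| is at most a
multiple of (1 - ‖ζ‖)/‖ζ‖; the factor ‖ζ‖ of the previous estimate cancels the denominator. -/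
theorem mem_stolz_of_cone (hαβ : α < β) {ζ ζ₀ : ℂ} (h : ζ ≠ 0) (h1 : ‖ζ‖ < 1)
    (h₀ : ‖ζ₀‖ = 1) (hside : 0 < ζ.im * ζ₀.im) {M : ℝ} (hM : 0 ≤ M)
    (hcone : |(joukowsky α β ζ).re - affinePoint α β ζ₀.re| ≤ M * |(joukowsky α β ζ).im|) :
    ζ ∈ stolz (2 * (M + 1) / |ζ₀.im|) ζ₀ := by
  refine ⟨h1, (norm_sub_le_of_same_side hαβ h h₀ hside).trans ?_⟩
  have hs : 0 < |ζ₀.im| := abs_pos.2 fun h => by simp [h] at hside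
  have hz : 0 < ‖ζ‖ := norm_pos_iff.2 h
  have hba : 0 < β - α := sub_pos.2 hαβ
  have hb : ‖joukowsky α β ζ - (affinePoint α β ζ₀.re : ℂ)‖ ≤
      (M + 1) * |(joukowsky α β ζ).im| := by
    refine (Complex.norm_le_abs_re_add_abs_im _).trans ?_
    rw [Complex.sub_re, Complex.sub_im, Complex.ofReal_re, Complex.ofReal_im, sub_zero]
    linarith
  have h2 : 0 < 1 - ‖ζ‖ := by linarith
  have him : |(joukowsky α β ζ).im| ≤ (β - α) / 4 * (2 * (1 - ‖ζ‖)) / ‖ζ‖ := by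
    have h3 : 0 ≤ (1 - ‖ζ‖ ^ 2) / ‖ζ‖ ^ 2 := div_nonneg (by nlinarith) (by positivity)
    rw [im_joukowsky h, abs_neg, abs_mul, abs_mul, abs_of_pos (by positivity : 0 < (β - α) / 4),
      abs_of_nonneg h3, mul_div_assoc]
    gcongr
    calc |ζ.im| * ((1 - ‖ζ‖ ^ 2) / ‖ζ‖ ^ 2) ≤ ‖ζ‖ * ((1 - ‖ζ‖ ^ 2) / ‖ζ‖ ^ 2) := by
          gcongr; exact Complex.abs_im_le_norm _
      _ = (1 - ‖ζ‖ ^ 2) / ‖ζ‖ := by field_simp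
      _ ≤ _ := by gcongr; nlinarith
  calc _ ≤ 4 / ((β - α) * |ζ₀.im|) * ‖ζ‖ * ((M + 1) *
        ((β - α) / 4 * (2 * (1 - ‖ζ‖)) / ‖ζ‖)) := by gcongr; exact hb.trans (by gcongr)
    _ = _ := by field_simp

/-- The conformal map onto the disk carries nontangential approach to an interior point of the slit
from one side to nontangential approach to a boundary point of the disk. -/
theorem tendsto_slitToDisk_stolz (hαβ : α < β) {ζ₀ : ℂ} (h₀ : ‖ζ₀‖ = 1) {σ : ℝ}
    (hσ : σ * ζ₀.im < 0) (hσ1 : |σ| = 1) {M : ℝ} (hM : 0 < M) :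
    Tendsto (fun z : ℂ => slitToDisk α β (z : OnePoint ℂ))
      (𝓝[{z : ℂ | |z.re - affinePoint α β ζ₀.re| < M * (σ * z.im)}]
        ((affinePoint α β ζ₀.re : ℝ) : ℂ)) (𝓝[stolz (2 * (M + 1) / |ζ₀.im|) ζ₀] ζ₀) := by
  have hba : 0 < β - α := sub_pos.2 hαβ
  have key : ∀ z : ℂ, |z.re - affinePoint α β ζ₀.re| < M * (σ * z.im) →
      (z : OnePoint ℂ) ∈ slitSphere α β ∧
      slitToDisk α β (z : OnePoint ℂ) ∈ stolz (2 * (M + 1) / |ζ₀.im|) ζ₀ ∧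
      ‖slitToDisk α β (z : OnePoint ℂ) - ζ₀‖ ≤ 4 / ((β - α) * |ζ₀.im|) *
        ‖z - ((affinePoint α β ζ₀.re : ℝ) : ℂ)‖ := by
    intro z hz
    have him : 0 < σ * z.im := by
      have := (abs_nonneg _).trans_lt hz
      exact pos_of_mul_pos_right this hM.le
    have hmem : (z : OnePoint ℂ) ∈ slitSphere α β := by
      rw [coe_mem_slitSphere]
      rintro x - rfl
      simp at him
    obtain ⟨ζ, h0, h1, rfl⟩ := exists_joukowsky_eq hαβ hmem
    rw [slitToDisk_joukowsky hαβ h0 h1]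
    have hz : 0 < ‖ζ‖ := norm_pos_iff.2 h0
    -- The Joukowsky map reverses the sign of the imaginary part, so the half-plane chosen by σ
    -- corresponds to the half-disk containing ζ₀ in its boundary.
    have hside : 0 < ζ.im * ζ₀.im := by
      rw [im_joukowsky h0] at him
      have hpos : 0 < (β - α) / 4 * ((1 - ‖ζ‖ ^ 2) / ‖ζ‖ ^ 2) :=
        mul_pos (by positivity) (div_pos (by nlinarith) (by positivity))
      have h2 : σ * ζ.im < 0 := by
        by_contra hcon
        push Not at hcon
        nlinarith [mul_nonneg hcon hpos.le]
      have h3 := mul_pos_of_neg_of_neg h2 hσ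
      have h4 : σ ^ 2 = 1 := by rw [← sq_abs, hσ1, one_pow]
      calc 0 < σ * ζ.im * (σ * ζ₀.im) := h3
        _ = σ ^ 2 * (ζ.im * ζ₀.im) := by ring
        _ = _ := by rw [h4, one_mul]
    refine ⟨hmem, mem_stolz_of_cone hαβ h0 h1 h₀ hside hM.le ?_, ?_⟩
    · have h5 : |(joukowsky α β ζ).im| = σ * (joukowsky α β ζ).im := by
        rw [← abs_of_pos him, abs_mul, hσ1, one_mul]
      rw [h5]
      exact le_of_lt ‹_›
    · refine (norm_sub_le_of_same_side hαβ h0 h₀ hside).trans ?_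
      gcongr
      exact mul_le_of_le_one_right (by positivity) h1.le
  refine tendsto_nhdsWithin_iff.2 ⟨?_, ?_⟩
  · rw [tendsto_iff_norm_sub_tendsto_zero]
    refine squeeze_zero' (Eventually.of_forall fun _ => norm_nonneg _)
      (g := fun z => 4 / ((β - α) * |ζ₀.im|) * ‖z - ((affinePoint α β ζ₀.re : ℝ) : ℂ)‖) ?_ ?_
    · filter_upwards [eventually_mem_nhdsWithin] with z hz
      exact (key z hz).2.2
    · have : ContinuousAt (fun z => 4 / ((β - α) * |ζ₀.im|) *
          ‖z - ((affinePoint α β ζ₀.re : ℝ) : ℂ)‖) ((affinePoint α β ζ₀.re : ℝ) : ℂ) := by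
        fun_prop
      have := this.tendsto
      simp only [sub_self, norm_zero, mul_zero] at this
      exact this.mono_left nhdsWithin_le_nhds
  · filter_upwards [eventually_mem_nhdsWithin] with z hz
    exact (key z hz).2.1

theorem mem_slitSphere_of_im_ne_zero {z : ℂ} (h : z.im ≠ 0) :
    (z : OnePoint ℂ) ∈ slitSphere α β := by
  rw [coe_mem_slitSphere]
  rintro x - rfl
  simp at h

/-- The sign of sin θ is negative because the upper side of the slit corresponds to the lower half
of the circle. -/
theorem HasLimitAbove.of_disk (hαβ : α < β) {f : OnePoint ℂ → ℂ} {F : ℂ → ℂ}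
    (hF : ∀ z ∈ slitSphere α β, f z = F (slitToDisk α β z)) {θ : ℝ} (hθ : Real.sin θ < 0) {l : ℂ}
    (hl : ∀ K : ℝ, 0 ≤ K → Tendsto F (𝓝[stolz K (circleMap 0 1 θ)] (circleMap 0 1 θ)) (𝓝 l)) :
    HasLimitAbove f (affinePoint α β (Real.cos θ)) l := by
  intro M hM
  have h1 := tendsto_slitToDisk_stolz hαβ (ζ₀ := circleMap 0 1 θ) (σ := 1) (by simp)
    (by rwa [im_circleMap, one_mul]) (by simp) hM
  simp only [one_mul, re_circleMap] at h1
  refine ((hl _ (by positivity)).comp h1).congr' ?_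
  filter_upwards [eventually_mem_nhdsWithin] with z hz
  refine (hF _ (mem_slitSphere_of_im_ne_zero fun h => ?_)).symm
  rw [h, mul_zero] at hz
  exact absurd hz (abs_nonneg _).not_gt

theorem HasLimitBelow.of_disk (hαβ : α < β) {f : OnePoint ℂ → ℂ} {F : ℂ → ℂ}
    (hF : ∀ z ∈ slitSphere α β, f z = F (slitToDisk α β z)) {θ : ℝ} (hθ : 0 < Real.sin θ) {l : ℂ}
    (hl : ∀ K : ℝ, 0 ≤ K → Tendsto F (𝓝[stolz K (circleMap 0 1 θ)] (circleMap 0 1 θ)) (𝓝 l)) :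
    HasLimitBelow f (affinePoint α β (Real.cos θ)) l := by
  intro M hM
  have h1 := tendsto_slitToDisk_stolz hαβ (ζ₀ := circleMap 0 1 θ) (σ := -1) (by simp)
    (by rw [im_circleMap]; linarith) (by simp) hM
  simp only [neg_one_mul, re_circleMap] at h1
  refine ((hl _ (by positivity)).comp h1).congr' ?_
  filter_upwards [eventually_mem_nhdsWithin] with z hz
  refine (hF _ (mem_slitSphere_of_im_ne_zero fun h => ?_)).symm
  rw [h, neg_zero, mul_zero] at hz
  exact absurd hz (abs_nonneg _).not_gt

end Transfer

/-! ### Null sets on the slit and on the circle. -/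

section NullSets

variable {α β : ℝ} {P : ℝ → Prop}

/-- The arcsine density is positive inside the interval. At the endpoints it takes the value 0,
since division by 0 gives 0, but these two points are null. -/
theorem ae_arcsine_iff :
    (∀ᵐ x ∂(arcsine α β), P x) ↔ ∀ᵐ x, x ∈ Set.Icc α β → P x := by
  rw [← ae_restrict_iff' measurableSet_Icc]
  refine ⟨fun h => ?_, fun h => arcsine_absolutelyContinuous.ae_le h⟩
  refine (withDensity_absolutelyContinuous' measurable_arcsine_density.aemeasurable ?_).ae_le h
  rw [ae_restrict_iff' measurableSet_Icc]
  filter_upwards [Set.countable_singleton α |>.ae_notMem volume,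
    Set.countable_singleton β |>.ae_notMem volume] with x h1 h2 hx
  have hx1 : 0 < x - α := sub_pos.2 (lt_of_le_of_ne hx.1 fun h => h1 h.symm)
  have hx2 : 0 < β - x := sub_pos.2 (lt_of_le_of_ne hx.2 fun h => h2 h)
  rw [ne_eq, ENNReal.ofReal_eq_zero, not_le]
  have := Real.pi_pos
  have := Real.sqrt_pos.2 (mul_pos hx1 hx2)
  positivity

/-- A differentiable map of the line sends null sets to null sets, and the two endpoints may be
discarded. -/
theorem ae_of_ae_angle (hαβ : α < β)
    (h : ∀ᵐ θ, θ ∈ Set.Ioo 0 Real.pi → P (affinePoint α β (Real.cos θ))) :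
    ∀ᵐ x, x ∈ Set.Icc α β → P x := by
  set Z := {θ | θ ∈ Set.Ioo 0 Real.pi ∧ ¬ P (affinePoint α β (Real.cos θ))} with hZ
  have hZ0 : volume Z = 0 := by
    refine measure_mono_null (fun θ hθ => ?_) (ae_iff.1 h)
    simpa [hZ, and_assoc] using hθ
  have himg : volume ((fun t => affinePoint α β (Real.cos t)) '' Z) = 0 :=
    addHaar_image_eq_zero_of_differentiableOn_of_addHaar_eq_zero volume
      (fun t _ => (hasDerivAt_affinePoint_cos t).differentiableAt.differentiableWithinAt) hZ0
  filter_upwards [Set.countable_singleton α |>.ae_notMem volume,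
    Set.countable_singleton β |>.ae_notMem volume, compl_mem_ae_iff.2 himg] with x h1 h2 h3 hx
  have hx' : x ∈ Set.Ioo α β :=
    ⟨lt_of_le_of_ne hx.1 fun h => h1 h.symm, lt_of_le_of_ne hx.2 fun h => h2 h⟩
  rw [← affinePoint_cos_image hαβ] at hx'
  obtain ⟨θ, hθ, rfl⟩ := hx'
  by_contra hcon
  exact h3 ⟨θ, ⟨hθ, hcon⟩, rfl⟩

/-- The two boundary points of the disk over a.e. point of the slit are generic. -/
theorem ae_of_ae_circle (hαβ : α < β) {Q : ℝ → Prop}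
    (hQ : ∀ᵐ θ, θ ∈ Set.Ioo 0 (2 * Real.pi) → Q θ)
    (h : ∀ θ ∈ Set.Ioo 0 Real.pi, Q θ → Q (2 * Real.pi - θ) → P (affinePoint α β (Real.cos θ))) :
    ∀ᵐ x, x ∈ Set.Icc α β → P x := by
  refine ae_of_ae_angle hαβ ?_
  have h2 := (Measure.measurePreserving_sub_left volume (2 * Real.pi)).quasiMeasurePreserving.ae hQ
  filter_upwards [hQ, h2] with θ h1 h2 hθ
  exact h θ hθ (h1 ⟨hθ.1, by linarith [hθ.1, hθ.2]⟩)
    (h2 ⟨by linarith [hθ.1, hθ.2], by linarith [hθ.1, hθ.2]⟩)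

end NullSets

/-- The angle θ in (0, π) gives the limit from below and 2π - θ the limit from above; symmetry of
the lift gives both the same modulus. -/
theorem ae_exists_limits_schwarz {α β : ℝ} (hαβ : α < β) {s : ℝ → ℝ}
    (hs : Integrable s (arcsine α β)) :
    ∀ᵐ x, x ∈ Set.Icc α β → ∃ p m : ℂ,
      HasLimitAbove (fun z => Complex.exp (schwarz α β s z)) x p ∧
      HasLimitBelow (fun z => Complex.exp (schwarz α β s z)) x m ∧
      ‖p‖ = Real.exp (s x) ∧ ‖m‖ = Real.exp (s x) := by
  have hc := (circleIntegrable_liftCircle_iff hαβ s).2 hs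
  have hF : ∀ z ∈ slitSphere α β, Complex.exp (schwarz α β s z) =
      Complex.exp (herglotzIntegral (liftCircle α β s) (slitToDisk α β z)) := fun z hz => by
    rw [schwarz_eq_herglotzIntegral hαβ hs hz]
  refine ae_of_ae_circle hαβ (ae_exists_tendsto_cexp_herglotzIntegral hc) ?_
  rintro θ hθ ⟨m, hm, hm'⟩ ⟨p, hp, hp'⟩
  have hsin := Real.sin_pos_of_mem_Ioo hθ
  refine ⟨p, m, ?_, HasLimitBelow.of_disk hαβ hF hsin hm', ?_, ?_⟩
  · rw [← Real.cos_two_pi_sub]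
    refine HasLimitAbove.of_disk hαβ hF ?_ hp'
    rw [Real.sin_two_pi_sub]; linarith
  · rw [hp, liftCircle, re_circleMap, Real.cos_two_pi_sub]
  · rw [hm, liftCircle, re_circleMap]

/-! ### The density v and the integrability of its logarithm. -/

section Density

variable {α β : ℝ}

/-- Restricting both parts of the Lebesgue decomposition of μ gives one of the restricted measure,
which determines the derivative a.e. -/
theorem rnDeriv_restrict_restrict (μ ν : Measure ℝ) [SigmaFinite μ] [SigmaFinite ν] {s : Set ℝ}
    (hs : MeasurableSet s) :
    (μ.restrict s).rnDeriv (ν.restrict s) =ᵐ[ν.restrict s] μ.rnDeriv ν := by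
  refine (Measure.eq_rnDeriv (s := (μ.singularPart ν).restrict s) (Measure.measurable_rnDeriv _ _)
    ?_ ?_).symm
  · exact (Measure.mutuallySingular_singularPart μ ν).mono Measure.restrict_le_self
      Measure.restrict_le_self
  · conv_lhs => rw [Measure.haveLebesgueDecomposition_add μ ν]
    rw [Measure.restrict_add, restrict_withDensity hs]

theorem ae_mem_Ioo_arcsine : ∀ᵐ x ∂(arcsine α β), x ∈ Set.Ioo α β := by
  rw [ae_arcsine_iff]
  filter_upwards [Set.countable_singleton α |>.ae_notMem volume,
    Set.countable_singleton β |>.ae_notMem volume] with x h1 h2 hx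
  exact ⟨lt_of_le_of_ne hx.1 fun h => h1 h.symm, lt_of_le_of_ne hx.2 fun h => h2 h⟩

/-- The chain rule for densities: division by the arcsine density. It makes log v and log μ' differ
by an explicit function. -/
theorem szegoDensity_ae_eq (μ : Measure ℝ) [IsFiniteMeasure μ] :
    szegoDensity μ α β =ᵐ[arcsine α β] fun x =>
      Real.pi * Real.sqrt ((x - α) * (β - x)) * (μ.rnDeriv volume x).toReal := by
  have hpos : ∀ x ∈ Set.Ioo α β, 0 < Real.pi * Real.sqrt ((x - α) * (β - x)) := fun x hx =>
    mul_pos Real.pi_pos (Real.sqrt_pos.2 (mul_pos (sub_pos.2 hx.1) (sub_pos.2 hx.2)))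
  have hIoo : ∀ᵐ x ∂(volume.restrict (Set.Icc α β)), x ∈ Set.Ioo α β := by
    rw [ae_restrict_iff' measurableSet_Icc, ← ae_arcsine_iff]
    exact ae_mem_Ioo_arcsine
  have h1 := Measure.rnDeriv_withDensity_right (μ.restrict (Set.Icc α β))
    (volume.restrict (Set.Icc α β)) (measurable_arcsine_density (α := α) (β := β)).aemeasurable
    (hIoo.mono fun x hx => by
      rw [ne_eq, ENNReal.ofReal_eq_zero, not_le]
      exact one_div_pos.2 (hpos x hx))
    (ae_of_all _ fun x => ENNReal.ofReal_ne_top)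
  refine arcsine_absolutelyContinuous.ae_le ?_
  filter_upwards [h1, rnDeriv_restrict_restrict μ volume (measurableSet_Icc (a := α) (b := β)),
    hIoo] with x h2 h3 hx
  change (Measure.rnDeriv _ (arcsine α β) x).toReal = _
  rw [arcsine, h2, h3, ENNReal.toReal_mul, ENNReal.toReal_inv,
    ENNReal.toReal_ofReal (one_div_pos.2 (hpos x hx)).le, one_div, inv_inv]

/-- In the angle variable the function is a constant plus log sin t, which is integrable on (0, π).
-/
theorem integrable_log_arcsine_density (hαβ : α < β) :
    Integrable (fun x => Real.log (Real.pi * Real.sqrt ((x - α) * (β - x)))) (arcsine α β) := by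
  rw [integrable_arcsine_iff_integrableOn hαβ]
  have hsin : IntegrableOn (fun t => Real.log (Real.sin t)) (Set.Ioo 0 Real.pi) :=
    ((intervalIntegrable_iff_integrableOn_Ioo_of_le Real.pi_pos.le).1 intervalIntegrable_log_sin)
  have hc : IntegrableOn (fun _ : ℝ => Real.log (Real.pi * ((β - α) / 2))) (Set.Ioo 0 Real.pi) :=
    integrableOn_const measure_Ioo_lt_top.ne
  refine (hc.add hsin).congr_fun (fun t ht => ?_) measurableSet_Ioo
  have hs : 0 < Real.sin t := Real.sin_pos_of_mem_Ioo ht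
  have hr : 0 < (β - α) / 2 := by linarith
  have : (affinePoint α β (Real.cos t) - α) * (β - affinePoint α β (Real.cos t)) =
      ((β - α) / 2 * Real.sin t) ^ 2 := by
    rw [mul_pow, Real.sin_sq]; unfold affinePoint; ring
  simp only [Pi.add_apply]
  rw [this, Real.sqrt_sq (by positivity), ← mul_assoc,
    Real.log_mul (mul_pos Real.pi_pos hr).ne' hs.ne']

theorem IsSzego.szegoDensity_pos {μ : Measure ℝ} [IsFiniteMeasure μ] (hμ : IsSzego μ α β) :
    ∀ᵐ x ∂(arcsine α β), 0 < szegoDensity μ α β x := by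
  filter_upwards [szegoDensity_ae_eq μ, hμ.pos, ae_mem_Ioo_arcsine] with x h1 h2 hx
  rw [h1]
  exact mul_pos (mul_pos Real.pi_pos (Real.sqrt_pos.2 (mul_pos (sub_pos.2 hx.1)
    (sub_pos.2 hx.2)))) h2

theorem IsSzego.integrable_log_szegoDensity (hαβ : α < β) {μ : Measure ℝ} [IsFiniteMeasure μ]
    (hμ : IsSzego μ α β) :
    Integrable (fun x => Real.log (szegoDensity μ α β x)) (arcsine α β) := by
  refine ((integrable_log_arcsine_density hαβ).add hμ.integrable_log).congr ?_
  filter_upwards [szegoDensity_ae_eq μ, hμ.pos, ae_mem_Ioo_arcsine] with x h1 h2 hx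
  rw [Pi.add_apply, h1, Real.log_mul (mul_pos Real.pi_pos (Real.sqrt_pos.2 (mul_pos
    (sub_pos.2 hx.1) (sub_pos.2 hx.2)))).ne' h2.ne']

theorem integrable_szegoDensity (μ : Measure ℝ) [IsFiniteMeasure μ] :
    Integrable (szegoDensity μ α β) (arcsine α β) :=
  Measure.integrable_toReal_rnDeriv

end Density

/-! ### Conjugate-symmetric outer functions on the slit domain. -/

section Outer

variable {α β : ℝ} {s : ℝ → ℝ}

theorem herglotzIntegral_eq_setIntegral (g : ℂ → ℝ) (ζ : ℂ) :
    herglotzIntegral g ζ = (1 / (2 * Real.pi) : ℂ) * ∫ t in Set.Ioc 0 (2 * Real.pi),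
      (Complex.exp (t * Complex.I) + ζ) / (Complex.exp (t * Complex.I) - ζ)
        * (g (circleMap 0 1 t) : ℂ) := by
  rw [herglotzIntegral, Real.circleAverage, intervalIntegral.integral_of_le (by positivity),
    Complex.real_smul]
  simp [herglotzRieszKernel_def, circleMap]

/-- The majorant of the squared modulus is the Dirichlet solution with data exp (2s), and the outer
density on the circle is the lift of exp s. -/
theorem isOuter_outerFun (hαβ : α < β) (hs : Integrable s (arcsine α β))
    (hs2 : Integrable (fun x => Real.exp (2 * s x)) (arcsine α β)) :
    IsOuter α β (outerFun α β fun x => Real.exp (s x)) := by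
  have hfun : (outerFun α β fun x => Real.exp (s x)) = fun z => Complex.exp (schwarz α β s z) :=
    funext (outerFun_exp α β s)
  rw [hfun]
  refine ⟨⟨(isHolomorphicOn_schwarz hαβ hs).cexp, fun z => (schwarz α β
    (fun x => Real.exp (2 * s x)) z).re, (isHolomorphicOn_schwarz hαβ hs2).isHarmonicOn_re,
    fun z hz => ?_⟩, 0, fun t => Real.exp (liftCircle α β s (circleMap 0 1 t)),
    fun t => Real.exp_pos _, ?_, ?_, fun ζ hζ => ?_⟩
  · refine le_trans (le_of_eq ?_) (exp_two_re_schwarz_le hαβ hs hs2 hz)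
    rw [Complex.norm_exp, ← Real.exp_nat_mul, Nat.cast_ofNat]
  · simp only [Real.log_exp]
    exact circleIntegrable_iff_integrableOn.1 ((circleIntegrable_liftCircle_iff hαβ s).2 hs)
  · refine (circleIntegrable_iff_integrableOn.1
      ((circleIntegrable_liftCircle_iff hαβ _).2 hs2)).congr_fun (fun t _ => ?_) measurableSet_Ioc
    simp only [liftCircle]
    rw [← Real.exp_nat_mul, Nat.cast_ofNat]
  · simp only [Real.log_exp]
    rw [← herglotzIntegral_eq_setIntegral, herglotzIntegral_liftCircle hαβ hs hζ]
    simp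

theorem isConjSymm_outerFun (hαβ : α < β) :
    IsConjSymm α β (outerFun α β fun x => Real.exp (s x)) := by
  intro z hz
  rw [outerFun_exp, outerFun_exp, ← Complex.exp_conj]
  congr 1
  induction z using OnePoint.rec with
  | infty =>
    rw [OnePoint.map_infty, schwarz_infty, integral_complex_ofReal, Complex.conj_ofReal]
  | coe z => exact schwarz_conj hαβ hz

theorem outerFun_infty_pos (α β : ℝ) (s : ℝ → ℝ) :
    (outerFun α β (fun x => Real.exp (s x)) OnePoint.infty).im = 0 ∧
      0 < (outerFun α β (fun x => Real.exp (s x)) OnePoint.infty).re := by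
  rw [outerFun_exp, schwarz_infty, integral_complex_ofReal, ← Complex.ofReal_exp]
  exact ⟨Complex.ofReal_im _, by rw [Complex.ofReal_re]; positivity⟩

theorem diskToSlit_conj (ζ : ℂ) :
    diskToSlit α β (starRingEnd ℂ ζ) = OnePoint.map (starRingEnd ℂ) (diskToSlit α β ζ) := by
  by_cases h : ζ = 0
  · rw [h, map_zero, diskToSlit_zero, OnePoint.map_infty]
  · rw [diskToSlit_of_ne_zero h, diskToSlit_of_ne_zero (by simpa using h), joukowsky_conj,
      OnePoint.map_some]

theorem continuous_kernel_circleMap {ζ : ℂ} (hζ : ‖ζ‖ < 1) :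
    Continuous fun t : ℝ => herglotzRieszKernel 0 ζ (circleMap 0 1 t) :=
  (continuousOn_herglotzRieszKernel_sphere (c := 0) (R := 1) (by simpa using hζ)).comp_continuous
    (continuous_circleMap 0 1) fun t => by simp

theorem re_setIntegral_kernel {h : ℝ → ℝ} (hh : IntegrableOn h (Set.Ioc 0 (2 * Real.pi)))
    {ζ : ℂ} (hζ : ‖ζ‖ < 1) :
    ((1 / (2 * Real.pi) : ℂ) * ∫ t in Set.Ioc 0 (2 * Real.pi),
      (Complex.exp (t * Complex.I) + ζ) / (Complex.exp (t * Complex.I) - ζ) * (h t : ℂ)).re =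
      poissonAngle h ζ := by
  have hk : ∀ t : ℝ, (Complex.exp (t * Complex.I) + ζ) / (Complex.exp (t * Complex.I) - ζ) =
      herglotzRieszKernel 0 ζ (circleMap 0 1 t) := fun t => by
    simp [herglotzRieszKernel_def, circleMap]
  simp only [hk]
  have hint : IntegrableOn (fun t => herglotzRieszKernel 0 ζ (circleMap 0 1 t) * (h t : ℂ))
      (Set.Ioc 0 (2 * Real.pi)) := by
    have h2 : IntegrableOn (fun t => (h t : ℂ)) (Set.Ioc 0 (2 * Real.pi)) := hh.ofReal
    rw [← intervalIntegrable_iff_integrableOn_Ioc_of_le (by positivity)] at *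
    exact h2.continuousOn_mul (continuous_kernel_circleMap hζ).continuousOn
  have hc : (1 / (2 * Real.pi) : ℂ) = (((2 * Real.pi)⁻¹ : ℝ) : ℂ) := by push_cast; rw [one_div]
  rw [hc, Complex.re_ofReal_mul, poissonAngle, smul_eq_mul]
  congr 1
  rw [← RCLike.re_eq_complex_re, ← integral_re hint]
  simp

theorem cexp_I_eq_one_of_pos {γ x : ℝ} (him : (Complex.exp (γ * Complex.I) *
    Complex.exp (x : ℂ)).im = 0) (hre : 0 < (Complex.exp (γ * Complex.I) *
    Complex.exp (x : ℂ)).re) : Complex.exp (γ * Complex.I) = 1 := by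
  rw [← Complex.ofReal_exp, Complex.im_mul_ofReal] at him
  rw [← Complex.ofReal_exp, Complex.re_mul_ofReal] at hre
  have h1 := (mul_eq_zero.1 him).resolve_right (Real.exp_pos x).ne'
  have h2 := pos_of_mul_pos_left hre (Real.exp_pos x).le
  have h3 := Complex.norm_exp_ofReal_mul_I γ
  have h4 : Complex.exp (γ * Complex.I) = ((Complex.exp (γ * Complex.I)).re : ℂ) :=
    Complex.ext (Complex.ofReal_re _).symm (by rw [h1, Complex.ofReal_im])
  rw [h4, Complex.norm_real, Real.norm_of_nonneg h2.le] at h3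
  rw [h4, h3, Complex.ofReal_one]

/-- A conjugate-symmetric outer function is determined by a real density on the slit. -/
theorem IsOuter.exists_eq_cexp_schwarz (hαβ : α < β) {G : OnePoint ℂ → ℂ} (hG : IsOuter α β G)
    (hsymm : IsConjSymm α β G) (him : (G OnePoint.infty).im = 0)
    (hre : 0 < (G OnePoint.infty).re) :
    ∃ s : ℝ → ℝ, Integrable s (arcsine α β) ∧
      ∀ z ∈ slitSphere α β, G z = Complex.exp (schwarz α β s z) := by
  obtain ⟨-, γ, ψ, -, hlog, -, hF⟩ := hG
  beta_reduce at hF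
  have hpi := Real.pi_pos
  have hnorm : ∀ ζ : ℂ, ‖ζ‖ < 1 → ‖G (diskToSlit α β ζ)‖ =
      Real.exp (poissonAngle (fun t => Real.log (ψ t)) ζ) := fun ζ hζ => by
    rw [hF ζ hζ, norm_mul, Complex.norm_exp_ofReal_mul_I, one_mul, Complex.norm_exp,
      re_setIntegral_kernel hlog hζ]
  -- Symmetry of G makes |G| symmetric, hence also the Poisson integral of log ψ.
  have hconj : ∀ ζ : ℂ, ‖ζ‖ < 1 → poissonAngle (fun t => Real.log (ψ t)) (starRingEnd ℂ ζ) =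
      poissonAngle (fun t => Real.log (ψ t)) ζ := fun ζ hζ => by
    have h1 := hnorm (starRingEnd ℂ ζ) (by rwa [Complex.norm_conj])
    rw [diskToSlit_conj, hsymm _ (diskToSlit_mem hαβ hζ), Complex.norm_conj, hnorm ζ hζ] at h1
    exact (Real.exp_injective h1).symm
  have hfatou : ∀ᵐ θ : ℝ, θ ∈ Set.Ioo 0 (2 * Real.pi) → Tendsto (fun r : ℝ => poissonAngle
      (fun t => Real.log (ψ t)) (r * circleMap 0 1 θ)) (𝓝[<] 1) (𝓝 (Real.log (ψ θ))) := by
    filter_upwards [ae_tendsto_poissonAngle hlog] with θ h hθ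
    exact (h hθ 1 zero_le_one).comp (tendsto_radial_stolz θ)
  -- Radial Fatou limits recover log ψ from its Poisson integral, so log ψ itself is even about the
  -- real axis a.e.
  have hev : ∀ᵐ θ : ℝ, θ ∈ Set.Ioo 0 (2 * Real.pi) →
      Real.log (ψ (2 * Real.pi - θ)) = Real.log (ψ θ) := by
    have h2 := (Measure.measurePreserving_sub_left volume
      (2 * Real.pi)).quasiMeasurePreserving.ae hfatou
    filter_upwards [hfatou, h2] with θ h1 h2 hθ
    refine tendsto_nhds_unique (h2 ⟨by linarith [hθ.2], by linarith [hθ.1]⟩)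
      ((h1 hθ).congr' ?_)
    filter_upwards [Ioo_mem_nhdsLT (zero_lt_one (α := ℝ))] with r hr
    rw [← hconj _ (by simpa [abs_of_pos hr.1] using hr.2)]
    congr 1
    rw [map_mul, Complex.conj_ofReal]
    congr 1
    refine Complex.ext ?_ ?_
    · rw [Complex.conj_re, re_circleMap, re_circleMap, Real.cos_two_pi_sub]
    · rw [Complex.conj_im, im_circleMap, im_circleMap, Real.sin_two_pi_sub]
  -- An even function of the angle descends to the slit; `arccos` picks the representative in [0,
  -- π].
  set s : ℝ → ℝ := fun x =>
    Real.log (ψ (Real.arccos ((x - (α + β) / 2) * (2 / (β - α))))) with hs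
  have hba : β - α ≠ 0 := (sub_pos.2 hαβ).ne'
  have hsx : ∀ t ∈ Set.Icc 0 Real.pi, s (affinePoint α β (Real.cos t)) = Real.log (ψ t) := by
    intro t ht
    have : (affinePoint α β (Real.cos t) - (α + β) / 2) * (2 / (β - α)) = Real.cos t := by
      unfold affinePoint; field_simp; ring
    simp only [hs]
    rw [this, Real.arccos_cos ht.1 ht.2]
  have hsint : Integrable s (arcsine α β) := by
    rw [integrable_arcsine_iff_integrableOn hαβ]
    refine IntegrableOn.congr_fun (hlog.mono_set fun t ht => ⟨ht.1, by linarith [ht.1, ht.2]⟩)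
      (fun t ht => (hsx t ⟨ht.1.le, ht.2.le⟩).symm) measurableSet_Ioo
  have hae : ∀ᵐ t, t ∈ Set.Ioc 0 (2 * Real.pi) →
      liftCircle α β s (circleMap 0 1 t) = Real.log (ψ t) := by
    filter_upwards [hev, Set.countable_singleton (2 * Real.pi) |>.ae_notMem volume]
      with t h1 h2 ht
    rw [liftCircle, re_circleMap]
    rcases le_total t Real.pi with h | h
    · exact hsx t ⟨ht.1.le, h⟩
    · rw [← Real.cos_two_pi_sub, hsx _ ⟨by linarith [ht.2], by linarith⟩]
      exact h1 ⟨ht.1, lt_of_le_of_ne ht.2 h2⟩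
  have hF' : ∀ ζ : ℂ, ‖ζ‖ < 1 → G (diskToSlit α β ζ) =
      Complex.exp (γ * Complex.I) * Complex.exp (schwarz α β s (diskToSlit α β ζ)) := by
    intro ζ hζ
    rw [hF ζ hζ, ← herglotzIntegral_liftCircle hαβ hsint hζ, herglotzIntegral_eq_setIntegral]
    congr 3
    refine setIntegral_congr_ae measurableSet_Ioc ?_
    filter_upwards [hae] with t ht htt
    rw [ht htt]
  -- At infinity the exponential of the integral is positive, so positivity of G there leaves no
  -- room for a phase.
  have hγ : Complex.exp (γ * Complex.I) = 1 := by
    have h0 := hF' 0 (by simp)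
    rw [diskToSlit_zero, schwarz_infty, integral_complex_ofReal] at h0
    rw [h0] at him hre
    exact cexp_I_eq_one_of_pos him hre
  refine ⟨s, hsint, fun z hz => ?_⟩
  obtain ⟨ζ, hζ, rfl⟩ := exists_diskToSlit_eq hαβ hz
  rw [hF' ζ hζ, hγ, one_mul]

/-- The limits of a given family are only asserted to exist; uniqueness identifies them with those
of the exponential representation. The cone filter is nontrivial because it contains a vertical
segment. -/
theorem HasLimitAbove.unique {f : OnePoint ℂ → ℂ} {x : ℝ} {p q : ℂ} (hp : HasLimitAbove f x p)
    (hq : HasLimitAbove f x q) : p = q := by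
  have : (𝓝[{z : ℂ | |z.re - x| < 1 * z.im}] (x : ℂ)).NeBot := by
    have h : Tendsto (fun ε : ℝ => (x : ℂ) + ε * Complex.I) (𝓝[>] 0)
        (𝓝[{z : ℂ | |z.re - x| < 1 * z.im}] (x : ℂ)) := by
      refine tendsto_nhdsWithin_iff.2 ⟨?_, ?_⟩
      · have : ContinuousAt (fun ε : ℝ => (x : ℂ) + ε * Complex.I) 0 := by fun_prop
        have := this.tendsto
        simp only [Complex.ofReal_zero, zero_mul, add_zero] at this
        exact this.mono_left nhdsWithin_le_nhds
      · filter_upwards [eventually_mem_nhdsWithin] with ε hε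
        simpa using hε
    exact h.neBot
  exact tendsto_nhds_unique (hp 1 one_pos) (hq 1 one_pos)

theorem HasLimitAbove.congr {f g : OnePoint ℂ → ℂ} {x : ℝ} {p : ℂ} (hp : HasLimitAbove f x p)
    (h : Set.EqOn f g (slitSphere α β)) : HasLimitAbove g x p := by
  intro M hM
  refine (hp M hM).congr' ?_
  filter_upwards [eventually_mem_nhdsWithin] with z hz
  refine h (mem_slitSphere_of_im_ne_zero fun h => ?_)
  rw [h, mul_zero] at hz
  exact absurd hz (abs_nonneg _).not_gt

end Outer

/-! ### Equivalence of the boundary relations and the linear system. -/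

section Family

variable {d : ℕ} {α β : Fin d → ℝ}

/-- Off its own slit each factor is real and positive on the axis by conjugate symmetry, so the
complex product loses nothing when written with real parts. -/
theorem prod_cexp_schwarz (hαβ : ∀ i, α i < β i)
    (hdisj : ∀ i j, i ≠ j → Disjoint (Set.Icc (α i) (β i)) (Set.Icc (α j) (β j)))
    (s : Fin d → ℝ → ℝ) (i : Fin d) {x : ℝ} (hx : x ∈ Set.Icc (α i) (β i)) :
    ∏ j ∈ Finset.univ.erase i, Complex.exp (schwarz (α j) (β j) (s j) ((x : ℂ) : OnePoint ℂ)) =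
      (Real.exp (-(2 * operH α β s i x)) : ℂ) := by
  have h : ∀ j ∈ Finset.univ.erase i,
      Complex.exp (schwarz (α j) (β j) (s j) ((x : ℂ) : OnePoint ℂ)) =
        ((Real.exp (schwarz (α j) (β j) (s j) ((x : ℂ) : OnePoint ℂ)).re : ℝ) : ℂ) := by
    intro j hj
    have hne : i ≠ j := (Finset.ne_of_mem_erase hj).symm
    have him := im_schwarz_ofReal (s := s j) (hαβ j) (mem_slitSphere_of_ne hdisj hne hx)
    rw [Complex.ofReal_exp]
    congr 1
    exact Complex.ext (by simp) (by rw [him]; simp)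
  rw [Finset.prod_congr rfl h, ← Complex.ofReal_prod, ← Real.exp_sum, operH_eq]
  congr 2
  ring

variable {μ : Fin d → Measure ℝ}

theorem isSzegoFamily_outerFun (hαβ : ∀ i, α i < β i)
    (hdisj : ∀ i j, i ≠ j → Disjoint (Set.Icc (α i) (β i)) (Set.Icc (α j) (β j)))
    (hfin : ∀ i, IsFiniteMeasure (μ i)) (hμ : ∀ i, IsSzego (μ i) (α i) (β i))
    {s : Fin d → ℝ → ℝ} (hs : SolvesSystem α β μ s) :
    IsSzegoFamily α β μ fun i => outerFun (α i) (β i) fun x => Real.exp (s i x) := by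
  intro i
  have hsi := fun i => (hs i).1
  have hv : ∀ᵐ x ∂(arcsine (α i) (β i)), Real.exp (2 * s i x) * Real.exp (-(2 * operH α β s i x)) =
      szegoDensity (μ i) (α i) (β i) x := by
    filter_upwards [(hs i).2, (hμ i).szegoDensity_pos] with x h1 h2
    rw [← Real.exp_add, ← Real.exp_log h2]
    congr 1
    linarith
  have hcont : ContinuousOn (fun x => Real.exp (2 * operH α β s i x)) (Set.Icc (α i) (β i)) :=
    Real.continuous_exp.comp_continuousOn ((continuousOn_operH hαβ hdisj hsi i).const_mul 2)
  obtain ⟨C, hC⟩ := isCompact_Icc.exists_bound_of_continuousOn hcont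
  -- The system gives exp (2 s) = v · exp (2 ℋ s), a product of an integrable function and a bounded
  -- one; this places `S_i` in H².
  have hs2 : Integrable (fun x => Real.exp (2 * s i x)) (arcsine (α i) (β i)) := by
    refine ((integrable_szegoDensity (α := α i) (β := β i) (μ i)).bdd_mul (c := C)
      (integrable_arcsine_of_continuousOn (hαβ i) hcont).aestronglyMeasurable
      (ae_arcsine_mem.mono fun x hx => hC x hx)).congr ?_
    filter_upwards [hv] with x hx
    rw [← hx, mul_comm, mul_assoc, ← Real.exp_add, neg_add_cancel, Real.exp_zero, mul_one]
  refine ⟨isOuter_outerFun (hαβ i) (hsi i) hs2, isConjSymm_outerFun (hαβ i),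
    outerFun_infty_pos _ _ _, ?_⟩
  filter_upwards [ae_exists_limits_schwarz (hαβ i) (hsi i), ae_arcsine_iff.1 hv] with x h1 h2 hx
  obtain ⟨p, m, hp, hm, hpn, hmn⟩ := h1 hx
  have hprod : ((Real.exp (s i x) ^ 2 : ℝ) : ℂ) * ∏ j ∈ Finset.univ.erase i,
      outerFun (α j) (β j) (fun x => Real.exp (s j x)) ((x : ℂ) : OnePoint ℂ) =
      (szegoDensity (μ i) (α i) (β i) x : ℂ) := by
    simp only [outerFun_exp]
    rw [prod_cexp_schwarz hαβ hdisj s i hx, ← Complex.ofReal_mul, ← h2 hx, ← Real.exp_nat_mul,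
      Nat.cast_ofNat]
  refine ⟨p, m, ?_, ?_, by rw [hpn]; exact hprod, by rw [hmn]; exact hprod⟩
  · rwa [funext (outerFun_exp (α i) (β i) (s i))]
  · rwa [funext (outerFun_exp (α i) (β i) (s i))]

/-- Each member is the exponential of some `schwarz` integral, and the logarithm of the boundary
relation is the linear system. Limits from above alone suffice. -/
theorem IsSzegoFamily.exists_solvesSystem (hαβ : ∀ i, α i < β i)
    (hdisj : ∀ i j, i ≠ j → Disjoint (Set.Icc (α i) (β i)) (Set.Icc (α j) (β j)))
    {T : Fin d → OnePoint ℂ → ℂ} (hT : IsSzegoFamily α β μ T) :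
    ∃ t : Fin d → ℝ → ℝ, SolvesSystem α β μ t ∧ ∀ i, ∀ z ∈ slitSphere (α i) (β i),
      T i z = Complex.exp (schwarz (α i) (β i) (t i) z) := by
  choose t ht htT using fun i => (hT i).1.exists_eq_cexp_schwarz (hαβ i) (hT i).2.1
    (hT i).2.2.1.1 (hT i).2.2.1.2
  refine ⟨t, fun i => ⟨ht i, ae_arcsine_iff.2 ?_⟩, htT⟩
  filter_upwards [ae_exists_limits_schwarz (hαβ i) (ht i), (hT i).2.2.2] with x h1 h2 hx
  obtain ⟨p, -, hp, -, hpn, -⟩ := h1 hx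
  obtain ⟨q, -, hq, -, hv, -⟩ := h2 hx
  have hpq : q = p := (hq.congr (htT i)).unique hp
  rw [hpq, hpn, Finset.prod_congr rfl fun j hj => htT j _ (mem_slitSphere_of_ne hdisj
    (Finset.ne_of_mem_erase hj).symm hx), prod_cexp_schwarz hαβ hdisj t i hx,
    ← Complex.ofReal_mul, Complex.ofReal_inj] at hv
  rw [← hv, ← Real.exp_nat_mul, ← Real.exp_add, Real.log_exp]
  push_cast
  ring

end Family

end SzegoSystem

/-! ### The proposition. -/

theorem proposition3p1 (d : ℕ) (α β : Fin d → ℝ) (hαβ : ∀ i, α i < β i)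
    (hdisj : ∀ i j, i ≠ j → Disjoint (Set.Icc (α i) (β i)) (Set.Icc (α j) (β j)))
    (μ : Fin d → MeasureTheory.Measure ℝ) (hfin : ∀ i, MeasureTheory.IsFiniteMeasure (μ i))
    (hμ : ∀ i, SzegoSystem.IsSzego (μ i) (α i) (β i)) :
    ∃ S : Fin d → OnePoint ℂ → ℂ,
      SzegoSystem.IsSzegoFamily α β μ S ∧
      (∀ T : Fin d → OnePoint ℂ → ℂ, SzegoSystem.IsSzegoFamily α β μ T →
        ∀ i, Set.EqOn (T i) (S i) (SzegoSystem.slitSphere (α i) (β i))) ∧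
      ∃ s : Fin d → ℝ → ℝ,
        SzegoSystem.SolvesSystem α β μ s ∧
        (∀ t : Fin d → ℝ → ℝ, SzegoSystem.SolvesSystem α β μ t →
          ∀ i, t i =ᵐ[SzegoSystem.arcsine (α i) (β i)] s i) ∧
        ∀ i, Set.EqOn (S i)
          (SzegoSystem.outerFun (α i) (β i) (fun x => Real.exp (s i x)))
          (SzegoSystem.slitSphere (α i) (β i)) := by
  obtain ⟨s, hsint, hs⟩ := SzegoSystem.exists_system_solution hαβ hdisj
    (a := fun i x => 1 / 2 * Real.log (SzegoSystem.szegoDensity (μ i) (α i) (β i) x))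
    fun i => ((hμ i).integrable_log_szegoDensity (hαβ i)).const_mul _
  have hsol : SzegoSystem.SolvesSystem α β μ s := fun i =>
    ⟨hsint i, SzegoSystem.ae_arcsine_mem.mono fun x hx => hs i x hx⟩
  have huniq : ∀ t : Fin d → ℝ → ℝ, SzegoSystem.SolvesSystem α β μ t →
      ∀ i, t i =ᵐ[SzegoSystem.arcsine (α i) (β i)] s i := fun t ht =>
    SzegoSystem.system_solution_unique hαβ hdisj hsint (fun i => (ht i).1)
      (fun i => (hsol i).2) fun i => (ht i).2
  refine ⟨fun i => SzegoSystem.outerFun (α i) (β i) fun x => Real.exp (s i x),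
    SzegoSystem.isSzegoFamily_outerFun hαβ hdisj hfin hμ hsol, fun T hT i z hz => ?_,
    s, hsol, huniq, fun i z _ => rfl⟩
  -- Uniqueness of the family comes from that of the system: `schwarz` depends only on the a.e.
  -- class of its data.
  obtain ⟨t, ht, htT⟩ := hT.exists_solvesSystem hαβ hdisj
  beta_reduce
  rw [htT i z hz, SzegoSystem.outerFun_exp, SzegoSystem.schwarz_congr (huniq t ht i)]
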